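/- Let $(P,\alpha)$ be a generalised Boothby--Wang fibration: $P$ is a closed manifold of dimension $2n+1$ ($n\ge 0$) with a contact form $\alpha$ whose Reeb field $R$ (defined by $\alpha(R)=1$, $\iota_R d\alpha=0$) generates a smooth action of $S^1=\{e^{i\varphi}\}$ on $P$, in the sense that $t\mapsto e^{it}*p$ is an integral curve of $R$ for every $p\in P$, and all stabilisers of this action are finite (the action is ``semi-free''). Let $L=P\times_{S^1}\mathbb{C}$ be the quotient of $P\times\mathbb{C}$ by the identification of $(p,z)$ with $(e^{-i\varphi}*p,\,e^{i\varphi}z)$ for all $e^{i\varphi}\in S^1$, let $q:P\times\mathbb{C}\to L$, $(p,z)\mapsto[p,z]$, be the projection, and embed $P$ in $L$ by $p\mapsto[p,1]$. Then $L$ is an effective orbifold of dimension $2n+2$ for which $q$ is a smooth submersion (it lifts locally to submersions into the orbifold charts), and $L$ carries a symplectic orbifold form $\Omega$ with $$q^*\Omega=\tfrac12\,d(|z|^2)\wedge\alpha+dx\wedge dy+\tfrac{1+|z|^2}{2}\,d\alpha,\qquad z=x+iy.$$ All orbifold singularities of $L$ lie on the zero section $\{[p,0]\}$. On the complement of the zero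 section there is a Liouville vector field $Y$ of $\Omega$ (that is, $\mathcal{L}_Y\Omega=d(\iota_Y\Omega)=\Omega$). The unit disc bundle $D=\{[p,z] : |z|\le 1\}$ is a compact domain whose smooth boundary lies in the regular part of $L$ and is the smoothly embedded copy of $P$; the field $Y$ is transverse to this boundary and points out of $D$, and the pullback of $\iota_Y\Omega$ to $P$ is $\alpha$. Thus $(D,\Omega)$ is a convex filling of $(P,\alpha)$ by a symplectic orbifold. -/

import Mathlib

open Set Filter Topology
open scoped Manifold ContDiff

noncomputable section

/-! ## Differential forms on manifolds without boundary -/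

section Manifold

variable {E : Type*} [NormedAddCommGroup E] [NormedSpace ℝ E]
  {H : Type*} [TopologicalSpace H] (I : ModelWithCorners ℝ E H)
  (M : Type*) [TopologicalSpace M] [ChartedSpace H M]

/-- A (not necessarily smooth) differential `k`-form on the manifold `M`. -/
abbrev ManifoldForm (k : ℕ) : Type _ := ∀ p : M, TangentSpace I p [⋀^Fin k]→L[ℝ] ℝ

variable {I M}

namespace ManifoldForm

/-- The expression of a form in the preferred chart at `p`: its pullback under the inverse of the
chart, a form on the target of the chart. -/
def inChart {k : ℕ} (η : ManifoldForm I M k) (p : M) : E → E [⋀^Fin k]→L[ℝ] ℝ := fun y =>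
  (η ((extChartAt I p).symm y)).compContinuousLinearMap
    (mfderiv 𝓘(ℝ, E) I (extChartAt I p).symm y)

/-- Smoothness of a form: smoothness of its chart expressions. -/
def IsSmooth {k : ℕ} (η : ManifoldForm I M k) : Prop :=
  ∀ p : M, ContDiffOn ℝ ∞ (η.inChart p) (extChartAt I p).target

/-- The exterior derivative of a form, computed in the preferred chart at each point. -/
def d {k : ℕ} (η : ManifoldForm I M k) : ManifoldForm I M (k + 1) := fun p =>
  (extDeriv (η.inChart p) (extChartAt I p p)).compContinuousLinearMap
    (mfderiv I 𝓘(ℝ, E) (extChartAt I p) p)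

/-- A contact form: a smooth nowhere vanishing `1`-form `α` such that `dα` is nondegenerate on the
hyperplane `ker α` at each point. -/
structure IsContact (α : ManifoldForm I M 1) : Prop where
  smooth : α.IsSmooth
  ne_zero : ∀ p, α p ≠ 0
  nondegenerate : ∀ (p : M) (v : TangentSpace I p), α p ![v] = 0 → v ≠ 0 →
    ∃ w : TangentSpace I p, α p ![w] = 0 ∧ α.d p ![v, w] ≠ 0

/-- `R` is the Reeb vector field of `α`. -/
def IsReeb (α : ManifoldForm I M 1) (R : ∀ p : M, TangentSpace I p) : Prop :=
  ∀ p, α p ![R p] = 1 ∧ ∀ v : TangentSpace I p, α.d p ![R p, v] = 0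

/-- `α` is a contact form whose Reeb field generates the given smooth circle action, and all
stabilisers of the action are finite.  (With compactness of `M`, which is a separate assumption,
this is a generalised Boothby-Wang fibration.) -/
structure IsGeneralisedBoothbyWang [MulAction Circle M] (α : ManifoldForm I M 1) : Prop where
  contact : α.IsContact
  smooth_action : ContMDiff ((𝓡 1).prod I) I ∞ (fun x : Circle × M => x.1 • x.2)
  generated : ∃ R : ∀ p : M, TangentSpace I p, α.IsReeb R ∧
    ∀ p : M, IsMIntegralCurve (I := I) (fun t : ℝ => Circle.exp t • p) R
  finite_stabilizer : ∀ p : M, Finite (MulAction.stabilizer Circle p)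

end ManifoldForm

end Manifold

/-! ## Orbifolds -/

section Orbifold

/-- An orbifold chart of dimension `m` on `X`: a connected open set `dom` of `ℝ^m`, a finite group
`G` acting on it effectively by diffeomorphisms, and a map `toFun` from `dom` to `X` which
induces a homeomorphism from `dom / G` onto an open subset of `X`. -/
structure OrbifoldChart (m : ℕ) (X : Type*) [TopologicalSpace X] where
  dom : Set (EuclideanSpace ℝ (Fin m))
  isOpen_dom : IsOpen dom
  isConnected_dom : IsConnected dom
  G : Type
  [group : Group G]
  [finite : Finite G]
  act : G → EuclideanSpace ℝ (Fin m) → EuclideanSpace ℝ (Fin m)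
  act_mem : ∀ g, ∀ x ∈ dom, act g x ∈ dom
  one_act : ∀ x ∈ dom, act 1 x = x
  mul_act : ∀ g h, ∀ x ∈ dom, act (g * h) x = act g (act h x)
  contDiffOn_act : ∀ g, ContDiffOn ℝ ∞ (act g) dom
  effective : ∀ g, (∀ x ∈ dom, act g x = x) → g = 1
  toFun : EuclideanSpace ℝ (Fin m) → X
  continuousOn_toFun : ContinuousOn toFun dom
  isOpen_image : ∀ V ⊆ dom, IsOpen V → IsOpen (toFun '' V)
  toFun_eq_iff : ∀ x ∈ dom, ∀ y ∈ dom, toFun x = toFun y ↔ ∃ g, act g x = y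

attribute [instance] OrbifoldChart.group OrbifoldChart.finite

variable {m : ℕ} {X : Type*} [TopologicalSpace X]

/-- `h` is a diffeomorphism between open subsets of the domains of two orbifold charts `c`, `c'`
which lies over the identity of `X`. -/
structure OrbifoldChart.IsTransition (c c' : OrbifoldChart m X)
    (h : OpenPartialHomeomorph (EuclideanSpace ℝ (Fin m)) (EuclideanSpace ℝ (Fin m))) : Prop where
  source_subset : h.source ⊆ c.dom
  target_subset : h.target ⊆ c'.dom
  contDiffOn : ContDiffOn ℝ ∞ h h.source
  contDiffOn_symm : ContDiffOn ℝ ∞ h.symm h.target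
  toFun_eq : ∀ x ∈ h.source, c'.toFun (h x) = c.toFun x

/-- An orbifold structure of dimension `m` on `X`: `X` is Hausdorff and second countable, and it is
covered by pairwise compatible orbifold charts. -/
structure OrbifoldAtlas (m : ℕ) (X : Type*) [TopologicalSpace X] where
  t2 : T2Space X
  secondCountable : SecondCountableTopology X
  charts : Set (OrbifoldChart m X)
  cover : ∀ p : X, ∃ c ∈ charts, ∃ x ∈ c.dom, c.toFun x = p
  compatible : ∀ c ∈ charts, ∀ c' ∈ charts, ∀ x ∈ c.dom, ∀ y ∈ c'.dom, c.toFun x = c'.toFun y →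
    ∃ h, c.IsTransition c' h ∧ x ∈ h.source ∧ h x = y

namespace OrbifoldAtlas

/-- `p` is an orbifold singularity: its isotropy group in some chart is nontrivial. -/
def IsSingular (𝒜 : OrbifoldAtlas m X) (p : X) : Prop :=
  ∃ c ∈ 𝒜.charts, ∃ x ∈ c.dom, c.toFun x = p ∧ ∃ g : c.G, g ≠ 1 ∧ c.act g x = x

/-- Smooth real functions on an orbifold. -/
def IsSmoothFun (𝒜 : OrbifoldAtlas m X) (f : X → ℝ) : Prop :=
  ∀ c ∈ 𝒜.charts, ContDiffOn ℝ ∞ (fun x => f (c.toFun x)) c.dom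

/-- A smooth `k`-form on an orbifold: a family of smooth `k`-forms on the chart domains which is
invariant under all transition diffeomorphisms (in particular under the groups of the charts).
The values outside the chart domains are irrelevant. -/
structure Form (𝒜 : OrbifoldAtlas m X) (k : ℕ) where
  toFun : 𝒜.charts → EuclideanSpace ℝ (Fin m) → EuclideanSpace ℝ (Fin m) [⋀^Fin k]→L[ℝ] ℝ
  contDiffOn : ∀ c : 𝒜.charts, ContDiffOn ℝ ∞ (toFun c) c.1.dom
  invariant : ∀ (c c' : 𝒜.charts) (h), c.1.IsTransition c'.1 h → ∀ x ∈ h.source,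
    (toFun c' (h x)).compContinuousLinearMap (fderiv ℝ h x) = toFun c x

/-- A smooth vector field on the open subset `V` of an orbifold. -/
structure VectorFieldOn (𝒜 : OrbifoldAtlas m X) (V : Set X) where
  isOpen : IsOpen V
  toFun : 𝒜.charts → EuclideanSpace ℝ (Fin m) → EuclideanSpace ℝ (Fin m)
  contDiffOn : ∀ c : 𝒜.charts, ContDiffOn ℝ ∞ (toFun c) (c.1.dom ∩ c.1.toFun ⁻¹' V)
  invariant : ∀ (c c' : 𝒜.charts) (h), c.1.IsTransition c'.1 h → ∀ x ∈ h.source, c.1.toFun x ∈ V →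
    fderiv ℝ h x (toFun c x) = toFun c' (h x)

/-- A symplectic form on an orbifold: a closed nondegenerate smooth `2`-form. -/
structure IsSymplectic {𝒜 : OrbifoldAtlas m X} (Ω : 𝒜.Form 2) : Prop where
  closed : ∀ c : 𝒜.charts, ∀ x ∈ c.1.dom, extDeriv (Ω.toFun c) x = 0
  nondegenerate : ∀ c : 𝒜.charts, ∀ x ∈ c.1.dom, ∀ v, v ≠ 0 → ∃ w, Ω.toFun c x ![v, w] ≠ 0

/-- The interior product `w ↦ η (v, w)` of a `2`-form on a vector space with a vector `v`. -/
def interior {E : Type*} [NormedAddCommGroup E] [NormedSpace ℝ E] (v : E)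
    (η : E [⋀^Fin 2]→L[ℝ] ℝ) : E [⋀^Fin 1]→L[ℝ] ℝ :=
  ContinuousAlternatingMap.ofSubsingleton ℝ E ℝ (0 : Fin 1) (η.toContinuousLinearMap ![v, 0] 1)

theorem interior_apply {E : Type*} [NormedAddCommGroup E] [NormedSpace ℝ E] (v w : E)
    (η : E [⋀^Fin 2]→L[ℝ] ℝ) : interior v η ![w] = η ![v, w] := by
  have h : Function.update ![v, 0] 1 w = ![v, w] := by
    ext i
    fin_cases i <;> simp
  simp [interior, ContinuousAlternatingMap.toContinuousLinearMap,
    ContinuousMultilinearMap.toContinuousLinearMap, h]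

/-- The `1`-form `ι_Y Ω` in the chart `c`. -/
def contract {𝒜 : OrbifoldAtlas m X} {V : Set X} (Y : 𝒜.VectorFieldOn V) (Ω : 𝒜.Form 2)
    (c : 𝒜.charts) : EuclideanSpace ℝ (Fin m) → EuclideanSpace ℝ (Fin m) [⋀^Fin 1]→L[ℝ] ℝ :=
  fun x => interior (Y.toFun c x) (Ω.toFun c x)

/-- `Y` is a Liouville vector field on `V` for the symplectic form `Ω`, that is
`L_Y Ω = d (ι_Y Ω) = Ω` on `V`. -/
def IsLiouville {𝒜 : OrbifoldAtlas m X} {V : Set X} (Y : 𝒜.VectorFieldOn V) (Ω : 𝒜.Form 2) :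
    Prop :=
  ∀ c : 𝒜.charts, ∀ x ∈ c.1.dom, c.1.toFun x ∈ V →
    extDeriv (contract Y Ω c) x = Ω.toFun c x

section Maps

variable {E : Type*} [NormedAddCommGroup E] [NormedSpace ℝ E]
  {H : Type*} [TopologicalSpace H] (I : ModelWithCorners ℝ E H)
  {M : Type*} [TopologicalSpace M] [ChartedSpace H M]

/-- `f` is, near `q`, a smooth lift to the orbifold chart `c` of the map `F` from a manifold. -/
structure IsLiftAt (c : OrbifoldChart m X) (F : M → X) (f : M → EuclideanSpace ℝ (Fin m))
    (q : M) : Prop where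
  contMDiffAt : ContMDiffAt I 𝓘(ℝ, EuclideanSpace ℝ (Fin m)) ∞ f q
  eventually : ∀ᶠ q' in 𝓝 q, f q' ∈ c.dom ∧ c.toFun (f q') = F q'

/-- `F` is a smooth submersion from a manifold to an orbifold: it lifts locally to smooth
submersions to the chart domains. -/
def IsSubmersion (𝒜 : OrbifoldAtlas m X) (F : M → X) : Prop :=
  ∀ q : M, ∀ c ∈ 𝒜.charts, ∀ x ∈ c.dom, c.toFun x = F q →
    ∃ f : M → EuclideanSpace ℝ (Fin m), IsLiftAt I c F f q ∧ f q = x ∧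
      Function.Surjective (mfderiv I 𝓘(ℝ, EuclideanSpace ℝ (Fin m)) f q)

/-- `F` is a smooth embedding from a manifold to the regular part of an orbifold. -/
structure IsRegularEmbedding (𝒜 : OrbifoldAtlas m X) (F : M → X) : Prop where
  isEmbedding : IsEmbedding F
  regular : ∀ q, ¬ 𝒜.IsSingular (F q)
  immersion : ∀ q : M, ∀ c ∈ 𝒜.charts, ∀ x ∈ c.dom, c.toFun x = F q →
    ∃ f : M → EuclideanSpace ℝ (Fin m), IsLiftAt I c F f q ∧ f q = x ∧
      Function.Injective (mfderiv I 𝓘(ℝ, EuclideanSpace ℝ (Fin m)) f q)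

/-- The form `η` on the manifold `M` is the pullback under `F` of the form on the orbifold with
the expressions `θ c` in the charts. -/
def IsPullback {𝒜 : OrbifoldAtlas m X} {k : ℕ} (F : M → X)
    (θ : 𝒜.charts → EuclideanSpace ℝ (Fin m) → EuclideanSpace ℝ (Fin m) [⋀^Fin k]→L[ℝ] ℝ)
    (η : ManifoldForm I M k) : Prop :=
  ∀ (q : M) (c : 𝒜.charts) (f : M → EuclideanSpace ℝ (Fin m)), IsLiftAt I c.1 F f q →
    ∀ v : Fin k → TangentSpace I q,
      θ c (f q) (fun i => mfderiv I 𝓘(ℝ, EuclideanSpace ℝ (Fin m)) f q (v i)) = η q v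

/-- The compact domain `D` in the symplectic orbifold `(X, Ω)` is a convex filling of the contact
manifold `(M, α)`, with respect to the Liouville vector field `Y` defined on the open set `V`.
That is: `D` is a domain with smooth boundary `{ρ = 0}`; the boundary is contained in `V` and in
the regular part of `X`, and is identified with `M` through the embedding `F`; the field `Y` is
transverse to the boundary and points out of `D` along it; and `ι_Y Ω` restricts to `α` on `M`. -/
structure IsConvexFilling {𝒜 : OrbifoldAtlas m X} (Ω : 𝒜.Form 2) (D : Set X) {V : Set X}
    (Y : 𝒜.VectorFieldOn V) (F : M → X) (α : ManifoldForm I M 1) : Prop where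
  symplectic : IsSymplectic Ω
  isCompact : IsCompact D
  embedding : 𝒜.IsRegularEmbedding I F
  range_subset : range F ⊆ V
  liouville : IsLiouville Y Ω
  boundary : ∃ ρ : X → ℝ, 𝒜.IsSmoothFun ρ ∧ D = {p | ρ p ≤ 0} ∧ range F = {p | ρ p = 0} ∧
    ∀ c : 𝒜.charts, ∀ x ∈ c.1.dom, c.1.toFun x ∈ range F →
      0 < fderiv ℝ (fun y => ρ (c.1.toFun y)) x (Y.toFun c x)
  restricts : IsPullback I F (contract Y Ω) α

end Maps

end OrbifoldAtlas

end Orbifold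

/-! ## The associated line bundle -/

section LineBundle

variable (P : Type*) [MulAction Circle P]

/-- The relation on `P × ℂ` that identifies `(p, z)` with `(l⁻¹ • p, l * z)` for `l` in the
circle. -/
def lineBundleSetoid : Setoid (P × ℂ) where
  r a b := ∃ l : Circle, b = (l⁻¹ • a.1, (l : ℂ) * a.2)
  iseqv :=
    { refl := fun a => ⟨1, by simp⟩
      symm := by
        rintro a b ⟨l, rfl⟩
        exact ⟨l⁻¹, by simp⟩
      trans := by
        rintro a b c ⟨l, rfl⟩ ⟨k, rfl⟩
        refine ⟨l * k, Prod.ext ?_ ?_⟩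
        · simp [mul_smul]
        · push_cast
          ring }

/-- The line bundle `L = P ×_{S¹} ℂ` associated with `P`. -/
def LineBundle : Type _ := Quotient (lineBundleSetoid P)

variable {P}

namespace LineBundle

/-- The projection from `P × ℂ` to `L`, which maps `(p, z)` to `[p, z]`. -/
def proj (a : P × ℂ) : LineBundle P := Quotient.mk (lineBundleSetoid P) a

/-- The quotient topology. -/
instance [TopologicalSpace P] : TopologicalSpace (LineBundle P) :=
  inferInstanceAs (TopologicalSpace (Quotient (lineBundleSetoid P)))

/-- The map `p ↦ [p, 1]` from `P` to `L`. -/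
def unitSection (p : P) : LineBundle P := proj (p, 1)

variable (P)

/-- The zero section of `L`, the set of all `[p, 0]`. -/
def zeroSection : Set (LineBundle P) := {x | ∃ p : P, x = proj (p, 0)}

/-- The closed unit disc bundle, the set of all `[p, z]` with `|z| ≤ 1`. -/
def unitDiscBundle : Set (LineBundle P) := {x | ∃ (p : P) (z : ℂ), ‖z‖ ≤ 1 ∧ x = proj (p, z)}

end LineBundle

end LineBundle

section NaturalForm

variable {m : ℕ} {P : Type*} [TopologicalSpace P] [ChartedSpace (EuclideanSpace ℝ (Fin m)) P]
  [MulAction Circle P]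

open scoped ComplexConjugate in
/-- The form `Ω` on `L` pulls back to the `2`-form
`½ d(|z|²) ∧ α + dx ∧ dy + ½ (1 + |z|²) dα` on `P × ℂ`, where `z = x + i y`. -/
def PullsBackToNaturalForm {𝒜 : OrbifoldAtlas (m + 1) (LineBundle P)} (Ω : 𝒜.Form 2)
    (α : ManifoldForm (𝓡 m) P 1) : Prop :=
  ∀ (p : P) (z : ℂ) (c : 𝒜.charts) (f : P × ℂ → EuclideanSpace ℝ (Fin (m + 1))),
    OrbifoldAtlas.IsLiftAt ((𝓡 m).prod 𝓘(ℝ, ℂ)) c.1 LineBundle.proj f (p, z) →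
    ∀ (v w : TangentSpace (𝓡 m) p) (a b : ℂ),
      Ω.toFun c (f (p, z))
        ![mfderiv ((𝓡 m).prod 𝓘(ℝ, ℂ)) 𝓘(ℝ, EuclideanSpace ℝ (Fin (m + 1))) f (p, z) (v, a),
          mfderiv ((𝓡 m).prod 𝓘(ℝ, ℂ)) 𝓘(ℝ, EuclideanSpace ℝ (Fin (m + 1))) f (p, z) (w, b)] =
      ((conj z * a).re * α p ![w] - (conj z * b).re * α p ![v]) + (a.re * b.im - a.im * b.re)
        + (1 + ‖z‖ ^ 2) / 2 * α.d p ![v, w]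

end NaturalForm

end

noncomputable section

section ModelDerivative

variable {E : Type*} [NormedAddCommGroup E] [NormedSpace ℝ E]
  {H : Type*} [TopologicalSpace H] (I : ModelWithCorners ℝ E H)
  {M : Type*} [TopologicalSpace M] [ChartedSpace H M]
  {E' : Type*} [NormedAddCommGroup E'] [NormedSpace ℝ E']
  {H' : Type*} [TopologicalSpace H'] (I' : ModelWithCorners ℝ E' H')
  {M' : Type*} [TopologicalSpace M'] [ChartedSpace H' M']
  {E'' : Type*} [NormedAddCommGroup E''] [NormedSpace ℝ E'']
  {H'' : Type*} [TopologicalSpace H''] (I'' : ModelWithCorners ℝ E'' H'')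
  {M'' : Type*} [TopologicalSpace M''] [ChartedSpace H'' M'']

/-- The derivative of a map of manifolds as a map between the model spaces. -/
def mderiv (f : M → M') (x : M) : E →L[ℝ] E' := mfderiv I I' f x

variable {I I' I''}

theorem mderiv_comp {g : M' → M''} {f : M → M'} (x : M) (hg : MDifferentiableAt I' I'' g (f x))
    (hf : MDifferentiableAt I I' f x) :
    mderiv I I'' (fun y => g (f y)) x = (mderiv I' I'' g (f x)).comp (mderiv I I' f x) :=
  mfderiv_comp x hg hf

theorem mderiv_comp_apply {g : M' → M''} {f : M → M'} (x : M)
    (hg : MDifferentiableAt I' I'' g (f x)) (hf : MDifferentiableAt I I' f x) (v : E) :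
    mderiv I I'' (fun y => g (f y)) x v = mderiv I' I'' g (f x) (mderiv I I' f x v) := by
  rw [mderiv_comp x hg hf]
  rfl

theorem mderiv_congr {f g : M → M'} {x : M} (h : f =ᶠ[𝓝 x] g) :
    mderiv I I' f x = mderiv I I' g x :=
  h.mfderiv_eq

theorem mderiv_id (x : M) : mderiv I I (fun y : M => y) x = ContinuousLinearMap.id ℝ E :=
  mfderiv_id

theorem mderiv_eq_fderiv (f : E → E') (x : E) : mderiv 𝓘(ℝ, E) 𝓘(ℝ, E') f x = fderiv ℝ f x :=
  mfderiv_eq_fderiv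

theorem mderiv_prod_apply {f : M × M' → M''} {p : M × M'}
    (hf : MDifferentiableAt (I.prod I') I'' f p) (v : E × E') :
    mderiv (I.prod I') I'' f p v =
      mderiv I I'' (fun z => f (z, p.2)) p.1 v.1 + mderiv I' I'' (fun z => f (p.1, z)) p.2 v.2 :=
  mfderiv_prod_eq_add_apply hf

end ModelDerivative

theorem two_le_infty : (2 : WithTop ℕ∞) ≤ ∞ := WithTop.coe_le_coe.2 le_top

section PullbackForm

variable {E : Type*} [NormedAddCommGroup E] [NormedSpace ℝ E]
  {P : Type*} [TopologicalSpace P] [ChartedSpace E P]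
  {V : Type*} [NormedAddCommGroup V] [NormedSpace ℝ V]

/-- The values of a form on a manifold as forms on the model space. -/
def ManifoldForm.val {k : ℕ} (η : ManifoldForm 𝓘(ℝ, E) P k) : P → E [⋀^Fin k]→L[ℝ] ℝ := η

/-- The pullback of a form on a manifold under a map from a normed space. -/
def ManifoldForm.pullback {k : ℕ} (η : ManifoldForm 𝓘(ℝ, E) P k) (f : V → P) :
    V → V [⋀^Fin k]→L[ℝ] ℝ := fun x =>
  (η.val (f x)).compContinuousLinearMap (mderiv 𝓘(ℝ, V) 𝓘(ℝ, E) f x)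

theorem ManifoldForm.pullback_apply {k : ℕ} (η : ManifoldForm 𝓘(ℝ, E) P k) (f : V → P) (x : V)
    (v : Fin k → V) :
    η.pullback f x v = η.val (f x) (fun i => mderiv 𝓘(ℝ, V) 𝓘(ℝ, E) f x (v i)) := rfl

theorem ManifoldForm.pullback_apply_one (η : ManifoldForm 𝓘(ℝ, E) P 1) (f : V → P) (x v : V) :
    η.pullback f x ![v] = η.val (f x) ![mderiv 𝓘(ℝ, V) 𝓘(ℝ, E) f x v] := by
  rw [pullback_apply]
  congr 1
  ext i; fin_cases i; rfl

theorem ManifoldForm.pullback_apply_two (η : ManifoldForm 𝓘(ℝ, E) P 2) (f : V → P) (x v w : V) :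
    η.pullback f x ![v, w] = η.val (f x)
      ![mderiv 𝓘(ℝ, V) 𝓘(ℝ, E) f x v, mderiv 𝓘(ℝ, V) 𝓘(ℝ, E) f x w] := by
  rw [pullback_apply]
  congr 1
  ext i; fin_cases i <;> rfl

/-- One-forms on a normed space as functionals. -/
abbrev oneForm (V : Type*) [NormedAddCommGroup V] [NormedSpace ℝ V] :
    (V →L[ℝ] ℝ) ≃ₗᵢ[ℝ] (V [⋀^Fin 1]→L[ℝ] ℝ) :=
  ContinuousAlternatingMap.ofSubsingletonLIE (𝕜 := ℝ) (E := V) (F := ℝ) (0 : Fin 1)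

theorem oneForm_apply (l : V →L[ℝ] ℝ) (v : Fin 1 → V) : oneForm V l v = l (v 0) := rfl

theorem oneForm_symm_apply (l : V [⋀^Fin 1]→L[ℝ] ℝ) (v : V) :
    (oneForm V).symm l v = l ![v] := by
  conv_rhs => rw [← (oneForm V).apply_symm_apply l]
  rfl

theorem extDeriv_one_form_apply {η : V → V [⋀^Fin 1]→L[ℝ] ℝ} {x : V}
    (h : DifferentiableAt ℝ η x) (u w : V) :
    extDeriv η x ![u, w] =
      fderiv ℝ (fun y => η y ![w]) x u - fderiv ℝ (fun y => η y ![u]) x w := by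
  rw [extDeriv_apply h]
  have h0 : (0 : Fin 2).removeNth ![u, w] = ![w] := by
    ext i; fin_cases i; rfl
  have h1 : (1 : Fin 2).removeNth ![u, w] = ![u] := by
    ext i; fin_cases i; rfl
  rw [Fin.sum_univ_two, h0, h1]
  simp [sub_eq_add_neg]

variable {k : ℕ} {η : ManifoldForm 𝓘(ℝ, E) P k} {f : V → P} {x : V}

theorem ManifoldForm.IsSmooth.contDiffAt_inChart (hη : η.IsSmooth) (p : P) :
    ContDiffAt ℝ ∞ (η.inChart p) (extChartAt 𝓘(ℝ, E) p p) :=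
  (hη p).contDiffAt ((isOpen_extChartAt_target p).mem_nhds (mem_extChartAt_target p))

theorem contDiffAt_extChartAt_comp (hf : ContMDiffAt 𝓘(ℝ, V) 𝓘(ℝ, E) ∞ f x) :
    ContDiffAt ℝ ∞ (fun y => extChartAt 𝓘(ℝ, E) (f x) (f y)) x := by
  rw [← contMDiffAt_iff_contDiffAt]
  exact ContMDiffAt.comp x (contMDiffAt_extChartAt (I := 𝓘(ℝ, E)) (x := f x)) hf

variable [IsManifold 𝓘(ℝ, E) ∞ P]

theorem mdifferentiableAt_extChartAt_of_mem {p q : P} (h : q ∈ (extChartAt 𝓘(ℝ, E) p).source) :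
    MDifferentiableAt 𝓘(ℝ, E) 𝓘(ℝ, E) (extChartAt 𝓘(ℝ, E) p) q :=
  (contMDiffAt_extChartAt' (n := ∞) (by simpa using h)).mdifferentiableAt (by simp)

theorem contMDiffAt_extChartAt_symm_of_mem {p : P} {u : E}
    (h : u ∈ (extChartAt 𝓘(ℝ, E) p).target) :
    ContMDiffAt 𝓘(ℝ, E) 𝓘(ℝ, E) ∞ (extChartAt 𝓘(ℝ, E) p).symm u :=
  (contMDiffOn_extChartAt_symm p).contMDiffAt ((isOpen_extChartAt_target p).mem_nhds h)

theorem ManifoldForm.pullback_eventuallyEq (η : ManifoldForm 𝓘(ℝ, E) P k)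
    (hf : ContMDiffAt 𝓘(ℝ, V) 𝓘(ℝ, E) ∞ f x) :
    η.pullback f =ᶠ[𝓝 x] fun y => (η.inChart (f x)
      (extChartAt 𝓘(ℝ, E) (f x) (f y))).compContinuousLinearMap
      (fderiv ℝ (fun y => extChartAt 𝓘(ℝ, E) (f x) (f y)) y) := by
  have h1 : ContMDiffAt 𝓘(ℝ, V) 𝓘(ℝ, E) 1 f x := hf.of_le (by simp)
  filter_upwards [(contMDiffAt_iff_contMDiffAt_nhds (by simp)).1 h1,
    hf.continuousAt.preimage_mem_nhds (extChartAt_source_mem_nhds (I := 𝓘(ℝ, E)) (f x))]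
    with y hy hys
  have hys' : f y ∈ (extChartAt 𝓘(ℝ, E) (f x)).source := hys
  set φ := extChartAt 𝓘(ℝ, E) (f x) with hφdef
  have hinv : φ.symm (φ (f y)) = f y := φ.left_inv hys'
  have hyd : MDifferentiableAt 𝓘(ℝ, V) 𝓘(ℝ, E) f y := hy.mdifferentiableAt (by simp)
  have hφ := mdifferentiableAt_extChartAt_of_mem hys'
  have hs := (contMDiffAt_extChartAt_symm_of_mem (φ.map_source hys')).mdifferentiableAt
    (by simp)
  have hback : mderiv 𝓘(ℝ, V) 𝓘(ℝ, E) f y = (mderiv 𝓘(ℝ, E) 𝓘(ℝ, E) φ.symm (φ (f y))).comp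
        (fderiv ℝ (fun y => φ (f y)) y) := by
    rw [← mderiv_eq_fderiv, ← mderiv_comp y (f := fun y => φ (f y)) hs (hφ.comp y hyd)]
    apply mderiv_congr
    filter_upwards [hy.continuousAt.preimage_mem_nhds
      (extChartAt_source_mem_nhds' (I := 𝓘(ℝ, E)) hys')] with z hz
    exact (φ.left_inv hz).symm
  ext v
  change η.val (f y) _ = η.val (φ.symm (φ (f y))) _
  rw [hinv, hback]
  rfl

theorem ManifoldForm.IsSmooth.extDeriv_pullback (hη : η.IsSmooth)
    (hf : ContMDiffAt 𝓘(ℝ, V) 𝓘(ℝ, E) ∞ f x) : extDeriv (η.pullback f) x = η.d.pullback f x := by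
  have hg := contDiffAt_extChartAt_comp hf
  have hi := (hη.contDiffAt_inChart (f x)).differentiableAt (by simp)
  rw [(η.pullback_eventuallyEq hf).extDeriv_eq]
  refine (_root_.extDeriv_pullback (f := fun y => extChartAt 𝓘(ℝ, E) (f x) (f y)) (x := x)
    hi hg (by simpa using two_le_infty)).trans ?_
  rw [← mderiv_eq_fderiv, mderiv_comp x (mdifferentiableAt_extChartAt_of_mem
    (mem_extChartAt_source (f x))) (hf.mdifferentiableAt (by simp))]
  rfl

theorem ManifoldForm.IsSmooth.contDiffAt_pullback {η : ManifoldForm 𝓘(ℝ, E) P 1}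
    (hη : η.IsSmooth) (hf : ContMDiffAt 𝓘(ℝ, V) 𝓘(ℝ, E) ∞ f x) :
    ContDiffAt ℝ ∞ (η.pullback f) x := by
  refine ContDiffAt.congr_of_eventuallyEq ?_ (η.pullback_eventuallyEq hf)
  have hg := contDiffAt_extChartAt_comp hf
  have h1 : ContDiffAt ℝ ∞ (fun y => oneForm V (((oneForm E).symm (η.inChart (f x)
      (extChartAt 𝓘(ℝ, E) (f x) (f y)))).comp
      (fderiv ℝ (fun y => extChartAt 𝓘(ℝ, E) (f x) (f y)) y))) x := by
    refine (oneForm V).toContinuousLinearEquiv.contDiff.contDiffAt.comp x ?_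
    refine ContDiffAt.clm_comp ?_ (hg.fderiv_right (by simp))
    refine (oneForm E).symm.toContinuousLinearEquiv.contDiff.contDiffAt.comp x ?_
    exact ContDiffAt.comp x (hη.contDiffAt_inChart (f x)) hg
  convert h1 using 2 with y
  ext v
  simp only [oneForm_apply, ContinuousLinearMap.comp_apply, oneForm_symm_apply]
  change η.inChart _ _ _ = _
  congr 1
  ext i
  fin_cases i
  rfl

end PullbackForm

section CircleAction

variable {E : Type*} [NormedAddCommGroup E] [NormedSpace ℝ E]
  {P : Type*} [TopologicalSpace P] [ChartedSpace E P] [MulAction Circle P]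
  {W : Type*} [NormedAddCommGroup W] [NormedSpace ℝ W]
  {H : Type*} [TopologicalSpace H] {I : ModelWithCorners ℝ W H}
  {M : Type*} [TopologicalSpace M] [ChartedSpace H M]

variable (E P) in
/-- The circle action is smooth. -/
def IsSmoothCircleAction : Prop :=
  ContMDiff ((𝓡 1).prod 𝓘(ℝ, E)) 𝓘(ℝ, E) ∞ (fun x : Circle × P => x.1 • x.2)

/-- The flow `(t, p) ↦ exp (i t) • p` has the velocity field `R`. -/
def IsGenerator (R : P → E) : Prop :=
  ∀ p : P, IsMIntegralCurve (I := 𝓘(ℝ, E)) (fun t : ℝ => Circle.exp t • p) R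

namespace IsSmoothCircleAction

theorem smul (h : IsSmoothCircleAction E P) (l : Circle) {g : M → P} {x : M}
    (hg : ContMDiffAt I 𝓘(ℝ, E) ∞ g x) : ContMDiffAt I 𝓘(ℝ, E) ∞ (fun y => l • g y) x :=
  ContMDiffAt.comp x (g := fun x : Circle × P => x.1 • x.2) (f := fun y => (l, g y))
    h.contMDiffAt (contMDiffAt_const.prodMk hg)

theorem exp_smul (h : IsSmoothCircleAction E P) {s : M → ℝ} {g : M → P} {x : M}
    (hs : ContMDiffAt I 𝓘(ℝ, ℝ) ∞ s x) (hg : ContMDiffAt I 𝓘(ℝ, E) ∞ g x) :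
    ContMDiffAt I 𝓘(ℝ, E) ∞ (fun y => Circle.exp (s y) • g y) x :=
  ContMDiffAt.comp x (g := fun x : Circle × P => x.1 • x.2) (f := fun y => (Circle.exp (s y), g y))
    h.contMDiffAt ((contMDiff_circleExp.contMDiffAt.comp x hs).prodMk hg)

theorem continuousSMul (h : IsSmoothCircleAction E P) : ContinuousSMul Circle P :=
  ⟨h.continuous⟩

theorem mdifferentiableAt_smul (h : IsSmoothCircleAction E P) (l : Circle) (p : P) :
    MDifferentiableAt 𝓘(ℝ, E) 𝓘(ℝ, E) (fun q : P => l • q) p :=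
  (h.smul l contMDiffAt_id).mdifferentiableAt (by simp)

theorem mderiv_exp_smul (h : IsSmoothCircleAction E P) {R : P → E} (hR : IsGenerator R)
    {s : M → ℝ} {g : M → P} {x : M}
    (hs : MDifferentiableAt I 𝓘(ℝ, ℝ) s x) (hg : MDifferentiableAt I 𝓘(ℝ, E) g x) (v : W) :
    mderiv I 𝓘(ℝ, E) (fun y => Circle.exp (s y) • g y) x v =
      mderiv I 𝓘(ℝ, ℝ) s x v • R (Circle.exp (s x) • g x) +
        mderiv 𝓘(ℝ, E) 𝓘(ℝ, E) (fun q => Circle.exp (s x) • q) (g x) (mderiv I 𝓘(ℝ, E) g x v) := by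
  have hA : ∀ a : ℝ × P, MDifferentiableAt (𝓘(ℝ, ℝ).prod 𝓘(ℝ, E)) 𝓘(ℝ, E)
      (fun a : ℝ × P => Circle.exp a.1 • a.2) a := fun a =>
    (h.exp_smul contMDiffAt_fst contMDiffAt_snd).mdifferentiableAt (by simp)
  have h2 : mderiv I 𝓘(ℝ, E) (fun y => Circle.exp (s y) • g y) x v =
      mderiv (𝓘(ℝ, ℝ).prod 𝓘(ℝ, E)) 𝓘(ℝ, E) (fun a : ℝ × P => Circle.exp a.1 • a.2) (s x, g x)
        (mderiv I (𝓘(ℝ, ℝ).prod 𝓘(ℝ, E)) (fun y => (s y, g y)) x v) :=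
    mderiv_comp_apply (g := fun a : ℝ × P => Circle.exp a.1 • a.2) (f := fun y => (s y, g y)) x
      (hA _) (hs.prodMk hg) v
  have h3 : mderiv I (𝓘(ℝ, ℝ).prod 𝓘(ℝ, E)) (fun y => (s y, g y)) x v =
      (mderiv I 𝓘(ℝ, ℝ) s x v, mderiv I 𝓘(ℝ, E) g x v) := by
    have := hs.mfderiv_prod hg
    unfold mderiv
    rw [this]
    rfl
  have h4 : mderiv 𝓘(ℝ, ℝ) 𝓘(ℝ, E) (fun t => Circle.exp t • g x) (s x) =
      (1 : ℝ →L[ℝ] ℝ).smulRight (R (Circle.exp (s x) • g x)) := (hR (g x) (s x)).mfderiv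
  rw [h2, h3, mderiv_prod_apply (hA _), h4]
  simp

end IsSmoothCircleAction

end CircleAction

section Invariance

variable {E : Type*} [NormedAddCommGroup E] [NormedSpace ℝ E]
  {P : Type*} [TopologicalSpace P] [ChartedSpace E P] [IsManifold 𝓘(ℝ, E) ∞ P]

theorem mdifferentiableAt_extChartAt_symm_of_mem {p : P} {u : E}
    (h : u ∈ (extChartAt 𝓘(ℝ, E) p).target) :
    MDifferentiableAt 𝓘(ℝ, E) 𝓘(ℝ, E) (extChartAt 𝓘(ℝ, E) p).symm u :=
  (contMDiffAt_extChartAt_symm_of_mem h).mdifferentiableAt (by simp)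

theorem mderiv_extChartAt_symm_comp (p : P) :
    (mderiv 𝓘(ℝ, E) 𝓘(ℝ, E) (extChartAt 𝓘(ℝ, E) p).symm (extChartAt 𝓘(ℝ, E) p p)).comp
      (mderiv 𝓘(ℝ, E) 𝓘(ℝ, E) (extChartAt 𝓘(ℝ, E) p) p) = ContinuousLinearMap.id ℝ E := by
  rw [← mderiv_comp p (mdifferentiableAt_extChartAt_symm_of_mem (mem_extChartAt_target p))
    (mdifferentiableAt_extChartAt_of_mem (mem_extChartAt_source p)), ← mderiv_id (I := 𝓘(ℝ, E)) p]
  apply mderiv_congr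
  filter_upwards [extChartAt_source_mem_nhds (I := 𝓘(ℝ, E)) p] with z hz
  exact (extChartAt 𝓘(ℝ, E) p).left_inv hz

variable [MulAction Circle P]

/-- The Reeb field as an `E`-valued function: `α` evaluates to `1` on it, and it is in the kernel
of `dα`. -/
structure IsReebFunction (α : ManifoldForm 𝓘(ℝ, E) P 1) (R : P → E) : Prop where
  one : ∀ p, α.val p ![R p] = 1
  kernel : ∀ p v, α.d.val p ![R p, v] = 0

/-- The data of a generalised Boothby-Wang fibration. -/
structure IsReebAction (α : ManifoldForm 𝓘(ℝ, E) P 1) (R : P → E) : Prop where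
  smooth : α.IsSmooth
  action : IsSmoothCircleAction E P
  generator : IsGenerator R
  reeb : IsReebFunction α R

namespace IsReebAction

variable {α : ManifoldForm 𝓘(ℝ, E) P 1} {R : P → E}

theorem pullback_smul_chart (h : IsReebAction α R) (s : ℝ) (p : P) {u : E}
    (hu : u ∈ (extChartAt 𝓘(ℝ, E) p).target) :
    α.pullback (fun u => Circle.exp s • (extChartAt 𝓘(ℝ, E) p).symm u) u =
      α.pullback (extChartAt 𝓘(ℝ, E) p).symm u := by
  set φ := extChartAt 𝓘(ℝ, E) p with hφ
  let G : ℝ × E → P := fun a => Circle.exp a.1 • φ.symm a.2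
  have hsnd : ∀ a : ℝ × E, a.2 ∈ φ.target →
      ContMDiffAt 𝓘(ℝ, ℝ × E) 𝓘(ℝ, E) ∞ (fun a : ℝ × E => φ.symm a.2) a := fun a ha =>
    ContMDiffAt.comp a (contMDiffAt_extChartAt_symm_of_mem ha)
      contDiffAt_snd.contMDiffAt
  have hfst : ∀ a : ℝ × E, ContMDiffAt 𝓘(ℝ, ℝ × E) 𝓘(ℝ, ℝ) ∞ (Prod.fst : ℝ × E → ℝ) a :=
    fun a => contDiffAt_fst.contMDiffAt
  have hG : ∀ a : ℝ × E, a.2 ∈ φ.target → ContMDiffAt 𝓘(ℝ, ℝ × E) 𝓘(ℝ, E) ∞ G a := fun a ha =>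
    h.action.exp_smul (hfst a) (hsnd a ha)
  have hderiv : ∀ a : ℝ × E, a.2 ∈ φ.target → ∀ w : ℝ × E, mderiv 𝓘(ℝ, ℝ × E) 𝓘(ℝ, E) G a w =
      w.1 • R (G a) + mderiv 𝓘(ℝ, E) 𝓘(ℝ, E) (fun q => Circle.exp a.1 • q) (φ.symm a.2)
        (mderiv 𝓘(ℝ, E) 𝓘(ℝ, E) φ.symm a.2 w.2) := by
    intro a ha w
    have h1 := h.action.mderiv_exp_smul h.generator ((hfst a).mdifferentiableAt (by simp))
      ((hsnd a ha).mdifferentiableAt (by simp)) w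
    have h2 : mderiv 𝓘(ℝ, ℝ × E) 𝓘(ℝ, E) (fun a : ℝ × E => φ.symm a.2) a w =
        mderiv 𝓘(ℝ, E) 𝓘(ℝ, E) φ.symm a.2 w.2 := by
      rw [mderiv_comp_apply (I' := 𝓘(ℝ, E)) (f := fun a : ℝ × E => a.2) a
        (mdifferentiableAt_extChartAt_symm_of_mem ha)
        (differentiableAt_snd.mdifferentiableAt), mderiv_eq_fderiv, fderiv_snd]
      rfl
    have h3 : mderiv 𝓘(ℝ, ℝ × E) 𝓘(ℝ, ℝ) (fun a : ℝ × E => a.1) a w = w.1 := by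
      rw [mderiv_eq_fderiv, fderiv_fst]
      rfl
    rw [h2, h3] at h1
    exact h1
  have hopen : IsOpen φ.target := isOpen_extChartAt_target p
  have hderivR : ∀ a : ℝ × E, a.2 ∈ φ.target → mderiv 𝓘(ℝ, ℝ × E) 𝓘(ℝ, E) G a (1, 0) = R (G a) := by
    intro a ha
    rw [hderiv a ha]
    simp
  have hone : ∀ a : ℝ × E, a.2 ∈ φ.target → α.pullback G a ![(1, 0)] = 1 := by
    intro a ha
    rw [ManifoldForm.pullback_apply_one, hderivR a ha, h.reeb.one]
  have hdiff : ∀ a : ℝ × E, a.2 ∈ φ.target → DifferentiableAt ℝ (α.pullback G) a := fun a ha =>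
    (h.smooth.contDiffAt_pullback (hG a ha)).differentiableAt (by simp)
  have hzero : ∀ a : ℝ × E, a.2 ∈ φ.target → ∀ w,
      fderiv ℝ (fun a => α.pullback G a ![w]) a (1, 0) = 0 := by
    intro a ha w
    have h1 := extDeriv_one_form_apply (hdiff a ha) (1, 0) w
    rw [h.smooth.extDeriv_pullback (hG a ha), ManifoldForm.pullback_apply_two, hderivR a ha,
      h.reeb.kernel] at h1
    have h3 : (fun a => α.pullback G a ![(1, 0)]) =ᶠ[𝓝 a] fun _ => 1 := by
      filter_upwards [(hopen.preimage continuous_snd).mem_nhds ha] with b hb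
      exact hone b hb
    rw [h3.fderiv_eq] at h1
    simpa using h1.symm
  have hconst : ∀ w, α.pullback G (s, u) ![w] = α.pullback G (0, u) ![w] := by
    intro w
    have hd : ∀ t : ℝ, HasDerivAt (fun t : ℝ => α.pullback G (t, u) ![w]) 0 t := by
      intro t
      have h1 : HasFDerivAt (fun a => α.pullback G a ![w])
          (fderiv ℝ (fun a => α.pullback G a ![w]) (t, u)) (t, u) := by
        apply DifferentiableAt.hasFDerivAt
        exact ((ContinuousAlternatingMap.apply ℝ (ℝ × E) ℝ ![w]).differentiableAt).comp _
          (hdiff (t, u) hu)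
      have h2 : HasDerivAt (fun t : ℝ => (t, u)) ((1 : ℝ), (0 : E)) t :=
        (hasDerivAt_id t).prodMk (hasDerivAt_const t u)
      have h3 := h1.comp_hasDerivAt t h2
      rwa [hzero (t, u) hu w] at h3
    exact is_const_of_deriv_eq_zero (fun t => (hd t).differentiableAt) (fun t => (hd t).deriv) s 0
  have hval : ∀ (t : ℝ) (v : Fin 1 → E), α.pullback G (t, u) ![(0, v 0)] =
      α.val (Circle.exp t • φ.symm u)
        ![mderiv 𝓘(ℝ, E) 𝓘(ℝ, E) (fun u => Circle.exp t • φ.symm u) u (v 0)] := by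
    intro t v
    rw [ManifoldForm.pullback_apply_one, hderiv (t, u) hu]
    change α.val _ ![(0 : ℝ) • _ + _] = _
    rw [zero_smul, zero_add, mderiv_comp_apply u (h.action.mdifferentiableAt_smul _ _)
      (mdifferentiableAt_extChartAt_symm_of_mem hu)]
  ext v
  have h1 := hconst (0, v 0)
  rw [hval, hval] at h1
  have hv : ∀ (f : E → P), α.pullback f u v = α.val (f u) ![mderiv 𝓘(ℝ, E) 𝓘(ℝ, E) f u (v 0)] := by
    intro f
    rw [ManifoldForm.pullback_apply]
    congr 1
    ext i; fin_cases i; rfl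
  rw [hv, hv, h1]
  simp

theorem pullback_smul_chart' (h : IsReebAction α R) (l : Circle) (p : P) {u : E}
    (hu : u ∈ (extChartAt 𝓘(ℝ, E) p).target) :
    α.pullback (fun u => l • (extChartAt 𝓘(ℝ, E) p).symm u) u =
      α.pullback (extChartAt 𝓘(ℝ, E) p).symm u := by
  have := h.pullback_smul_chart (Complex.arg l) p hu
  rwa [Circle.exp_arg] at this

theorem mderiv_smul_chart (h : IsReebAction α R) (l : Circle) (p : P) (v : E) :
    mderiv 𝓘(ℝ, E) 𝓘(ℝ, E) (fun u => l • (extChartAt 𝓘(ℝ, E) p).symm u)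
      (extChartAt 𝓘(ℝ, E) p p) (mderiv 𝓘(ℝ, E) 𝓘(ℝ, E) (extChartAt 𝓘(ℝ, E) p) p v) =
    mderiv 𝓘(ℝ, E) 𝓘(ℝ, E) (fun q => l • q) p v := by
  rw [mderiv_comp_apply _ (h.action.mdifferentiableAt_smul _ _)
      (mdifferentiableAt_extChartAt_symm_of_mem (mem_extChartAt_target p))]
  have := congrArg (fun f => f v) (mderiv_extChartAt_symm_comp p)
  simp only [ContinuousLinearMap.comp_apply, ContinuousLinearMap.id_apply] at this
  rw [this, extChartAt_to_inv]

theorem val_smul (h : IsReebAction α R) (l : Circle) (p : P) (v : E) :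
    α.val (l • p) ![mderiv 𝓘(ℝ, E) 𝓘(ℝ, E) (fun q => l • q) p v] = α.val p ![v] := by
  have key : ∀ l : Circle, α.pullback (fun u => l • (extChartAt 𝓘(ℝ, E) p).symm u)
      (extChartAt 𝓘(ℝ, E) p p) ![mderiv 𝓘(ℝ, E) 𝓘(ℝ, E) (extChartAt 𝓘(ℝ, E) p) p v] =
      α.val (l • p) ![mderiv 𝓘(ℝ, E) 𝓘(ℝ, E) (fun q => l • q) p v] := by
    intro l
    rw [ManifoldForm.pullback_apply_one, extChartAt_to_inv, h.mderiv_smul_chart]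
  rw [← key, h.pullback_smul_chart' l p (mem_extChartAt_target p),
    ← h.pullback_smul_chart' 1 p (mem_extChartAt_target p), key]
  simp [mderiv_id]

theorem d_val_smul (h : IsReebAction α R) (l : Circle) (p : P) (v w : E) :
    α.d.val (l • p) ![mderiv 𝓘(ℝ, E) 𝓘(ℝ, E) (fun q => l • q) p v,
      mderiv 𝓘(ℝ, E) 𝓘(ℝ, E) (fun q => l • q) p w] = α.d.val p ![v, w] := by
  have hext : ∀ l : Circle, extDeriv (α.pullback (fun u => l • (extChartAt 𝓘(ℝ, E) p).symm u))
      (extChartAt 𝓘(ℝ, E) p p) = extDeriv (α.pullback (extChartAt 𝓘(ℝ, E) p).symm)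
      (extChartAt 𝓘(ℝ, E) p p) := by
    intro l
    apply Filter.EventuallyEq.extDeriv_eq
    filter_upwards [(isOpen_extChartAt_target (I := 𝓘(ℝ, E)) p).mem_nhds
      (mem_extChartAt_target p)] with u hu
    exact h.pullback_smul_chart' l p hu
  have key : ∀ l : Circle, extDeriv (α.pullback (fun u => l • (extChartAt 𝓘(ℝ, E) p).symm u))
      (extChartAt 𝓘(ℝ, E) p p) ![mderiv 𝓘(ℝ, E) 𝓘(ℝ, E) (extChartAt 𝓘(ℝ, E) p) p v,
        mderiv 𝓘(ℝ, E) 𝓘(ℝ, E) (extChartAt 𝓘(ℝ, E) p) p w] =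
      α.d.val (l • p) ![mderiv 𝓘(ℝ, E) 𝓘(ℝ, E) (fun q => l • q) p v,
        mderiv 𝓘(ℝ, E) 𝓘(ℝ, E) (fun q => l • q) p w] := by
    intro l
    rw [h.smooth.extDeriv_pullback (h.action.smul l
      (contMDiffAt_extChartAt_symm_of_mem (mem_extChartAt_target p))),
      ManifoldForm.pullback_apply_two, extChartAt_to_inv, h.mderiv_smul_chart,
      h.mderiv_smul_chart]
  rw [← key, hext l, ← hext 1, key]
  simp [mderiv_id]

end IsReebAction

end Invariance

/-- A slice for a smooth circle action: a local section `sec` of the orbits whose image is invariant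
under a finite group `Γ`, and a retraction of an open set `nbhd` onto this image along the orbits,
with parameter `time` and with values `sec ∘ coord`. -/
structure Slice (E : Type*) [NormedAddCommGroup E] [NormedSpace ℝ E]
    (P : Type*) [TopologicalSpace P] [ChartedSpace E P] [MulAction Circle P]
    (F : Type*) [NormedAddCommGroup F] [NormedSpace ℝ F] where
  Γ : Subgroup Circle
  finite : Finite Γ
  base : Set F
  isOpen_base : IsOpen base
  isConnected_base : IsConnected base
  sec : F → P
  nbhd : Set P
  isOpen_nbhd : IsOpen nbhd
  coord : P → F
  time : P → ℝ
  contMDiffAt_sec : ∀ b ∈ base, ContMDiffAt 𝓘(ℝ, F) 𝓘(ℝ, E) ∞ sec b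
  contMDiffAt_coord : ∀ p ∈ nbhd, ContMDiffAt 𝓘(ℝ, E) 𝓘(ℝ, F) ∞ coord p
  contMDiffAt_time : ∀ p ∈ nbhd, ContMDiffAt 𝓘(ℝ, E) 𝓘(ℝ, ℝ) ∞ time p
  coord_mem : ∀ p ∈ nbhd, coord p ∈ base
  exp_smul : ∀ p ∈ nbhd, Circle.exp (time p) • sec (coord p) = p
  sec_mem : ∀ b ∈ base, sec b ∈ nbhd
  coord_sec : ∀ b ∈ base, coord (sec b) = b
  time_sec : ∀ b ∈ base, time (sec b) = 0
  smul_sec_mem : ∀ γ ∈ Γ, ∀ b ∈ base, ∃ b' ∈ base, γ • sec b = sec b'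
  mem_of_smul_sec : ∀ l : Circle, ∀ b ∈ base, ∀ b' ∈ base, l • sec b = sec b' → l ∈ Γ

namespace LineBundle

variable {P : Type*} [MulAction Circle P]

theorem proj_eq_iff {a b : P × ℂ} :
    proj a = proj b ↔ ∃ l : Circle, b = (l⁻¹ • a.1, (l : ℂ) * a.2) :=
  Quotient.eq (r := lineBundleSetoid P)

theorem proj_smul (l : Circle) (p : P) (z : ℂ) :
    proj (l • p, ((l⁻¹ : Circle) : ℂ) * z) = proj (p, z) :=
  (proj_eq_iff.2 ⟨l⁻¹, by simp⟩).symm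

theorem exists_proj (x : LineBundle P) : ∃ (p : P) (z : ℂ), x = proj (p, z) := by
  obtain ⟨⟨p, z⟩, rfl⟩ := Quotient.exists_rep x
  exact ⟨p, z, rfl⟩

theorem proj_mem_zeroSection {p : P} {z : ℂ} : proj (p, z) ∈ zeroSection P ↔ z = 0 := by
  constructor
  · rintro ⟨p', h⟩
    obtain ⟨l, hl⟩ := proj_eq_iff.1 h
    have := (Prod.ext_iff.1 hl).2
    simpa using this.symm
  · rintro rfl
    exact ⟨p, rfl⟩

theorem injective_unitSection : Function.Injective (unitSection : P → LineBundle P) := by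
  intro p p' h
  obtain ⟨l, hl⟩ := proj_eq_iff.1 h
  obtain ⟨h1, h2⟩ := Prod.ext_iff.1 hl
  have : l = 1 := Circle.ext (by simpa using h2.symm)
  simpa [this] using h1.symm

/-- The function `[p, z] ↦ |z|² - 1`. -/
def normSqSubOne : LineBundle P → ℝ :=
  Quotient.lift (fun a : P × ℂ => ‖a.2‖ ^ 2 - 1) (by
    rintro a b ⟨l, rfl⟩
    simp only [norm_mul, Circle.norm_coe, one_mul])

theorem normSqSubOne_proj (p : P) (z : ℂ) : normSqSubOne (proj (p, z)) = ‖z‖ ^ 2 - 1 := rfl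

theorem unitDiscBundle_eq : unitDiscBundle P = {x | normSqSubOne x ≤ 0} := by
  ext x
  obtain ⟨p, z, rfl⟩ := exists_proj x
  have h0 : normSqSubOne (proj (p, z)) ≤ 0 ↔ ‖z‖ ≤ 1 := by
    rw [normSqSubOne_proj, sub_nonpos, sq_le_one_iff₀ (norm_nonneg _)]
  refine ⟨?_, fun h => ⟨p, z, h0.1 h, rfl⟩⟩
  rintro ⟨p', z', hz', h⟩
  rw [mem_ofPred_eq, h, normSqSubOne_proj, sub_nonpos]
  exact (sq_le_one_iff₀ (norm_nonneg _)).2 hz'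

theorem range_unitSection_eq : range (unitSection : P → LineBundle P) =
    {x | normSqSubOne x = 0} := by
  ext x
  constructor
  · rintro ⟨p, rfl⟩
    simp [unitSection, normSqSubOne_proj]
  · obtain ⟨p, z, rfl⟩ := exists_proj x
    intro h
    rw [mem_ofPred_eq, normSqSubOne_proj, sub_eq_zero, pow_eq_one_iff_of_nonneg (norm_nonneg _)
      two_ne_zero] at h
    let l : Circle := ⟨z, by simpa [Submonoid.unitSphere] using h⟩
    refine ⟨l • p, ?_⟩
    rw [unitSection, ← proj_smul l p z]
    congr 2
    have : z ≠ 0 := by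
      rintro rfl
      simp at h
    rw [Circle.coe_inv]
    exact (inv_mul_cancel₀ this).symm

variable [TopologicalSpace P]

theorem continuous_proj : Continuous (proj : P × ℂ → LineBundle P) := continuous_quotient_mk'

theorem isCompact_unitDiscBundle [CompactSpace P] : IsCompact (unitDiscBundle P) := by
  have : unitDiscBundle P = proj '' ((univ : Set P) ×ˢ Metric.closedBall (0 : ℂ) 1) := by
    ext x
    constructor
    · rintro ⟨p, z, hz, rfl⟩
      exact ⟨(p, z), ⟨mem_univ _, by simpa using hz⟩, rfl⟩
    · rintro ⟨⟨p, z⟩, ⟨-, hz⟩, rfl⟩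
      exact ⟨p, z, by simpa using hz, rfl⟩
  rw [this]
  exact (isCompact_univ.prod (isCompact_closedBall 0 1)).image continuous_proj

variable [ContinuousSMul Circle P]

theorem isOpenMap_proj : IsOpenMap (proj : P × ℂ → LineBundle P) := by
  intro U hU
  change IsOpen ((proj : P × ℂ → LineBundle P) ⁻¹' (proj '' U))
  have : (proj : P × ℂ → LineBundle P) ⁻¹' (proj '' U) =
      ⋃ l : Circle, (fun a : P × ℂ => (l⁻¹ • a.1, (l : ℂ) * a.2)) ⁻¹' U := by
    ext a
    simp only [mem_preimage, mem_image, mem_iUnion]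
    constructor
    · rintro ⟨b, hb, h⟩
      obtain ⟨l, hl⟩ := proj_eq_iff.1 h.symm
      exact ⟨l, hl ▸ hb⟩
    · rintro ⟨l, hl⟩
      exact ⟨_, hl, (proj_eq_iff.2 ⟨l, rfl⟩).symm⟩
  rw [this]
  refine isOpen_iUnion fun l => hU.preimage ?_
  fun_prop

theorem isOpenQuotientMap_proj : IsOpenQuotientMap (proj : P × ℂ → LineBundle P) :=
  ⟨Quotient.mk_surjective, continuous_proj, isOpenMap_proj⟩

instance [SecondCountableTopology P] : SecondCountableTopology (LineBundle P) :=
  isOpenQuotientMap_proj.isQuotientMap.secondCountableTopology isOpenMap_proj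

instance [T2Space P] : T2Space (LineBundle P) := by
  rw [t2Space_iff_of_isOpenQuotientMap isOpenQuotientMap_proj]
  have : {q : (P × ℂ) × (P × ℂ) | proj q.1 = proj q.2} =
      Prod.snd '' {x : Circle × ((P × ℂ) × (P × ℂ)) |
        x.2.2 = (x.1⁻¹ • x.2.1.1, (x.1 : ℂ) * x.2.1.2)} := by
    ext q
    simp [proj_eq_iff]
  rw [this]
  apply isClosedMap_snd_of_compactSpace
  apply isClosed_eq <;> fun_prop

theorem isEmbedding_unitSection [CompactSpace P] [T2Space P] :
    IsEmbedding (unitSection : P → LineBundle P) := by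
  have : Continuous (unitSection : P → LineBundle P) := continuous_proj.comp (by fun_prop)
  exact (this.isClosedEmbedding injective_unitSection).isEmbedding

end LineBundle

section SliceChart

variable {E : Type*} [NormedAddCommGroup E] [NormedSpace ℝ E]
  {P : Type*} [TopologicalSpace P] [ChartedSpace E P] [MulAction Circle P]
  {F : Type*} [NormedAddCommGroup F] [NormedSpace ℝ F]

namespace Slice

theorem coord_smul_mem (S : Slice E P F) {γ : Circle} (hγ : γ ∈ S.Γ) {b : F} (hb : b ∈ S.base) :
    S.coord (γ • S.sec b) ∈ S.base := by
  obtain ⟨b', hb', h⟩ := S.smul_sec_mem γ hγ b hb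
  rwa [h, S.coord_sec b' hb']

theorem sec_coord_smul (S : Slice E P F) {γ : Circle} (hγ : γ ∈ S.Γ) {b : F} (hb : b ∈ S.base) :
    S.sec (S.coord (γ • S.sec b)) = γ • S.sec b := by
  obtain ⟨b', hb', h⟩ := S.smul_sec_mem γ hγ b hb
  rw [h, S.coord_sec b' hb']

theorem smul_sec_mem_nbhd (S : Slice E P F) {γ : Circle} (hγ : γ ∈ S.Γ) {b : F}
    (hb : b ∈ S.base) : γ • S.sec b ∈ S.nbhd := by
  obtain ⟨b', hb', h⟩ := S.smul_sec_mem γ hγ b hb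
  rw [h]
  exact S.sec_mem b' hb'

variable {m : ℕ} (K : EuclideanSpace ℝ (Fin m) ≃L[ℝ] F × ℂ)

/-- The lift to `P × ℂ` of the orbifold chart of the line bundle defined by a slice. -/
def lift (S : Slice E P F) (x : EuclideanSpace ℝ (Fin m)) : P × ℂ := (S.sec (K x).1, (K x).2)

/-- The retraction of an open subset of `P × ℂ` along the orbits. -/
def retract (S : Slice E P F) (a : P × ℂ) : EuclideanSpace ℝ (Fin m) :=
  K.symm (S.coord a.1, (Circle.exp (S.time a.1) : ℂ) * a.2)

/-- The domain of the orbifold chart of the line bundle defined by a slice. -/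
def chartDom (S : Slice E P F) : Set (EuclideanSpace ℝ (Fin m)) := {x | (K x).1 ∈ S.base}

theorem retract_lift (S : Slice E P F) {x : EuclideanSpace ℝ (Fin m)} (hx : x ∈ S.chartDom K) :
    S.retract K (S.lift K x) = x := by
  simp only [retract, lift, S.time_sec _ hx, S.coord_sec _ hx]
  simp

theorem retract_mem (S : Slice E P F) {a : P × ℂ} (ha : a.1 ∈ S.nbhd) :
    S.retract K a ∈ S.chartDom K := by
  simpa [chartDom, retract] using S.coord_mem _ ha

theorem lift_retract (S : Slice E P F) {a : P × ℂ} (ha : a.1 ∈ S.nbhd) :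
    S.lift K (S.retract K a) = (Circle.exp (-S.time a.1) • a.1,
      (((Circle.exp (-S.time a.1))⁻¹ : Circle) : ℂ) * a.2) := by
  simp only [lift, retract, ContinuousLinearEquiv.apply_symm_apply]
  conv_rhs => enter [1, 2]; rw [← S.exp_smul _ ha]
  rw [smul_smul, ← Circle.exp_add, ← Circle.exp_neg]
  simp

theorem proj_lift_retract (S : Slice E P F) {a : P × ℂ} (ha : a.1 ∈ S.nbhd) :
    LineBundle.proj (S.lift K (S.retract K a)) = LineBundle.proj a := by
  rw [S.lift_retract K ha, LineBundle.proj_smul]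

/-- The action of `Γ` on the chart domain. -/
def act (S : Slice E P F) (g : S.Γ) (x : EuclideanSpace ℝ (Fin m)) : EuclideanSpace ℝ (Fin m) :=
  K.symm (S.coord ((g : Circle) • S.sec (K x).1), (((g : Circle)⁻¹ : Circle) : ℂ) * (K x).2)

theorem act_mem (S : Slice E P F) (g : S.Γ) {x : EuclideanSpace ℝ (Fin m)}
    (hx : x ∈ S.chartDom K) : S.act K g x ∈ S.chartDom K := by
  simpa [chartDom, act] using S.coord_smul_mem g.2 hx

theorem lift_act (S : Slice E P F) (g : S.Γ) {x : EuclideanSpace ℝ (Fin m)}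
    (hx : x ∈ S.chartDom K) : S.lift K (S.act K g x) =
      ((g : Circle) • (S.lift K x).1, (((g : Circle)⁻¹ : Circle) : ℂ) * (S.lift K x).2) := by
  simp only [lift, act, ContinuousLinearEquiv.apply_symm_apply]
  rw [S.sec_coord_smul g.2 hx]

theorem lift_injOn (S : Slice E P F) {x y : EuclideanSpace ℝ (Fin m)} (hx : x ∈ S.chartDom K)
    (hy : y ∈ S.chartDom K) (h : S.lift K x = S.lift K y) : x = y := by
  rw [← S.retract_lift K hx, h, S.retract_lift K hy]

theorem isOpen_chartDom (S : Slice E P F) : IsOpen (S.chartDom K) :=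
  S.isOpen_base.preimage (by fun_prop)

theorem contMDiffAt_lift_fst (S : Slice E P F) {x : EuclideanSpace ℝ (Fin m)}
    (hx : x ∈ S.chartDom K) :
    ContMDiffAt 𝓘(ℝ, EuclideanSpace ℝ (Fin m)) 𝓘(ℝ, E) ∞ (fun x => S.sec (K x).1) x :=
  ContMDiffAt.comp x (S.contMDiffAt_sec _ hx)
    (by rw [contMDiffAt_iff_contDiffAt]; fun_prop)

section

variable {W : Type*} [NormedAddCommGroup W] [NormedSpace ℝ W]
  {H : Type*} [TopologicalSpace H] {I : ModelWithCorners ℝ W H}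
  {M : Type*} [TopologicalSpace M] [ChartedSpace H M]

theorem contMDiffAt_retract (S : Slice E P F) {f : M → P} {g : M → ℂ} {x : M}
    (hf : ContMDiffAt I 𝓘(ℝ, E) ∞ f x) (hg : ContMDiffAt I 𝓘(ℝ, ℂ) ∞ g x) (hx : f x ∈ S.nbhd) :
    ContMDiffAt I 𝓘(ℝ, EuclideanSpace ℝ (Fin m)) ∞ (fun y => S.retract K (f y, g y)) x := by
  have h1 := ContMDiffAt.comp x (S.contMDiffAt_coord _ hx) hf
  have h2 := ContMDiffAt.comp x (S.contMDiffAt_time _ hx) hf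
  have h3 : ContMDiffAt I 𝓘(ℝ, F × ℂ) ∞
      (fun y => (S.coord (f y), (Circle.exp (S.time (f y)) : ℂ) * g y)) x := by
    refine h1.prodMk_space ?_
    let q : ℝ × ℂ → ℂ := fun a => Complex.exp (a.1 * Complex.I) * a.2
    have hq : ContDiff ℝ ∞ q := by
      have := Complex.ofRealCLM.contDiff (n := ∞)
      refine ContDiff.mul (ContDiff.cexp (ContDiff.mul ?_ contDiff_const)) contDiff_snd
      exact Complex.ofRealCLM.contDiff.comp contDiff_fst
    have := ContMDiffAt.comp x (hq.contMDiff.contMDiffAt) (h2.prodMk_space hg)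
    refine this.congr_of_eventuallyEq (Eventually.of_forall fun y => ?_)
    simp [q, Circle.coe_exp]
  exact ContMDiffAt.comp x (K.symm.contDiff.contMDiff.contMDiffAt) h3

end

theorem contDiffAt_act (hs : IsSmoothCircleAction E P) (S : Slice E P F) (g : S.Γ)
    {x : EuclideanSpace ℝ (Fin m)} (hx : x ∈ S.chartDom K) :
    ContDiffAt ℝ ∞ (S.act K g) x := by
  rw [← contMDiffAt_iff_contDiffAt]
  have h := S.contMDiffAt_retract K (hs.smul (g : Circle) (S.contMDiffAt_lift_fst K hx))
    (g := fun x => (((g : Circle)⁻¹ : Circle) : ℂ) * (K x).2)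
    (by rw [contMDiffAt_iff_contDiffAt]; fun_prop) (S.smul_sec_mem_nbhd g.2 hx)
  refine h.congr_of_eventuallyEq ?_
  filter_upwards [(S.isOpen_chartDom K).mem_nhds hx] with y hy
  obtain ⟨b', hb', h⟩ := S.smul_sec_mem g g.2 _ hy
  simp [act, retract, h, S.time_sec b' hb']

/-- The orbifold chart of the line bundle defined by a slice. -/
def chart (hs : IsSmoothCircleAction E P) (S : Slice E P F) : OrbifoldChart m (LineBundle P) where
  dom := S.chartDom K
  isOpen_dom := S.isOpen_chartDom K
  isConnected_dom := by
    have : S.chartDom K = K.symm '' (S.base ×ˢ univ) := by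
      rw [ContinuousLinearEquiv.image_symm_eq_preimage]
      ext x
      simp [chartDom]
    rw [this]
    exact (S.isConnected_base.prod isConnected_univ).image _ K.symm.continuous.continuousOn
  G := S.Γ
  finite := S.finite
  act := S.act K
  act_mem g x hx := S.act_mem K g hx
  one_act x hx := by
    refine S.lift_injOn K (S.act_mem K 1 hx) hx ?_
    rw [S.lift_act K 1 hx]
    simp
  mul_act g h x hx := by
    refine S.lift_injOn K (S.act_mem K _ hx) (S.act_mem K _ (S.act_mem K _ hx)) ?_
    rw [S.lift_act K _ hx, S.lift_act K _ (S.act_mem K _ hx), S.lift_act K _ hx]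
    simp [mul_smul, mul_assoc, mul_comm]
  contDiffOn_act g x hx := (S.contDiffAt_act K hs g hx).contDiffWithinAt
  effective g h := by
    obtain ⟨b, hb⟩ := S.isConnected_base.nonempty
    have hx : K.symm (b, 1) ∈ S.chartDom K := by simpa [chartDom] using hb
    have h1 := S.lift_act K g hx
    rw [h _ hx] at h1
    have h2 := (Prod.ext_iff.1 h1).2
    simp only [lift, ContinuousLinearEquiv.apply_symm_apply, mul_one] at h2
    have h3 : (g : Circle)⁻¹ = 1 := Circle.ext (by simpa using h2.symm)
    exact Subtype.ext (by simpa using h3)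
  toFun x := LineBundle.proj (S.lift K x)
  continuousOn_toFun x hx := by
    refine ContinuousAt.continuousWithinAt ?_
    refine LineBundle.continuous_proj.continuousAt.comp ?_
    exact (S.contMDiffAt_lift_fst K hx).continuousAt.prodMk (by fun_prop)
  isOpen_image U hU hUo := by
    have := hs.continuousSMul
    have hcont : ContinuousOn (S.retract K) {a : P × ℂ | a.1 ∈ S.nbhd} := by
      intro a ha
      have h1 : ContinuousAt S.coord a.1 := (S.contMDiffAt_coord _ ha).continuousAt
      have h2 : ContinuousAt S.time a.1 := (S.contMDiffAt_time _ ha).continuousAt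
      refine ContinuousAt.continuousWithinAt ?_
      refine K.symm.continuous.continuousAt.comp ?_
      refine (ContinuousAt.comp h1 continuousAt_fst).prodMk ?_
      refine ContinuousAt.mul ?_ continuousAt_snd
      refine continuous_subtype_val.continuousAt.comp ?_
      exact Circle.exp.continuous.continuousAt.comp (ContinuousAt.comp h2 continuousAt_fst)
    have hopen := hcont.isOpen_inter_preimage (S.isOpen_nbhd.preimage continuous_fst) hUo
    convert LineBundle.isOpenMap_proj _ hopen using 1
    ext y
    constructor
    · rintro ⟨x, hx, rfl⟩
      refine ⟨S.lift K x, ⟨S.sec_mem _ (hU hx), ?_⟩, rfl⟩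
      rwa [mem_preimage, S.retract_lift K (hU hx)]
    · rintro ⟨a, ⟨ha, hau⟩, rfl⟩
      exact ⟨S.retract K a, hau, S.proj_lift_retract K ha⟩
  toFun_eq_iff x hx y hy := by
    rw [LineBundle.proj_eq_iff]
    constructor
    · rintro ⟨l, hl⟩
      have h1 := (Prod.ext_iff.1 hl).1
      refine ⟨⟨l⁻¹, S.mem_of_smul_sec _ _ hx _ hy h1.symm⟩, ?_⟩
      refine S.lift_injOn K (S.act_mem K _ hx) hy ?_
      refine (S.lift_act K _ hx).trans (Eq.trans ?_ hl.symm)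
      simp
    · rintro ⟨g, rfl⟩
      refine ⟨(g : Circle)⁻¹, ?_⟩
      rw [S.lift_act K _ hx]
      simp

end Slice

end SliceChart

section Pigeonhole

variable {W : Type*} [NormedAddCommGroup W] [NormedSpace ℝ W]
  {V : Type*} [NormedAddCommGroup V] [NormedSpace ℝ V] {ι : Type*} [Finite ι]

/-- If a map agrees near a point, pointwise, with one of finitely many maps, then its `1`-jet at
the point agrees with that of one of them. -/
theorem exists_fderiv_eq_of_eventually_exists {f : W → V} {g : ι → W → V} {x : W}
    (hf : DifferentiableAt ℝ f x) (hg : ∀ i, DifferentiableAt ℝ (g i) x)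
    (h : ∀ᶠ y in 𝓝 x, ∃ i, f y = g i y) : ∃ i, f x = g i x ∧ fderiv ℝ f x = fderiv ℝ (g i) x := by
  classical
  have := Fintype.ofFinite ι
  have h' : ∀ᶠ y in 𝓝 x, ∃ i, f x = g i x ∧ f y = g i y := by
    have h1 : ∀ᶠ y in 𝓝 x, ∀ i, f x ≠ g i x → f y ≠ g i y := by
      rw [eventually_all]
      intro i
      by_cases hi : f x = g i x
      · exact Eventually.of_forall fun y hy => absurd hi hy
      · filter_upwards [hf.continuousAt.ne_iff_eventually_ne (hg i).continuousAt |>.1 hi]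
          with y hy _ using hy
    filter_upwards [h, h1] with y ⟨i, hi⟩ hy
    exact ⟨i, by_contra fun hn => hy i hn hi, hi⟩
  by_contra! hcon
  let s : Finset (Subspace ℝ W) := (Finset.univ.filter (fun i => f x = g i x)).image
    (fun i => LinearMap.ker (fderiv ℝ f x - fderiv ℝ (g i) x : W →L[ℝ] V).toLinearMap)
  have hs : ⊤ ∉ s := by
    intro hmem
    simp only [s, Finset.mem_image, Finset.mem_filter, Finset.mem_univ, true_and] at hmem
    obtain ⟨i, hi, htop⟩ := hmem
    refine hcon i hi (sub_eq_zero.1 ?_)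
    ext v
    have : v ∈ LinearMap.ker (fderiv ℝ f x - fderiv ℝ (g i) x : W →L[ℝ] V).toLinearMap := by
      rw [htop]; trivial
    exact this
  refine Subspace.biUnion_ne_univ_of_top_notMem hs (eq_univ_of_forall fun v => ?_)
  by_contra hv
  have hv' : ∀ i, f x = g i x → fderiv ℝ f x v - fderiv ℝ (g i) x v ≠ 0 := by
    intro i hi h0
    refine hv (mem_biUnion (x := LinearMap.ker
      (fderiv ℝ f x - fderiv ℝ (g i) x : W →L[ℝ] V).toLinearMap) ?_ h0)
    simp only [s, Finset.coe_image, mem_image, Finset.coe_filter, Finset.mem_univ, true_and]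
    exact ⟨i, hi, rfl⟩
  have hline : HasDerivAt (fun t : ℝ => x + t • v) v 0 := by
    simpa using ((hasDerivAt_id (0 : ℝ)).smul_const v).const_add x
  have hx0 : x + (0 : ℝ) • v = x := by simp
  have hne : ∀ᶠ t : ℝ in 𝓝[≠] 0, ∀ i, f x = g i x → f (x + t • v) ≠ g i (x + t • v) := by
    rw [eventually_all]
    intro i
    by_cases hi : f x = g i x
    · have hd : HasDerivAt (fun t : ℝ => f (x + t • v) - g i (x + t • v))
          (fderiv ℝ f x v - fderiv ℝ (g i) x v) 0 := by
        refine HasDerivAt.sub ?_ ?_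
        · refine HasFDerivAt.comp_hasDerivAt (l := f) (f := fun t : ℝ => x + t • v) 0 ?_ hline
          rw [hx0]; exact hf.hasFDerivAt
        · refine HasFDerivAt.comp_hasDerivAt (l := g i) (f := fun t : ℝ => x + t • v) 0 ?_ hline
          rw [hx0]; exact (hg i).hasFDerivAt
      filter_upwards [hd.eventually_ne (c := 0) (hv' i hi)] with t ht _
      exact sub_ne_zero.1 ht
    · exact Eventually.of_forall fun t ht => absurd ht hi
  have hT : Tendsto (fun t : ℝ => x + t • v) (𝓝[≠] 0) (𝓝 x) := by
    have := hline.continuousAt.tendsto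
    rw [hx0] at this
    exact this.mono_left nhdsWithin_le_nhds
  obtain ⟨t, ht, i, hi, hit⟩ := (hne.and (hT.eventually h')).exists
  exact ht i hi hit

variable {H : Type*} [TopologicalSpace H] {I : ModelWithCorners ℝ W H} [I.Boundaryless]
  {M : Type*} [TopologicalSpace M] [ChartedSpace H M]

theorem exists_mderiv_eq_of_eventually_exists {f : M → V} {g : ι → M → V} {q : M}
    (hf : MDifferentiableAt I 𝓘(ℝ, V) f q) (hg : ∀ i, MDifferentiableAt I 𝓘(ℝ, V) (g i) q)
    (h : ∀ᶠ y in 𝓝 q, ∃ i, f y = g i y) :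
    ∃ i, f q = g i q ∧ mderiv I 𝓘(ℝ, V) f q = mderiv I 𝓘(ℝ, V) (g i) q := by
  have key : ∀ f : M → V, MDifferentiableAt I 𝓘(ℝ, V) f q →
      DifferentiableAt ℝ (f ∘ (extChartAt I q).symm) (extChartAt I q q) ∧
      mderiv I 𝓘(ℝ, V) f q = fderiv ℝ (f ∘ (extChartAt I q).symm) (extChartAt I q q) := by
    intro f hf
    have h1 := hf.differentiableWithinAt_writtenInExtChartAt
    rw [I.range_eq_univ, differentiableWithinAt_univ] at h1
    refine ⟨h1, ?_⟩
    have h3 : mderiv I 𝓘(ℝ, V) f q =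
        fderivWithin ℝ (writtenInExtChartAt I 𝓘(ℝ, V) q f) (range I) (extChartAt I q q) := hf.mfderiv
    rw [h3, I.range_eq_univ, fderivWithin_univ]
    rfl
  obtain ⟨i, hi, hi'⟩ := exists_fderiv_eq_of_eventually_exists (key f hf).1
    (fun i => (key (g i) (hg i)).1) (by
      have h2 : Tendsto (extChartAt I q).symm (𝓝 (extChartAt I q q)) (𝓝 q) := by
        simpa using (continuousAt_extChartAt_symm (I := I) q).tendsto
      exact h2.eventually h)
  refine ⟨i, by simpa using hi, ?_⟩
  rw [(key f hf).2, hi', (key (g i) (hg i)).2]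

end Pigeonhole

section NaturalForm

open scoped ComplexConjugate

/-- The value of the natural two-form on `P × ℂ` at a point `(p, z)` on two tangent vectors with
`ℂ`-components `a`, `b`, on which `α` takes the values `A`, `B` and `dα` the value `D`. -/
def naturalValue (z : ℂ) (A B : ℝ) (a b : ℂ) (D : ℝ) : ℝ :=
  ((conj z * a).re * B - (conj z * b).re * A) + (a.re * b.im - a.im * b.re)
    + (1 + ‖z‖ ^ 2) / 2 * D

/-- The value at a point of `P × ℂ` of the primitive `(1 + |z|²) / 2 (α + dθ)` of the natural form,
in the notation of `naturalValue`. -/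
def liouvilleValue (z : ℂ) (A : ℝ) (a : ℂ) : ℝ :=
  (1 + ‖z‖ ^ 2) / 2 * (A + (conj z * a).im / ‖z‖ ^ 2)

theorem conj_circle_mul (l : Circle) (z a : ℂ) : conj (l * z) * (l * a) = conj z * a := by
  rw [map_mul, ← Circle.coe_inv_eq_conj]
  have : ((l⁻¹ : Circle) : ℂ) * l = 1 := by simp
  linear_combination (conj z * a) * this

theorem naturalValue_circle_mul (l : Circle) (z : ℂ) (A B : ℝ) (a b : ℂ) (D : ℝ) :
    naturalValue (l * z) A B (l * a) (l * b) D = naturalValue z A B a b D := by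
  have h : ∀ a b : ℂ, a.re * b.im - a.im * b.re = (conj a * b).im := fun a b => by
    simp [Complex.mul_im]; ring
  simp only [naturalValue, h, conj_circle_mul, norm_mul, Circle.norm_coe, one_mul]

theorem liouvilleValue_circle_mul (l : Circle) (z : ℂ) (A : ℝ) (a : ℂ) :
    liouvilleValue (l * z) A (l * a) = liouvilleValue z A a := by
  simp only [liouvilleValue, conj_circle_mul, norm_mul, Circle.norm_coe, one_mul]

theorem naturalValue_shift (z : ℂ) (A B : ℝ) (a b : ℂ) (D s t : ℝ) :
    naturalValue z (A + s) (B + t) (a - Complex.I * s * z) (b - Complex.I * t * z) D =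
      naturalValue z A B a b D := by
  simp [naturalValue, Complex.mul_re, Complex.mul_im]
  ring

theorem liouvilleValue_shift {z : ℂ} (hz : z ≠ 0) (A : ℝ) (a : ℂ) (s : ℝ) :
    liouvilleValue z (A + s) (a - Complex.I * s * z) = liouvilleValue z A a := by
  have h : ‖z‖ ^ 2 ≠ 0 := by simpa using hz
  have h2 : ‖z‖ ^ 2 = z.re ^ 2 + z.im ^ 2 := by
    rw [Complex.sq_norm, Complex.normSq_apply]; ring
  simp only [liouvilleValue]
  congr 1
  rw [add_assoc]
  congr 1
  field_simp
  simp [Complex.mul_re, Complex.mul_im, h2]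
  ring

/-- The coefficient of the Liouville field `Y = κ(z) z`. -/
def liouvilleCoeff (z : ℂ) : ℝ := (1 + ‖z‖ ^ 2) / (2 * ‖z‖ ^ 2)

theorem naturalValue_liouville {z : ℂ} (hz : z ≠ 0) (B : ℝ) (b : ℂ) :
    naturalValue z 0 B (liouvilleCoeff z * z) b 0 = liouvilleValue z B b := by
  have h : ‖z‖ ^ 2 ≠ 0 := by simpa using hz
  have h2 : z.re ^ 2 + z.im ^ 2 = ‖z‖ ^ 2 := by
    rw [Complex.sq_norm, Complex.normSq_apply]; ring
  have h3 : liouvilleCoeff z * ‖z‖ ^ 2 = (1 + ‖z‖ ^ 2) / 2 := by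
    unfold liouvilleCoeff; field_simp
  have h4 : (1 + ‖z‖ ^ 2) / 2 / ‖z‖ ^ 2 = liouvilleCoeff z := by
    unfold liouvilleCoeff; field_simp
  have h5 : liouvilleValue z B b =
      (1 + ‖z‖ ^ 2) / 2 * B + liouvilleCoeff z * (conj z * b).im := by
    rw [← h4, liouvilleValue]; ring
  rw [h5, ← h3, ← h2]
  simp [naturalValue, Complex.mul_re, Complex.mul_im]
  ring

end NaturalForm

section AlternatingTwo

variable {V : Type*} [NormedAddCommGroup V] [NormedSpace ℝ V]

theorem alternating_one_add (η : V [⋀^Fin 1]→L[ℝ] ℝ) (a b : V) :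
    η ![a + b] = η ![a] + η ![b] := by
  simp only [← oneForm_symm_apply, map_add]

theorem alternating_one_smul (η : V [⋀^Fin 1]→L[ℝ] ℝ) (c : ℝ) (a : V) :
    η ![c • a] = c * η ![a] := by
  simp only [← oneForm_symm_apply, map_smul, smul_eq_mul]

theorem alternating_one_zero (η : V [⋀^Fin 1]→L[ℝ] ℝ) : η ![0] = 0 := by
  simp only [← oneForm_symm_apply, map_zero]

theorem alternating_two_swap (η : V [⋀^Fin 2]→L[ℝ] ℝ) (a b : V) : η ![a, b] = - η ![b, a] := by
  have h := η.toAlternatingMap.map_swap ![b, a] (i := 0) (j := 1) (by decide)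
  have h2 : (![b, a] : Fin 2 → V) ∘ Equiv.swap 0 1 = ![a, b] := by
    ext i; fin_cases i <;> rfl
  rw [h2] at h
  exact h

theorem alternating_two_add_left (η : V [⋀^Fin 2]→L[ℝ] ℝ) (a b c : V) :
    η ![a + b, c] = η ![a, c] + η ![b, c] :=
  η.map_vecCons_add ![c] a b

theorem alternating_two_smul_left (η : V [⋀^Fin 2]→L[ℝ] ℝ) (r : ℝ) (a c : V) :
    η ![r • a, c] = r * η ![a, c] :=
  η.map_vecCons_smul ![c] r a

theorem alternating_two_add_right (η : V [⋀^Fin 2]→L[ℝ] ℝ) (a b c : V) :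
    η ![c, a + b] = η ![c, a] + η ![c, b] := by
  rw [alternating_two_swap, alternating_two_add_left, alternating_two_swap η c a,
    alternating_two_swap η c b]
  ring

theorem alternating_two_smul_right (η : V [⋀^Fin 2]→L[ℝ] ℝ) (r : ℝ) (a c : V) :
    η ![c, r • a] = r * η ![c, a] := by
  rw [alternating_two_swap, alternating_two_smul_left, alternating_two_swap η c a]
  ring

theorem alternating_two_zero_left (η : V [⋀^Fin 2]→L[ℝ] ℝ) (c : V) : η ![0, c] = 0 := by
  have := alternating_two_smul_left η 0 0 c
  simpa using this

end AlternatingTwo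

section Primitive

variable {E : Type*} [NormedAddCommGroup E] [NormedSpace ℝ E]
  {P : Type*} [TopologicalSpace P] [ChartedSpace E P]
  {V : Type*} [NormedAddCommGroup V] [NormedSpace ℝ V]

/-- The pullback of `(1 + |z|²) / 2 α + (x dy - y dx) / 2` under `(s, ζ) : V → P × ℂ`. -/
def naturalPrimitive (α : ManifoldForm 𝓘(ℝ, E) P 1) (s : V → P) (ζ : V →L[ℝ] ℂ) (x : V) :
    V [⋀^Fin 1]→L[ℝ] ℝ :=
  ((1 + ‖ζ x‖ ^ 2) / 2) • α.pullback s x + oneForm V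
    ((1 / 2 : ℝ) • ((ζ x).re • Complex.imCLM.comp ζ - (ζ x).im • Complex.reCLM.comp ζ))

theorem naturalPrimitive_apply (α : ManifoldForm 𝓘(ℝ, E) P 1) (s : V → P) (ζ : V →L[ℝ] ℂ)
    (x v : V) : naturalPrimitive α s ζ x ![v] = (1 + ‖ζ x‖ ^ 2) / 2 * α.pullback s x ![v] +
      1 / 2 * ((ζ x).re * (ζ v).im - (ζ x).im * (ζ v).re) := rfl

variable [IsManifold 𝓘(ℝ, E) ∞ P] {α : ManifoldForm 𝓘(ℝ, E) P 1} {s : V → P} {x : V}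

theorem contDiffAt_naturalPrimitive (hα : α.IsSmooth) (hs : ContMDiffAt 𝓘(ℝ, V) 𝓘(ℝ, E) ∞ s x)
    (ζ : V →L[ℝ] ℂ) : ContDiffAt ℝ ∞ (naturalPrimitive α s ζ) x := by
  have hζ : ContDiff ℝ ∞ ζ := ζ.contDiff
  have hre : ContDiff ℝ ∞ (fun y => (ζ y).re) := Complex.reCLM.contDiff.comp hζ
  have him : ContDiff ℝ ∞ (fun y => (ζ y).im) := Complex.imCLM.contDiff.comp hζ
  refine ContDiffAt.add (ContDiffAt.fun_smul ?_ (hα.contDiffAt_pullback hs)) ?_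
  · exact ((contDiff_const.add (hζ.norm_sq ℝ)).div_const 2).contDiffAt
  · refine (oneForm V).toContinuousLinearEquiv.contDiff.contDiffAt.comp x ?_
    have : ContDiff ℝ ∞ (fun y => (1 / 2 : ℝ) •
        ((ζ y).re • Complex.imCLM.comp ζ - (ζ y).im • Complex.reCLM.comp ζ)) := by fun_prop
    exact this.contDiffAt

theorem extDeriv_naturalPrimitive (hα : α.IsSmooth) (hs : ContMDiffAt 𝓘(ℝ, V) 𝓘(ℝ, E) ∞ s x)
    (ζ : V →L[ℝ] ℂ) (u w : V) : extDeriv (naturalPrimitive α s ζ) x ![u, w] =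
      naturalValue (ζ x) (α.pullback s x ![u]) (α.pullback s x ![w]) (ζ u) (ζ w)
        (α.d.pullback s x ![u, w]) := by
  have hp := (hα.contDiffAt_pullback hs).differentiableAt (by simp)
  have hA : ∀ w, DifferentiableAt ℝ (fun y => α.pullback s y ![w]) x := fun w =>
    ((ContinuousAlternatingMap.apply ℝ V ℝ ![w]).differentiableAt).comp x hp
  have hre : HasFDerivAt (fun y => (ζ y).re) (Complex.reCLM.comp ζ) x :=
    (Complex.reCLM.comp ζ).hasFDerivAt
  have him : HasFDerivAt (fun y => (ζ y).im) (Complex.imCLM.comp ζ) x :=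
    (Complex.imCLM.comp ζ).hasFDerivAt
  have hn : ∀ y, ‖ζ y‖ ^ 2 = (ζ y).re * (ζ y).re + (ζ y).im * (ζ y).im := fun y => by
    rw [Complex.sq_norm, Complex.normSq_apply]
  have hder : ∀ w u, fderiv ℝ (fun y => naturalPrimitive α s ζ y ![w]) x u =
      ((ζ x).re * (ζ u).re + (ζ x).im * (ζ u).im) * α.pullback s x ![w] +
      (1 + ‖ζ x‖ ^ 2) / 2 * fderiv ℝ (fun y => α.pullback s y ![w]) x u +
      1 / 2 * ((ζ u).re * (ζ w).im - (ζ u).im * (ζ w).re) := by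
    intro w u
    have h1 := (((((hre.mul hre).add (him.mul him)).const_add 1).mul_const (1 / 2)).mul
      (hA w).hasFDerivAt).add
      (((hre.mul_const (ζ w).im).sub (him.mul_const (ζ w).re)).const_mul (1 / 2))
    have h2 : (fun y => naturalPrimitive α s ζ y ![w]) = _ := funext fun y => by
      rw [naturalPrimitive_apply, hn, div_eq_mul_one_div]
    rw [h2]
    refine (congrArg (fun L => L u) h1.fderiv).trans ?_
    rw [hn]
    simp
    ring
  rw [extDeriv_one_form_apply ((contDiffAt_naturalPrimitive hα hs ζ).differentiableAt (by simp)),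
    hder, hder, ← hα.extDeriv_pullback hs, extDeriv_one_form_apply hp]
  simp only [naturalValue, Complex.mul_re, Complex.conj_re, Complex.conj_im]
  ring

/-- The form `Im (dz / z)` in `ℂ`, pulled back under a linear map. -/
def angularForm (ζ : V →L[ℝ] ℂ) (x : V) : V [⋀^Fin 1]→L[ℝ] ℝ :=
  oneForm V (Complex.imCLM.comp (((ζ x)⁻¹ • ContinuousLinearMap.id ℂ ℂ).restrictScalars ℝ |>.comp ζ))

theorem angularForm_apply (ζ : V →L[ℝ] ℂ) (x v : V) :
    angularForm ζ x ![v] = ((ζ x)⁻¹ * ζ v).im := rfl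

theorem differentiableAt_angularForm (ζ : V →L[ℝ] ℂ) (hx : ζ x ≠ 0) :
    DifferentiableAt ℝ (angularForm ζ) x := by
  refine (oneForm V).toContinuousLinearEquiv.differentiableAt.comp x ?_
  refine (differentiableAt_const _).clm_comp (DifferentiableAt.clm_comp ?_
    (differentiableAt_const _))
  have h1 : DifferentiableAt ℝ (fun y => (ζ y)⁻¹) x := ζ.differentiableAt.inv hx
  refine ((ContinuousLinearMap.restrictScalarsL ℂ ℂ ℂ ℝ ℝ).differentiableAt).comp x ?_
  exact h1.smul_const _

theorem extDeriv_angularForm (ζ : V →L[ℝ] ℂ) (hx : ζ x ≠ 0) : extDeriv (angularForm ζ) x = 0 := by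
  have hder : ∀ w u, fderiv ℝ (fun y => angularForm ζ y ![w]) x u =
      (-(ζ u * ζ w) / (ζ x) ^ 2).im := by
    intro w u
    have h1 : HasFDerivAt (fun y => (ζ y)⁻¹) _ x :=
      (hasFDerivAt_inv' (𝕜 := ℝ) hx).comp x ζ.hasFDerivAt
    have h2 : HasFDerivAt (fun y => ((ζ y)⁻¹ * ζ w).im) _ x :=
      Complex.imCLM.hasFDerivAt.comp x (h1.mul_const (ζ w))
    refine (congrArg (fun L => L u) h2.fderiv).trans ?_
    change (ζ w • -((ζ x)⁻¹ * ζ u * (ζ x)⁻¹)).im = _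
    congr 1
    rw [smul_eq_mul]
    field_simp
  ext v
  have hv : v = ![v 0, v 1] := by ext i; fin_cases i <;> rfl
  rw [hv, extDeriv_one_form_apply (differentiableAt_angularForm ζ hx), hder, hder,
    mul_comm (ζ (v 1))]
  simp

end Primitive

section SliceForms

variable {E : Type*} [NormedAddCommGroup E] [NormedSpace ℝ E]
  {P : Type*} [TopologicalSpace P] [ChartedSpace E P] [MulAction Circle P]
  {F : Type*} [NormedAddCommGroup F] [NormedSpace ℝ F]
  {m : ℕ} (K : EuclideanSpace ℝ (Fin m) ≃L[ℝ] F × ℂ)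

/-- The fibre coordinate in the chart defined by a slice. -/
def fiberCoord : EuclideanSpace ℝ (Fin m) →L[ℝ] ℂ := 
  (ContinuousLinearMap.snd ℝ F ℂ).comp (K : EuclideanSpace ℝ (Fin m) →L[ℝ] F × ℂ)

namespace Slice

/-- The `P`-component of the lift of the chart defined by a slice. -/
def secMap (S : Slice E P F) (x : EuclideanSpace ℝ (Fin m)) : P := S.sec (K x).1

theorem lift_eq (S : Slice E P F) (x : EuclideanSpace ℝ (Fin m)) :
    S.lift K x = (S.secMap K x, fiberCoord K x) := rfl

theorem contMDiffAt_secMap (S : Slice E P F) {x : EuclideanSpace ℝ (Fin m)}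
    (hx : x ∈ S.chartDom K) :
    ContMDiffAt 𝓘(ℝ, EuclideanSpace ℝ (Fin m)) 𝓘(ℝ, E) ∞ (S.secMap K) x :=
  S.contMDiffAt_lift_fst K hx

theorem exists_smul_eq_lift (S : Slice E P F) {x : EuclideanSpace ℝ (Fin m)}
    (hx : x ∈ S.chartDom K) {p : P} {z : ℂ}
    (h : LineBundle.proj (S.lift K x) = LineBundle.proj (p, z)) :
    ∃ l : Circle, l • p ∈ S.nbhd ∧ S.lift K x = (l • p, ((l⁻¹ : Circle) : ℂ) * z) ∧
      S.retract K (l • p, ((l⁻¹ : Circle) : ℂ) * z) = x := by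
  obtain ⟨l, hl⟩ := LineBundle.proj_eq_iff.1 h.symm
  refine ⟨l⁻¹, ?_, by simpa using hl, ?_⟩
  · have : S.sec (K x).1 = l⁻¹ • p := (Prod.ext_iff.1 hl).1
    exact this ▸ S.sec_mem _ hx
  · rw [inv_inv]
    exact (congrArg (S.retract K) hl).symm.trans (S.retract_lift K hx)

variable {W : Type*} [NormedAddCommGroup W] [NormedSpace ℝ W]
  {H : Type*} [TopologicalSpace H] {I : ModelWithCorners ℝ W H}
  {M : Type*} [TopologicalSpace M] [ChartedSpace H M]
  {Φ₁ : M → P} {Φ₂ : M → ℂ} {q : M}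

theorem isLiftAt_retract (hs : IsSmoothCircleAction E P) (S : Slice E P F)
    (h₁ : ContMDiffAt I 𝓘(ℝ, E) ∞ Φ₁ q) (h₂ : ContMDiffAt I 𝓘(ℝ, ℂ) ∞ Φ₂ q) (l : Circle)
    (hl : l • Φ₁ q ∈ S.nbhd) :
    OrbifoldAtlas.IsLiftAt I (S.chart K hs) (fun y => LineBundle.proj (Φ₁ y, Φ₂ y))
      (fun y => S.retract K (l • Φ₁ y, ((l⁻¹ : Circle) : ℂ) * Φ₂ y)) q where
  contMDiffAt := by
    refine S.contMDiffAt_retract K (hs.smul l h₁) ?_ hl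
    exact (((contDiff_const (c := ((l⁻¹ : Circle) : ℂ))).mul contDiff_id).contMDiff.contMDiffAt
      (n := ∞) (I := 𝓘(ℝ, ℂ)) (I' := 𝓘(ℝ, ℂ))).comp q h₂
  eventually := by
    filter_upwards [(hs.smul l h₁).continuousAt.preimage_mem_nhds (S.isOpen_nbhd.mem_nhds hl)]
      with y hy
    refine ⟨S.retract_mem K hy, ?_⟩
    exact (S.proj_lift_retract K (a := (l • Φ₁ y, ((l⁻¹ : Circle) : ℂ) * Φ₂ y)) hy).trans (LineBundle.proj_smul _ _ _)

variable [I.Boundaryless]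

theorem exists_jet_eq (hs : IsSmoothCircleAction E P) {R : P → E} (hR : IsGenerator R)
    (S : Slice E P F)
    (h₁ : ContMDiffAt I 𝓘(ℝ, E) ∞ Φ₁ q) (h₂ : ContMDiffAt I 𝓘(ℝ, ℂ) ∞ Φ₂ q)
    {f : M → EuclideanSpace ℝ (Fin m)} (hf : OrbifoldAtlas.IsLiftAt I (S.chart K hs)
      (fun y => LineBundle.proj (Φ₁ y, Φ₂ y)) f q) :
    ∃ (l : Circle) (τ : W →L[ℝ] ℝ), S.secMap K (f q) = l • Φ₁ q ∧
      fiberCoord K (f q) = ((l⁻¹ : Circle) : ℂ) * Φ₂ q ∧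
      (∀ v, mderiv 𝓘(ℝ, EuclideanSpace ℝ (Fin m)) 𝓘(ℝ, E) (S.secMap K) (f q)
          (mderiv I 𝓘(ℝ, EuclideanSpace ℝ (Fin m)) f q v) =
        τ v • R (l • Φ₁ q) +
          mderiv 𝓘(ℝ, E) 𝓘(ℝ, E) (fun p => l • p) (Φ₁ q) (mderiv I 𝓘(ℝ, E) Φ₁ q v)) ∧
      ∀ v, fiberCoord K (mderiv I 𝓘(ℝ, EuclideanSpace ℝ (Fin m)) f q v) =
        ((l⁻¹ : Circle) : ℂ) * (mderiv I 𝓘(ℝ, ℂ) Φ₂ q v - Complex.I * τ v * Φ₂ q) := by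
  have hfq : f q ∈ S.chartDom K := hf.eventually.self_of_nhds.1
  obtain ⟨l, hl, hlift, hret⟩ := S.exists_smul_eq_lift K hfq hf.eventually.self_of_nhds.2
  set r : M → EuclideanSpace ℝ (Fin m) :=
    fun y => S.retract K (l • Φ₁ y, ((l⁻¹ : Circle) : ℂ) * Φ₂ y) with hr
  have hrl : OrbifoldAtlas.IsLiftAt I (S.chart K hs) _ r q :=
    S.isLiftAt_retract K hs h₁ h₂ l hl
  have hnear : ∀ᶠ y in 𝓝 q, l • Φ₁ y ∈ S.nbhd :=
    (hs.smul l h₁).continuousAt.preimage_mem_nhds (S.isOpen_nbhd.mem_nhds hl)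
  have hact : ∀ g : S.Γ, ContMDiffAt I 𝓘(ℝ, EuclideanSpace ℝ (Fin m)) ∞
      (fun y => S.act K g (r y)) q := fun g =>
    ContMDiffAt.comp q (g := S.act K g) (f := r) (S.contDiffAt_act K hs g (S.retract_mem K hl)).contMDiffAt hrl.contMDiffAt
  have := S.finite
  have hfmd := hf.contMDiffAt.mdifferentiableAt (by simp)
  obtain ⟨g, hgq, hg⟩ := exists_mderiv_eq_of_eventually_exists (ι := S.Γ) hfmd
    (fun g => (hact g).mdifferentiableAt (by simp)) (by
      filter_upwards [hf.eventually, hrl.eventually] with y hy hy'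
      obtain ⟨g, hg⟩ := ((S.chart K hs).toFun_eq_iff _ hy'.1 _ hy.1).1 (hy'.2.trans hy.2.symm)
      exact ⟨g, hg.symm⟩)
  let s : M → ℝ := fun y => -S.time (l • Φ₁ y)
  have hsmooth : ContMDiffAt I 𝓘(ℝ, ℝ) ∞ s q :=
    (ContMDiffAt.comp q (S.contMDiffAt_time _ hl) (hs.smul l h₁)).neg
  have hs0 : s q = 0 := by
    have h1 : l • Φ₁ q = S.sec (K (f q)).1 := (Prod.ext_iff.1 hlift).1.symm
    simp only [s, h1, S.time_sec _ hfq, neg_zero]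
  let k : Circle := g * l
  have hlift_near : ∀ᶠ y in 𝓝 q, S.lift K (S.act K g (r y)) =
      (Circle.exp (s y) • k • Φ₁ y, (((Circle.exp (s y))⁻¹ * k⁻¹ : Circle) : ℂ) * Φ₂ y) := by
    filter_upwards [hnear] with y hy
    rw [S.lift_act K g (S.retract_mem K hy), S.lift_retract K hy]
    ext1
    · simp only [smul_smul, s, k]
      congr 1
      exact mul_left_comm _ _ _
    · simp only [s, k, ← mul_assoc, ← Circle.coe_mul]
      congr 2
      rw [mul_inv, mul_comm (g : Circle)⁻¹, mul_assoc]
  have hliftf : S.lift K (f q) = (k • Φ₁ q, ((k⁻¹ : Circle) : ℂ) * Φ₂ q) := by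
    rw [hgq, hlift_near.self_of_nhds, hs0]
    simp
  have hsec1 := (Prod.ext_iff.1 hliftf).1
  have hmdsec : MDifferentiableAt 𝓘(ℝ, EuclideanSpace ℝ (Fin m)) 𝓘(ℝ, E) (S.secMap K) (f q) :=
    (S.contMDiffAt_secMap K hfq).mdifferentiableAt (by simp)
  have hs' : MDifferentiableAt I 𝓘(ℝ, ℝ) s q := hsmooth.mdifferentiableAt (by simp)
  have h₁' : MDifferentiableAt I 𝓘(ℝ, E) Φ₁ q := h₁.mdifferentiableAt (by simp)
  have h₂' : MDifferentiableAt I 𝓘(ℝ, ℂ) Φ₂ q := h₂.mdifferentiableAt (by simp)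
  refine ⟨k, mderiv I 𝓘(ℝ, ℝ) s q, hsec1, (Prod.ext_iff.1 hliftf).2, fun v => ?_, fun v => ?_⟩
  · have hcomp : mderiv 𝓘(ℝ, EuclideanSpace ℝ (Fin m)) 𝓘(ℝ, E) (S.secMap K) (f q)
        (mderiv I 𝓘(ℝ, EuclideanSpace ℝ (Fin m)) f q v) =
        mderiv I 𝓘(ℝ, E) (fun y => Circle.exp (s y) • k • Φ₁ y) q v := by
      rw [hg]
      have h3 : MDifferentiableAt 𝓘(ℝ, EuclideanSpace ℝ (Fin m)) 𝓘(ℝ, E) (S.secMap K)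
        (S.act K g (r q)) := hgq ▸ hmdsec
      rw [hgq, ← mderiv_comp_apply (f := fun y => S.act K g (r y)) q h3
        ((hact g).mdifferentiableAt (by simp))]
      refine DFunLike.congr_fun (mderiv_congr ?_) v
      filter_upwards [hlift_near] with y hy
      exact (Prod.ext_iff.1 hy).1
    rw [hcomp, hs.mderiv_exp_smul hR hs' ((hs.smul k h₁).mdifferentiableAt (by simp)), hs0]
    simp only [Circle.exp_zero, one_smul, mderiv_id, ContinuousLinearMap.id_apply]
    rw [mderiv_comp_apply q (hs.mdifferentiableAt_smul k _) h₁']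
  · have hcomp : fiberCoord K (mderiv I 𝓘(ℝ, EuclideanSpace ℝ (Fin m)) f q v) =
        mderiv I 𝓘(ℝ, ℂ) (fun y => (((Circle.exp (s y))⁻¹ * k⁻¹ : Circle) : ℂ) * Φ₂ y) q v := by
      rw [hg]
      have h3 := mderiv_comp_apply (I := I) (I'' := 𝓘(ℝ, ℂ)) (g := fiberCoord K)
        (f := fun y => S.act K g (r y)) q
        (fiberCoord K).differentiableAt.mdifferentiableAt
        ((hact g).mdifferentiableAt (by simp)) v
      rw [mderiv_eq_fderiv, ContinuousLinearMap.fderiv] at h3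
      rw [← h3]
      refine DFunLike.congr_fun (mderiv_congr ?_) v
      filter_upwards [hlift_near] with y hy
      exact (Prod.ext_iff.1 hy).2
    rw [hcomp]
    let Q : ℝ × ℂ → ℂ := fun a => Complex.exp (-(a.1 * Complex.I)) * (((k⁻¹ : Circle) : ℂ) * a.2)
    have hQ : HasFDerivAt Q ((((k⁻¹ : Circle) : ℂ) • ContinuousLinearMap.snd ℝ ℝ ℂ) +
        (-(Complex.I * (((k⁻¹ : Circle) : ℂ) * Φ₂ q))) •
          (Complex.ofRealCLM.comp (ContinuousLinearMap.fst ℝ ℝ ℂ))) (s q, Φ₂ q) := by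
      have e1 : HasFDerivAt (fun a : ℝ × ℂ => (a.1 : ℂ))
        (Complex.ofRealCLM.comp (ContinuousLinearMap.fst ℝ ℝ ℂ)) (s q, Φ₂ q) :=
        (Complex.ofRealCLM.comp (ContinuousLinearMap.fst ℝ ℝ ℂ)).hasFDerivAt
      have e2 : HasFDerivAt (fun a : ℝ × ℂ => a.2) (ContinuousLinearMap.snd ℝ ℝ ℂ) (s q, Φ₂ q) :=
        hasFDerivAt_snd
      refine (((e1.mul_const Complex.I).neg.cexp).mul
        (e2.const_mul ((k⁻¹ : Circle) : ℂ))).congr_fderiv ?_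
      ext
      · simp [hs0]
        ring
      · simp [hs0]
    have hpair : MDifferentiableAt I 𝓘(ℝ, ℝ × ℂ) (fun y => (s y, Φ₂ y)) q :=
      (hsmooth.prodMk_space h₂).mdifferentiableAt (by simp)
    have hpd : mderiv I 𝓘(ℝ, ℝ × ℂ) (fun y => (s y, Φ₂ y)) q v =
        (mderiv I 𝓘(ℝ, ℝ) s q v, mderiv I 𝓘(ℝ, ℂ) Φ₂ q v) := by
      have e1 := mderiv_comp_apply (I'' := 𝓘(ℝ, ℝ)) (g := Prod.fst) q
        differentiableAt_fst.mdifferentiableAt hpair v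
      have e2 := mderiv_comp_apply (I'' := 𝓘(ℝ, ℂ)) (g := Prod.snd) q
        differentiableAt_snd.mdifferentiableAt hpair v
      rw [mderiv_eq_fderiv, fderiv_fst] at e1
      rw [mderiv_eq_fderiv, fderiv_snd] at e2
      exact Prod.ext e1.symm e2.symm
    have h4 : mderiv I 𝓘(ℝ, ℂ) (fun y => Q (s y, Φ₂ y)) q v = _ :=
      mderiv_comp_apply (I' := 𝓘(ℝ, ℝ × ℂ)) (g := Q) (f := fun y => (s y, Φ₂ y)) q
        hQ.differentiableAt.mdifferentiableAt hpair v
    have h5 : (fun y => (((Circle.exp (s y))⁻¹ * k⁻¹ : Circle) : ℂ) * Φ₂ y) =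
        fun y => Q (s y, Φ₂ y) := by
      ext y
      simp only [Q, Circle.coe_mul, Circle.coe_inv, Circle.coe_exp, Complex.exp_neg]
      ring
    rw [h5, h4, mderiv_eq_fderiv, hQ.fderiv, hpd]
    simp
    ring

end Slice

end SliceForms

section LocalInverse

variable {V : Type*} [NormedAddCommGroup V] [NormedSpace ℝ V] [CompleteSpace V]
  {V' : Type*} [NormedAddCommGroup V'] [NormedSpace ℝ V']

/-- The inverse function theorem, with smoothness on the whole domains. -/
theorem exists_openPartialHomeomorph_contDiffOn_symm {f : V → V'} {U : Set V} (hU : IsOpen U)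
    (hf : ∀ x ∈ U, ContDiffAt ℝ ∞ f x)
    (hinv : ∀ x ∈ U, ∃ L : V ≃L[ℝ] V', HasFDerivAt f (L : V →L[ℝ] V') x) {a : V} (ha : a ∈ U) :
    ∃ e : OpenPartialHomeomorph V V', a ∈ e.source ∧ e.source ⊆ U ∧ ⇑e = f ∧
      ∀ y ∈ e.target, ContDiffAt ℝ ∞ e.symm y := by
  obtain ⟨L, hL⟩ := hinv a ha
  let e := ((hf a ha).toOpenPartialHomeomorph f hL (by simp)).restrOpen U hU
  refine ⟨e, ⟨(hf a ha).mem_toOpenPartialHomeomorph_source hL (by simp), ha⟩, ?_, rfl, ?_⟩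
  · intro x hx
    exact hx.2
  · intro y hy
    have hm : e.symm y ∈ U := (e.map_target hy).2
    obtain ⟨L', hL'⟩ := hinv _ hm
    exact e.contDiffAt_symm hy hL' (hf _ hm)

end LocalInverse

section ChartDerivative

variable {E : Type*} [NormedAddCommGroup E] [NormedSpace ℝ E]
  {P : Type*} [TopologicalSpace P] [ChartedSpace E P] [IsManifold 𝓘(ℝ, E) ∞ P]

theorem mderiv_extChartAt_comp_symm (p : P) :
    (mderiv 𝓘(ℝ, E) 𝓘(ℝ, E) (extChartAt 𝓘(ℝ, E) p) p).comp
      (mderiv 𝓘(ℝ, E) 𝓘(ℝ, E) (extChartAt 𝓘(ℝ, E) p).symm (extChartAt 𝓘(ℝ, E) p p)) =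
      ContinuousLinearMap.id ℝ E := by
  have h1 := mdifferentiableAt_extChartAt_of_mem (mem_extChartAt_source (I := 𝓘(ℝ, E)) p)
  have h2 := mdifferentiableAt_extChartAt_symm_of_mem (mem_extChartAt_target (I := 𝓘(ℝ, E)) p)
  have h3 := mderiv_comp (I := 𝓘(ℝ, E)) (I' := 𝓘(ℝ, E)) (I'' := 𝓘(ℝ, E))
    (g := extChartAt 𝓘(ℝ, E) p) (f := (extChartAt 𝓘(ℝ, E) p).symm) (extChartAt 𝓘(ℝ, E) p p)
    (by rwa [extChartAt_to_inv]) h2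
  rw [extChartAt_to_inv] at h3
  rw [← h3, ← mderiv_id (I := 𝓘(ℝ, E)) (extChartAt 𝓘(ℝ, E) p p)]
  apply mderiv_congr
  filter_upwards [(isOpen_extChartAt_target (I := 𝓘(ℝ, E)) p).mem_nhds (mem_extChartAt_target p)]
    with z hz
  exact (extChartAt 𝓘(ℝ, E) p).right_inv hz

end ChartDerivative

section FlowBox

variable {E : Type*} [NormedAddCommGroup E] [NormedSpace ℝ E]
  {P : Type*} [TopologicalSpace P] [ChartedSpace E P] [MulAction Circle P]
  {F : Type*} [NormedAddCommGroup F] [NormedSpace ℝ F]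

/-- A flow box for a circle action at `p`. -/
structure FlowBox (E : Type*) [NormedAddCommGroup E] [NormedSpace ℝ E]
    {P : Type*} [TopologicalSpace P] [ChartedSpace E P] [MulAction Circle P]
    (F : Type*) [NormedAddCommGroup F] [NormedSpace ℝ F] (p : P) where
  radius : ℝ
  radius_pos : 0 < radius
  base : Set F
  base_mem : base ∈ 𝓝 0
  sec : F → P
  nbhd : Set P
  isOpen_nbhd : IsOpen nbhd
  time : P → ℝ
  coord : P → F
  sec_zero : sec 0 = p
  contMDiffAt_sec : ∀ b ∈ base, ContMDiffAt 𝓘(ℝ, F) 𝓘(ℝ, E) ∞ sec b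
  contMDiffAt_time : ∀ q ∈ nbhd, ContMDiffAt 𝓘(ℝ, E) 𝓘(ℝ, ℝ) ∞ time q
  contMDiffAt_coord : ∀ q ∈ nbhd, ContMDiffAt 𝓘(ℝ, E) 𝓘(ℝ, F) ∞ coord q
  coord_mem : ∀ q ∈ nbhd, coord q ∈ base
  exp_smul : ∀ q ∈ nbhd, Circle.exp (time q) • sec (coord q) = q
  exp_smul_mem : ∀ s : ℝ, |s| < radius → ∀ b ∈ base, Circle.exp s • sec b ∈ nbhd
  time_exp_smul : ∀ s : ℝ, |s| < radius → ∀ b ∈ base, time (Circle.exp s • sec b) = s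
  coord_exp_smul : ∀ s : ℝ, |s| < radius → ∀ b ∈ base, coord (Circle.exp s • sec b) = b

variable [IsManifold 𝓘(ℝ, E) ∞ P]

theorem exists_flowBox [CompleteSpace F] (hs : IsSmoothCircleAction E P) {R : P → E}
    (hR : IsGenerator R) (p : P) (j : (ℝ × F) ≃L[ℝ] E)
    (hj : j (1, 0) = mderiv 𝓘(ℝ, E) 𝓘(ℝ, E) (extChartAt 𝓘(ℝ, E) p) p (R p)) :
    Nonempty (FlowBox E F p) := by
  set φ := extChartAt 𝓘(ℝ, E) p with hφ
  let c : F → E := fun y => φ p + j (0, y)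
  have hc : ContDiff ℝ ∞ c := by fun_prop
  have hc0 : c 0 = φ p := by
    have : ((0 : ℝ), (0 : F)) = 0 := rfl
    simp [c, this]
  let σ : F → P := fun y => φ.symm (c y)
  have hσ0 : σ 0 = p := by
    simp only [σ, hc0]
    exact extChartAt_to_inv p
  let A : ℝ × F → P := fun a => Circle.exp a.1 • σ a.2
  have hA0 : A 0 = p := by simp [A, hσ0]
  have hσ : ∀ y, c y ∈ φ.target → ContMDiffAt 𝓘(ℝ, F) 𝓘(ℝ, E) ∞ σ y := fun y hy =>
    ContMDiffAt.comp y (contMDiffAt_extChartAt_symm_of_mem hy) hc.contMDiff.contMDiffAt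
  have hσ' : ∀ a : ℝ × F, c a.2 ∈ φ.target →
      ContMDiffAt 𝓘(ℝ, ℝ × F) 𝓘(ℝ, E) ∞ (fun a : ℝ × F => σ a.2) a := fun a ha =>
    ContMDiffAt.comp a (g := σ) (f := Prod.snd) (hσ _ ha) contDiffAt_snd.contMDiffAt
  have hfst : ∀ a : ℝ × F, ContMDiffAt 𝓘(ℝ, ℝ × F) 𝓘(ℝ, ℝ) ∞ (Prod.fst : ℝ × F → ℝ) a :=
    fun a => contDiffAt_fst.contMDiffAt
  have hA : ∀ a : ℝ × F, c a.2 ∈ φ.target → ContMDiffAt 𝓘(ℝ, ℝ × F) 𝓘(ℝ, E) ∞ A a := fun a ha =>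
    hs.exp_smul (hfst a) (hσ' a ha)
  let U₀ : Set (ℝ × F) := {a | c a.2 ∈ φ.target ∧ A a ∈ φ.source}
  have hU₀ : IsOpen U₀ := by
    rw [isOpen_iff_mem_nhds]
    intro a ha
    have hcc : Continuous fun a : ℝ × F => c a.2 := hc.continuous.comp continuous_snd
    exact Filter.inter_mem (hcc.continuousAt.preimage_mem_nhds
      ((isOpen_extChartAt_target p).mem_nhds ha.1))
      ((hA a ha.1).continuousAt.preimage_mem_nhds ((isOpen_extChartAt_source p).mem_nhds ha.2))
  have h0U₀ : (0 : ℝ × F) ∈ U₀ := by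
    refine ⟨?_, ?_⟩
    · change c 0 ∈ _
      rw [hc0]; exact mem_extChartAt_target p
    · rw [hA0]; exact mem_extChartAt_source p
  let f : ℝ × F → E := fun a => φ (A a)
  have hf : ∀ a ∈ U₀, ContDiffAt ℝ ∞ f a := by
    intro a ha
    rw [← contMDiffAt_iff_contDiffAt]
    exact ContMDiffAt.comp a (contMDiffAt_extChartAt' (I := 𝓘(ℝ, E)) (x := p)
      (by simpa [φ] using ha.2)) (hA a ha.1)
  have hderiv : fderiv ℝ f 0 = (j : ℝ × F →L[ℝ] E) := by
    refine ContinuousLinearMap.ext fun w => ?_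
    have hAmd : MDifferentiableAt 𝓘(ℝ, ℝ × F) 𝓘(ℝ, E) A 0 :=
      (hA 0 h0U₀.1).mdifferentiableAt (by simp)
    have hφmd : MDifferentiableAt 𝓘(ℝ, E) 𝓘(ℝ, E) φ p :=
      mdifferentiableAt_extChartAt_of_mem (mem_extChartAt_source p)
    have hσmd : MDifferentiableAt 𝓘(ℝ, ℝ × F) 𝓘(ℝ, E) (fun a : ℝ × F => σ a.2) 0 :=
      (hσ' 0 h0U₀.1).mdifferentiableAt (by simp)
    have h1 := hs.mderiv_exp_smul hR ((hfst 0).mdifferentiableAt (by simp)) hσmd w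
    rw [mderiv_eq_fderiv, fderiv_fst] at h1
    have h2 : mderiv 𝓘(ℝ, ℝ × F) 𝓘(ℝ, E) (fun a : ℝ × F => σ a.2) 0 w =
        mderiv 𝓘(ℝ, E) 𝓘(ℝ, E) φ.symm (φ p) (j (0, w.2)) := by
      have hcd : HasFDerivAt (fun a : ℝ × F => c a.2) ((j : ℝ × F →L[ℝ] E).comp
          ((ContinuousLinearMap.inr ℝ ℝ F).comp (ContinuousLinearMap.snd ℝ ℝ F))) 0 :=
        (((j : ℝ × F →L[ℝ] E).comp ((ContinuousLinearMap.inr ℝ ℝ F).comp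
          (ContinuousLinearMap.snd ℝ ℝ F))).hasFDerivAt).const_add _
      have h3 := mderiv_comp_apply (I'' := 𝓘(ℝ, E)) (g := φ.symm) (f := fun a : ℝ × F => c a.2) 0
        (by
          change MDifferentiableAt _ _ _ (c 0)
          rw [hc0]
          exact mdifferentiableAt_extChartAt_symm_of_mem (mem_extChartAt_target p))
        hcd.differentiableAt.mdifferentiableAt w
      rw [mderiv_eq_fderiv, hcd.fderiv] at h3
      refine h3.trans ?_
      change mderiv _ _ _ (c 0) _ = _
      rw [hc0]
      rfl
    have h4 : fderiv ℝ f 0 w = mderiv 𝓘(ℝ, E) 𝓘(ℝ, E) φ p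
        (mderiv 𝓘(ℝ, ℝ × F) 𝓘(ℝ, E) A 0 w) := by
      rw [← mderiv_eq_fderiv]
      have := mderiv_comp_apply (g := φ) (f := A) (0 : ℝ × F) (by rwa [hA0]) hAmd w
      rwa [hA0] at this
    have h5 : Circle.exp (0 : ℝ × F).1 = 1 := by simp
    have h6 := DFunLike.congr_fun (mderiv_extChartAt_comp_symm p) (j (0, w.2))
    simp only [ContinuousLinearMap.comp_apply, ContinuousLinearMap.id_apply] at h6
    have h7 : mderiv 𝓘(ℝ, ℝ × F) 𝓘(ℝ, E) A 0 w =
        w.1 • R p + mderiv 𝓘(ℝ, E) 𝓘(ℝ, E) φ.symm (φ p) (j (0, w.2)) := by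
      rw [← h2]
      refine h1.trans ?_
      simp [hσ0, mderiv_id]
    rw [h4, h7, map_add, map_smul, ← hj, h6, ← map_smul, ← map_add]
    simp
  let U : Set (ℝ × F) := U₀ ∩ {a | fderiv ℝ f a ∈ range ((↑) : ((ℝ × F) ≃L[ℝ] E) → (ℝ × F →L[ℝ] E))}
  have hU : IsOpen U := by
    rw [isOpen_iff_mem_nhds]
    intro a ha
    refine Filter.inter_mem (hU₀.mem_nhds ha.1) ?_
    have : ContinuousAt (fderiv ℝ f) a :=
      ((hf a ha.1).fderiv_right (m := ∞) (by simp)).continuousAt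
    exact this.preimage_mem_nhds (ContinuousLinearEquiv.isOpen.mem_nhds ha.2)
  have h0U : (0 : ℝ × F) ∈ U := ⟨h0U₀, ⟨j, hderiv.symm⟩⟩
  obtain ⟨e, h0e, heU, hef, hsymm⟩ := exists_openPartialHomeomorph_contDiffOn_symm hU
    (fun a ha => hf a ha.1) (fun a ha => by
      obtain ⟨L, hL⟩ := ha.2
      exact ⟨L, hL ▸ ((hf a ha.1).differentiableAt (by simp)).hasFDerivAt⟩) h0U
  obtain ⟨r, hr, hball⟩ := Metric.isOpen_iff.1 e.open_source 0 h0e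
  have hbox : ∀ (s : ℝ) (b : F), |s| < r → b ∈ Metric.ball (0 : F) r → (s, b) ∈ e.source := by
    intro s b hs hb
    apply hball
    rw [mem_ball_zero_iff] at hb ⊢
    rw [Prod.norm_mk, Real.norm_eq_abs]
    exact max_lt hs hb
  let N : Set P := {q | q ∈ φ.source ∧ φ q ∈ e.target ∧
    (e.symm (φ q)).2 ∈ Metric.ball (0 : F) r}
  have hφsm : ∀ q ∈ φ.source, ContMDiffAt 𝓘(ℝ, E) 𝓘(ℝ, E) ∞ φ q := fun q hq =>
    contMDiffAt_extChartAt' (by simpa [φ] using hq)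
  have hpre : ∀ q ∈ N, ContMDiffAt 𝓘(ℝ, E) 𝓘(ℝ, ℝ × F) ∞ (fun q => e.symm (φ q)) q :=
    fun q hq => ContMDiffAt.comp q (hsymm _ hq.2.1).contMDiffAt (hφsm q hq.1)
  have hN : IsOpen N := by
    rw [isOpen_iff_mem_nhds]
    intro q hq
    have h1 := (isOpen_extChartAt_source (I := 𝓘(ℝ, E)) p).mem_nhds hq.1
    have h2 := (hφsm q hq.1).continuousAt.preimage_mem_nhds (e.open_target.mem_nhds hq.2.1)
    have h3 := (continuous_snd.continuousAt.comp (hpre q hq).continuousAt).preimage_mem_nhds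
      (Metric.isOpen_ball.mem_nhds hq.2.2)
    filter_upwards [h1, h2, h3] with z hz1 hz2 hz3 using ⟨hz1, hz2, hz3⟩
  have hmain : ∀ a ∈ e.source, A a ∈ φ.source ∧ φ (A a) ∈ e.target ∧ e.symm (φ (A a)) = a := by
    intro a ha
    have h1 : e a = φ (A a) := by rw [hef]
    refine ⟨(heU ha).1.2, h1 ▸ e.map_source ha, ?_⟩
    rw [← h1, e.left_inv ha]
  have hback : ∀ q ∈ N, A (e.symm (φ q)) = q := by
    intro q hq
    have hm := e.map_target hq.2.1
    refine φ.injOn (hmain _ hm).1 hq.1 ?_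
    have h1 := e.right_inv hq.2.1
    rwa [hef] at h1
  exact ⟨{
    radius := r
    radius_pos := hr
    base := Metric.ball 0 r
    base_mem := Metric.ball_mem_nhds 0 hr
    sec := σ
    nbhd := N
    isOpen_nbhd := hN
    time := fun q => (e.symm (φ q)).1
    coord := fun q => (e.symm (φ q)).2
    sec_zero := hσ0
    contMDiffAt_sec := fun b hb => hσ b (heU (hbox 0 b (by simpa using hr) hb)).1.1
    contMDiffAt_time := fun q hq =>
      ContMDiffAt.comp q contDiffAt_fst.contMDiffAt (hpre q hq)
    contMDiffAt_coord := fun q hq =>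
      ContMDiffAt.comp q contDiffAt_snd.contMDiffAt (hpre q hq)
    coord_mem := fun q hq => hq.2.2
    exp_smul := hback
    exp_smul_mem := fun s hs b hb => by
      obtain ⟨h1, h2, h3⟩ := hmain _ (hbox s b hs hb)
      refine ⟨h1, h2, ?_⟩
      rw [show Circle.exp s • σ b = A (s, b) from rfl, h3]
      exact hb
    time_exp_smul := fun s hs b hb => congrArg Prod.fst (hmain _ (hbox s b hs hb)).2.2
    coord_exp_smul := fun s hs b hb => congrArg Prod.snd (hmain _ (hbox s b hs hb)).2.2 }⟩

end FlowBox

section ExistsSlice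

variable {E : Type*} [NormedAddCommGroup E] [NormedSpace ℝ E]
  {P : Type*} [TopologicalSpace P] [ChartedSpace E P] [MulAction Circle P]
  {F : Type*} [NormedAddCommGroup F] [NormedSpace ℝ F] {p : P}

theorem FlowBox.flow (B : FlowBox E F p) {q : P} (hq : q ∈ B.nbhd) {s : ℝ}
    (h : |B.time q + s| < B.radius) : Circle.exp s • q ∈ B.nbhd ∧
      B.time (Circle.exp s • q) = B.time q + s ∧ B.coord (Circle.exp s • q) = B.coord q := by
  have h1 : Circle.exp s • q = Circle.exp (B.time q + s) • B.sec (B.coord q) := by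
    rw [add_comm, Circle.exp_add, mul_smul, B.exp_smul q hq]
  have hb := B.coord_mem q hq
  rw [h1]
  exact ⟨B.exp_smul_mem _ h _ hb, B.time_exp_smul _ h _ hb, B.coord_exp_smul _ h _ hb⟩

theorem FlowBox.time_self (B : FlowBox E F p) :
    p ∈ B.nbhd ∧ B.time p = 0 ∧ B.coord p = 0 := by
  have h0 := mem_of_mem_nhds B.base_mem
  have h : |(0 : ℝ)| < B.radius := by simpa using B.radius_pos
  have e : Circle.exp 0 • B.sec 0 = p := by rw [B.sec_zero]; simp
  have h1 := B.exp_smul_mem 0 h 0 h0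
  have h2 := B.time_exp_smul 0 h 0 h0
  have h3 := B.coord_exp_smul 0 h 0 h0
  rw [e] at h1 h2 h3
  exact ⟨h1, h2, h3⟩

/-- An element of the circle which maps a point near `p` to a point near `p` is close to the
stabilizer of `p`. -/
theorem eventually_exists_stabilizer [ContinuousSMul Circle P] [T2Space P] (p : P) {ε : ℝ}
    (hε : 0 < ε) : ∀ᶠ x : P × P in 𝓝 (p, p), ∀ l : Circle, l • x.1 = x.2 →
      ∃ s : ℝ, |s| < ε ∧ ∃ γ ∈ MulAction.stabilizer Circle p, l = Circle.exp s * γ := by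
  have := isCompact_univ.eventually_forall_of_forall_eventually (x₀ := (p, p))
    (K := (univ : Set Circle)) (P := fun (x : P × P) (l : Circle) => l • x.1 = x.2 →
      ∃ s : ℝ, |s| < ε ∧ ∃ γ ∈ MulAction.stabilizer Circle p, l = Circle.exp s * γ) (by
    intro l _
    by_cases hl : l • p = p
    · have harc : {z : (P × P) × Circle | z.2 * l⁻¹ ∈ Circle.centeredArc ε} ∈ 𝓝 ((p, p), l) := by
        refine IsOpen.mem_nhds ((Circle.isOpen_centeredArc ε).preimage (by fun_prop)) ?_
        exact ⟨0, by simpa using hε, by simp⟩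
      filter_upwards [harc] with z hz _
      obtain ⟨s, hs, hz⟩ := hz
      exact ⟨s, hs, l, hl, by rw [hz]; simp⟩
    · have hne : ∀ᶠ z : (P × P) × Circle in 𝓝 ((p, p), l), z.2 • z.1.1 ≠ z.1.2 :=
        (ContinuousAt.ne_iff_eventually_ne (by fun_prop) (by fun_prop)).1 hl
      filter_upwards [hne] with z hz hz'
      exact absurd hz' hz)
  filter_upwards [this] with x hx l using hx l (mem_univ _)

theorem exists_slice_of_flowBox (hs : IsSmoothCircleAction E P) [T2Space P] (B : FlowBox E F p)
    (hfin : Finite (MulAction.stabilizer Circle p)) :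
    ∃ S : Slice E P F, ∃ b ∈ S.base, S.sec b = p := by
  have hcs := hs.continuousSMul
  have := Fintype.ofFinite (MulAction.stabilizer Circle p)
  set Γ := MulAction.stabilizer Circle p with hΓ
  obtain ⟨hp, htp, hyp⟩ := B.time_self
  have hr := B.radius_pos
  have hcard : (0 : ℝ) < Fintype.card Γ := by exact_mod_cast Fintype.card_pos
  let W₁ : Set P := {q | q ∈ B.nbhd ∧ |B.time q| < B.radius / 4}
  have hW₁ : IsOpen W₁ := by
    rw [isOpen_iff_mem_nhds]
    intro q hq
    exact Filter.inter_mem (B.isOpen_nbhd.mem_nhds hq.1)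
      ((B.contMDiffAt_time q hq.1).continuousAt.abs.eventually_lt continuousAt_const hq.2)
  have hpW₁ : p ∈ W₁ := ⟨hp, by rw [htp]; simpa using hr⟩
  let W : Set P := {q | ∀ γ : Γ, (γ : Circle) • q ∈ W₁}
  have hW : IsOpen W := by
    have : W = ⋂ γ : Γ, (fun q => (γ : Circle) • q) ⁻¹' W₁ := by ext; simp [W]
    rw [this]
    exact isOpen_iInter_of_finite fun γ => hW₁.preimage (by fun_prop)
  have hpW : p ∈ W := fun γ => by rw [show (γ : Circle) • p = p from γ.2]; exact hpW₁
  have hWsmul : ∀ γ ∈ Γ, ∀ q ∈ W, γ • q ∈ W := by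
    intro γ hγ q hq δ
    rw [smul_smul]
    exact hq (δ * ⟨γ, hγ⟩)
  have hWB : ∀ q ∈ W, q ∈ W₁ := fun q hq => by simpa using hq 1
  let T : P → ℝ := fun q => (∑ γ : Γ, B.time ((γ : Circle) • q)) / Fintype.card Γ
  have hTsmul : ∀ γ ∈ Γ, ∀ q, T (γ • q) = T q := by
    intro γ hγ q
    simp only [T, smul_smul]
    congr 1
    exact Fintype.sum_equiv (Equiv.mulRight (⟨γ, hγ⟩ : Γ)) _ _ fun δ => rfl
  have hTsmooth : ∀ q ∈ W, ContMDiffAt 𝓘(ℝ, E) 𝓘(ℝ, ℝ) ∞ T q := by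
    intro q hq
    have hsum : ContMDiffAt 𝓘(ℝ, E) 𝓘(ℝ, ℝ) ∞ (fun q => ∑ γ : Γ, B.time ((γ : Circle) • q)) q :=
      ContMDiffAt.sum fun γ _ => ContMDiffAt.comp q (B.contMDiffAt_time _ (hq γ).1)
        (hs.smul γ contMDiffAt_id)
    exact ContMDiffAt.comp q (g := fun x : ℝ => x / Fintype.card Γ)
      ((contDiff_id.div_const _).contMDiff.contMDiffAt) hsum
  have hTflow : ∀ q ∈ W, ∀ s : ℝ, |s| < B.radius / 2 → T (Circle.exp s • q) = T q + s := by
    intro q hq s hs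
    have h1 : ∀ γ : Γ, B.time ((γ : Circle) • Circle.exp s • q) =
        B.time ((γ : Circle) • q) + s := by
      intro γ
      rw [smul_comm]
      refine (B.flow (hq γ).1 ?_).2.1
      refine (abs_add_le _ _).trans_lt ?_
      linarith [(hq γ).2]
    simp only [T, h1, Finset.sum_add_distrib, Finset.sum_const, Finset.card_univ, nsmul_eq_mul]
    field_simp
  have hTlt : ∀ q ∈ W, |T q| < B.radius / 2 := by
    intro q hq
    simp only [T]
    rw [abs_div, Nat.abs_cast, div_lt_iff₀ hcard]
    refine (Finset.abs_sum_le_sum_abs _ _).trans_lt ?_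
    refine (Finset.sum_le_sum fun γ _ => (hq γ).2.le).trans_lt ?_
    rw [Finset.sum_const, Finset.card_univ, nsmul_eq_mul]
    nlinarith
  have hTp : T p = 0 := by
    have : ∀ γ : Γ, (γ : Circle) • p = p := fun γ => γ.2
    simp [T, this, htp]
  let σ : F → P := fun b => Circle.exp (-T (B.sec b)) • B.sec b
  have hσ0 : σ 0 = p := by simp [σ, B.sec_zero, hTp]
  have hσsm : ∀ b ∈ B.base, B.sec b ∈ W → ContMDiffAt 𝓘(ℝ, F) 𝓘(ℝ, E) ∞ σ b := by
    intro b hb hbW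
    have h1 := B.contMDiffAt_sec b hb
    exact hs.exp_smul (ContMDiffAt.comp b (hTsmooth _ hbW) h1).neg h1
  have hev : ∀ᶠ b in 𝓝 (0 : F), b ∈ B.base ∧ B.sec b ∈ W ∧ σ b ∈ W := by
    have h0 := mem_of_mem_nhds B.base_mem
    have h1 : B.sec ⁻¹' W ∈ 𝓝 0 := (B.contMDiffAt_sec 0 h0).continuousAt.preimage_mem_nhds
      (hW.mem_nhds (by rwa [B.sec_zero]))
    have h2 : σ ⁻¹' W ∈ 𝓝 0 := (hσsm 0 h0 (by rwa [B.sec_zero])).continuousAt.preimage_mem_nhds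
      (hW.mem_nhds (by rwa [hσ0]))
    filter_upwards [B.base_mem, h1, h2] with b hb1 hb2 hb3 using ⟨hb1, hb2, hb3⟩
  have hev2 : ∀ᶠ b in 𝓝 (0 : F) ×ˢ 𝓝 (0 : F), ∀ l : Circle, l • σ b.1 = σ b.2 →
      ∃ s : ℝ, |s| < B.radius / 2 ∧ ∃ γ ∈ Γ, l = Circle.exp s * γ := by
    have hc : Tendsto σ (𝓝 0) (𝓝 p) := by
      have := (hσsm 0 (mem_of_mem_nhds B.base_mem) (by rwa [B.sec_zero])).continuousAt.tendsto
      rwa [hσ0] at this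
    have h1 := hc.prodMap hc
    rw [← nhds_prod_eq (x := p)] at h1
    exact h1.eventually (eventually_exists_stabilizer p (half_pos hr))
  obtain ⟨t, ht, htt⟩ := (eventually_prod_self_iff (r := fun b b' => ∀ l : Circle, l • σ b = σ b' →
      ∃ s : ℝ, |s| < B.radius / 2 ∧ ∃ γ ∈ Γ, l = Circle.exp s * γ)).1 hev2
  obtain ⟨B₁, hB₁sub, hB₁o, h0B₁⟩ := mem_nhds_iff.1 (Filter.inter_mem hev ht)
  have hB : ∀ b ∈ B₁, b ∈ B.base ∧ B.sec b ∈ W ∧ σ b ∈ W := fun b hb => (hB₁sub hb).1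
  have hTσ : ∀ b ∈ B₁, T (σ b) = 0 := by
    intro b hb
    obtain ⟨-, h2, -⟩ := hB b hb
    rw [hTflow _ h2 _ (by rw [abs_neg]; exact hTlt _ h2)]
    ring
  have hyσ : ∀ b ∈ B₁, B.coord (σ b) = b := by
    intro b hb
    obtain ⟨h1, h2, -⟩ := hB b hb
    refine B.coord_exp_smul _ ?_ b h1
    rw [abs_neg]
    linarith [hTlt _ h2]
  have hret : ∀ q ∈ W, B.coord q ∈ B₁ → Circle.exp (T q) • σ (B.coord q) = q := by
    intro q hq hqb
    obtain ⟨h1, h2, -⟩ := hB _ hqb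
    have hq1 := hWB q hq
    have h3 : T q = T (B.sec (B.coord q)) + B.time q := by
      rw [← hTflow _ h2 (B.time q) (by linarith [hq1.2]), B.exp_smul q hq1.1]
    simp only [σ]
    rw [h3, smul_smul, ← Circle.exp_add]
    have : T (B.sec (B.coord q)) + B.time q + -T (B.sec (B.coord q)) = B.time q := by ring
    rw [this, B.exp_smul q hq1.1]
  let a : Γ → F → F := fun γ b => B.coord ((γ : Circle) • σ b)
  have haW : ∀ γ : Γ, ∀ b ∈ B₁, (γ : Circle) • σ b ∈ W := fun γ b hb =>
    hWsmul γ γ.2 _ (hB b hb).2.2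
  have hσa : ∀ γ : Γ, ∀ b ∈ B₁, a γ b ∈ B₁ → σ (a γ b) = (γ : Circle) • σ b := by
    intro γ b hb hab
    have h1 := hret _ (haW γ b hb) hab
    rw [hTsmul γ γ.2, hTσ b hb] at h1
    simpa using h1
  have hacont : ∀ γ : Γ, ∀ b ∈ B₁, ContinuousAt (a γ) b := by
    intro γ b hb
    have h1 := (hσsm b (hB b hb).1 (hB b hb).2.1).continuousAt
    exact ContinuousAt.comp (g := B.coord)
      (B.contMDiffAt_coord _ (hWB _ (haW γ b hb)).1).continuousAt (h1.const_smul _)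
  let B₂ : Set F := {b | b ∈ B₁ ∧ ∀ γ : Γ, a γ b ∈ B₁}
  have hB₂ : IsOpen B₂ := by
    rw [isOpen_iff_mem_nhds]
    intro b hb
    refine Filter.inter_mem (hB₁o.mem_nhds hb.1) ?_
    exact Filter.eventually_all.2 fun γ =>
      (hacont γ b hb.1).preimage_mem_nhds (hB₁o.mem_nhds (hb.2 γ))
  have haB₂ : ∀ γ : Γ, ∀ b ∈ B₂, a γ b ∈ B₂ := by
    intro γ b hb
    refine ⟨hb.2 γ, fun δ => ?_⟩
    have : a δ (a γ b) = a (δ * γ) b := by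
      simp only [a]
      rw [show B.coord ((γ : Circle) • σ b) = a γ b from rfl, hσa γ b hb.1 (hb.2 γ), smul_smul]
      rfl
    rw [this]
    exact hb.2 _
  have ha0 : ∀ γ : Γ, a γ 0 = 0 := by
    intro γ
    simp only [a, hσ0]
    rw [show (γ : Circle) • p = p from γ.2, hyp]
  have h0B₂ : (0 : F) ∈ B₂ := ⟨h0B₁, fun γ => by rw [ha0]; exact h0B₁⟩
  let C : Set F := connectedComponentIn B₂ 0
  have hC₂ : C ⊆ B₂ := connectedComponentIn_subset _ _
  have hC : ∀ b ∈ C, b ∈ B₁ := fun b hb => (hC₂ hb).1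
  have haC : ∀ γ : Γ, ∀ b ∈ C, a γ b ∈ C := by
    intro γ b hb
    have h1 : IsPreconnected (a γ '' C) := isPreconnected_connectedComponentIn.image _
      fun c hc => (hacont γ c (hC c hc)).continuousWithinAt
    refine h1.subset_connectedComponentIn ⟨0, mem_connectedComponentIn h0B₂, ha0 γ⟩ ?_ ⟨b, hb, rfl⟩
    rintro _ ⟨c, hc, rfl⟩
    exact haB₂ γ c (hC₂ hc)
  have hCo : IsOpen C := hB₂.connectedComponentIn
  refine ⟨{
    Γ := Γ
    finite := hfin
    base := C
    isOpen_base := hCo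
    isConnected_base := isConnected_connectedComponentIn_iff.2 h0B₂
    sec := σ
    nbhd := {q | q ∈ W ∧ B.coord q ∈ C}
    isOpen_nbhd := by
      rw [isOpen_iff_mem_nhds]
      intro q hq
      exact Filter.inter_mem (hW.mem_nhds hq.1)
        ((B.contMDiffAt_coord q (hWB q hq.1).1).continuousAt.preimage_mem_nhds
          (hCo.mem_nhds hq.2))
    coord := B.coord
    time := T
    contMDiffAt_sec := fun b hb => hσsm b (hB b (hC b hb)).1 (hB b (hC b hb)).2.1
    contMDiffAt_coord := fun q hq => B.contMDiffAt_coord q (hWB q hq.1).1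
    contMDiffAt_time := fun q hq => hTsmooth q hq.1
    coord_mem := fun q hq => hq.2
    exp_smul := fun q hq => hret q hq.1 (hC _ hq.2)
    sec_mem := fun b hb => ⟨(hB b (hC b hb)).2.2, by rw [hyσ b (hC b hb)]; exact hb⟩
    coord_sec := fun b hb => hyσ b (hC b hb)
    time_sec := fun b hb => hTσ b (hC b hb)
    smul_sec_mem := fun γ hγ b hb =>
      ⟨a ⟨γ, hγ⟩ b, haC ⟨γ, hγ⟩ b hb, (hσa ⟨γ, hγ⟩ b (hC b hb) ((hC₂ hb).2 _)).symm⟩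
    mem_of_smul_sec := ?_ }, 0, mem_connectedComponentIn h0B₂, hσ0⟩
  intro l b hb b' hb' h
  obtain ⟨s, hs, γ, hγ, rfl⟩ := htt b (hB₁sub (hC b hb)).2 b' (hB₁sub (hC b' hb')).2 l h
  rw [mul_smul] at h
  have h1 := hTflow (γ • σ b) (haW ⟨γ, hγ⟩ b (hC b hb)) s hs
  rw [h, hTσ b' (hC b' hb'), hTsmul γ hγ, hTσ b (hC b hb), zero_add] at h1
  rw [← h1]
  simpa using hγ

end ExistsSlice

section SymplecticChart

variable {E : Type*} [NormedAddCommGroup E] [NormedSpace ℝ E]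
  {P : Type*} [TopologicalSpace P] [ChartedSpace E P] [MulAction Circle P]
  {F : Type*} [NormedAddCommGroup F] [NormedSpace ℝ F]
  {m : ℕ} (K : EuclideanSpace ℝ (Fin m) ≃L[ℝ] F × ℂ) {α : ManifoldForm 𝓘(ℝ, E) P 1} {R : P → E}

namespace Slice

variable (α) in
/-- The symplectic form in the chart defined by a slice. -/
def omega (S : Slice E P F) :
    EuclideanSpace ℝ (Fin m) → EuclideanSpace ℝ (Fin m) [⋀^Fin 2]→L[ℝ] ℝ :=
  extDeriv (naturalPrimitive α (S.secMap K) (fiberCoord K))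

end Slice

/-- The Liouville field `(1 + |z|²) / (2 |z|²) z` in the chart defined by a slice. -/
def liouvilleField (x : EuclideanSpace ℝ (Fin m)) : EuclideanSpace ℝ (Fin m) :=
  K.symm (0, liouvilleCoeff (fiberCoord K x) * fiberCoord K x)

theorem fiberCoord_liouvilleField (x : EuclideanSpace ℝ (Fin m)) :
    fiberCoord K (liouvilleField K x) = liouvilleCoeff (fiberCoord K x) * fiberCoord K x := by
  simp [fiberCoord, liouvilleField]

theorem contDiffAt_liouvilleField {x : EuclideanSpace ℝ (Fin m)} (hx : fiberCoord K x ≠ 0) :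
    ContDiffAt ℝ ∞ (liouvilleField K) x := by
  have hζ : ContDiff ℝ ∞ (fiberCoord K) := (fiberCoord K).contDiff
  have hn : ContDiff ℝ ∞ (fun y => ‖fiberCoord K y‖ ^ 2) := hζ.norm_sq ℝ
  have hc : ContDiffAt ℝ ∞ (fun y => liouvilleCoeff (fiberCoord K y)) x :=
    (contDiff_const.add hn).contDiffAt.div (contDiff_const.mul hn).contDiffAt (by simpa using hx)
  refine K.symm.contDiff.contDiffAt.comp x (contDiffAt_const.prodMk ?_)
  exact (Complex.ofRealCLM.contDiff.contDiffAt.comp x hc).mul hζ.contDiffAt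

theorem fderiv_norm_sq_liouvilleField {x : EuclideanSpace ℝ (Fin m)} (hx : fiberCoord K x ≠ 0) :
    0 < fderiv ℝ (fun y => ‖fiberCoord K y‖ ^ 2 - 1) x (liouvilleField K x) := by
  have h1 := (((fiberCoord K).hasFDerivAt (x := x)).norm_sq).sub_const 1
  rw [h1.fderiv]
  have h2 : (0 : ℝ) < ‖fiberCoord K x‖ ^ 2 := by positivity
  have h3 : inner ℝ (fiberCoord K x) (fiberCoord K (liouvilleField K x)) =
      (1 + ‖fiberCoord K x‖ ^ 2) / 2 := by
    rw [fiberCoord_liouvilleField, ← Complex.real_smul, inner_smul_right,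
      real_inner_self_eq_norm_sq, liouvilleCoeff]
    field_simp
  have h4 : 0 < inner ℝ (fiberCoord K x) (fiberCoord K (liouvilleField K x)) := by
    rw [h3]; positivity
  simp only [Complex.inner, Complex.mul_re, Complex.conj_re, Complex.conj_im] at h4
  simp
  linarith

namespace Slice

theorem mderiv_secMap (S : Slice E P F) {x : EuclideanSpace ℝ (Fin m)}
    (hx : x ∈ S.chartDom K) (u : EuclideanSpace ℝ (Fin m)) :
    mderiv 𝓘(ℝ, EuclideanSpace ℝ (Fin m)) 𝓘(ℝ, E) (S.secMap K) x u =
      mderiv 𝓘(ℝ, F) 𝓘(ℝ, E) S.sec (K x).1 (K u).1 := by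
  let L : EuclideanSpace ℝ (Fin m) →L[ℝ] F :=
    (ContinuousLinearMap.fst ℝ F ℂ).comp (K : EuclideanSpace ℝ (Fin m) →L[ℝ] F × ℂ)
  have h := mderiv_comp_apply (I := 𝓘(ℝ, EuclideanSpace ℝ (Fin m))) (I' := 𝓘(ℝ, F))
    (I'' := 𝓘(ℝ, E)) (g := S.sec) (f := L) x
    ((S.contMDiffAt_sec _ hx).mdifferentiableAt (by simp))
    L.differentiableAt.mdifferentiableAt u
  rw [mderiv_eq_fderiv, ContinuousLinearMap.fderiv] at h
  exact h

theorem eq_time_smul_add (hs : IsSmoothCircleAction E P) (hR : IsGenerator R) (S : Slice E P F)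
    {b : F} (hb : b ∈ S.base) (v : E) :
    v = mderiv 𝓘(ℝ, E) 𝓘(ℝ, ℝ) S.time (S.sec b) v • R (S.sec b) +
      mderiv 𝓘(ℝ, F) 𝓘(ℝ, E) S.sec b (mderiv 𝓘(ℝ, E) 𝓘(ℝ, F) S.coord (S.sec b) v) := by
  have hn := S.sec_mem b hb
  have hc := (S.contMDiffAt_coord _ hn)
  have hsec : ContMDiffAt 𝓘(ℝ, F) 𝓘(ℝ, E) ∞ S.sec (S.coord (S.sec b)) := by
    rw [S.coord_sec b hb]
    exact S.contMDiffAt_sec b hb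
  have hsc : ContMDiffAt 𝓘(ℝ, E) 𝓘(ℝ, E) ∞ (fun q => S.sec (S.coord q)) (S.sec b) :=
    ContMDiffAt.comp (S.sec b) hsec hc
  have h1 := hs.mderiv_exp_smul hR ((S.contMDiffAt_time _ hn).mdifferentiableAt (by simp))
    (hsc.mdifferentiableAt (by simp)) v
  rw [S.time_sec b hb, mderiv_comp_apply (S.sec b) (hsec.mdifferentiableAt (by simp))
    (hc.mdifferentiableAt (by simp)), S.coord_sec b hb] at h1
  simp only [Circle.exp_zero, one_smul, mderiv_id, ContinuousLinearMap.id_apply] at h1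
  rw [← h1]
  have h2 : mderiv 𝓘(ℝ, E) 𝓘(ℝ, E) (fun q : P => q) (S.sec b) v = v := by rw [mderiv_id]; rfl
  conv_lhs => rw [← h2]
  refine DFunLike.congr_fun (mderiv_congr ?_) v
  filter_upwards [S.isOpen_nbhd.mem_nhds hn] with q hq
  exact (S.exp_smul q hq).symm

theorem eq_zero_of_mderiv_sec [FiniteDimensional ℝ E] [FiniteDimensional ℝ F]
    (hs : IsSmoothCircleAction E P) (hR : IsGenerator R)
    (hdim : Module.finrank ℝ E = Module.finrank ℝ F + 1) (S : Slice E P F)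
    {b : F} (hb : b ∈ S.base) {t : ℝ} {y : F}
    (h : mderiv 𝓘(ℝ, F) 𝓘(ℝ, E) S.sec b y = t • R (S.sec b)) : t = 0 ∧ y = 0 := by
  let T : ℝ × F →ₗ[ℝ] E := ((LinearMap.toSpanSingleton ℝ E (R (S.sec b))).comp
    (LinearMap.fst ℝ ℝ F)) + (mderiv 𝓘(ℝ, F) 𝓘(ℝ, E) S.sec b).toLinearMap.comp
      (LinearMap.snd ℝ ℝ F)
  have hsurj : Function.Surjective T := fun v =>
    ⟨(mderiv 𝓘(ℝ, E) 𝓘(ℝ, ℝ) S.time (S.sec b) v,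
      mderiv 𝓘(ℝ, E) 𝓘(ℝ, F) S.coord (S.sec b) v), (S.eq_time_smul_add hs hR hb v).symm⟩
  have hinj : Function.Injective T :=
    (LinearMap.injective_iff_surjective_of_finrank_eq_finrank (by simp [hdim, add_comm])).2 hsurj
  have h0 : T (-t, y) = T 0 := by
    rw [map_zero]
    change (-t) • R (S.sec b) + mderiv 𝓘(ℝ, F) 𝓘(ℝ, E) S.sec b y = 0
    rw [h, neg_smul, neg_add_cancel]
  have h1 := Prod.ext_iff.1 (hinj h0)
  exact ⟨by simpa using h1.1, h1.2⟩

end Slice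

variable [IsManifold 𝓘(ℝ, E) ∞ P]

namespace Slice

theorem omega_apply (hα : α.IsSmooth) (S : Slice E P F) {x : EuclideanSpace ℝ (Fin m)}
    (hx : x ∈ S.chartDom K) (u w : EuclideanSpace ℝ (Fin m)) :
    S.omega K α x ![u, w] = naturalValue (fiberCoord K x)
      (α.pullback (S.secMap K) x ![u]) (α.pullback (S.secMap K) x ![w])
      (fiberCoord K u) (fiberCoord K w) (α.d.pullback (S.secMap K) x ![u, w]) :=
  extDeriv_naturalPrimitive hα (S.contMDiffAt_secMap K hx) _ u w

theorem contDiffAt_omega (hα : α.IsSmooth) (S : Slice E P F) {x : EuclideanSpace ℝ (Fin m)}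
    (hx : x ∈ S.chartDom K) : ContDiffAt ℝ ∞ (S.omega K α) x := by
  have h := (contDiffAt_naturalPrimitive hα (S.contMDiffAt_secMap K hx)
    (fiberCoord K)).fderiv_right (m := ∞) (by simp)
  exact (ContinuousAlternatingMap.alternatizeUncurryFinCLM ℝ (EuclideanSpace ℝ (Fin m))
    ℝ).contDiff.contDiffAt.comp x h

theorem extDeriv_omega (hα : α.IsSmooth) (S : Slice E P F) {x : EuclideanSpace ℝ (Fin m)}
    (hx : x ∈ S.chartDom K) : extDeriv (S.omega K α) x = 0 :=
  extDeriv_extDeriv_apply (contDiffAt_naturalPrimitive hα (S.contMDiffAt_secMap K hx)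
    (fiberCoord K)) (by simpa using two_le_infty)

theorem omega_liouvilleField (hα : α.IsSmooth) (S : Slice E P F) {x : EuclideanSpace ℝ (Fin m)}
    (hx : x ∈ S.chartDom K) (hz : fiberCoord K x ≠ 0) (w : EuclideanSpace ℝ (Fin m)) :
    S.omega K α x ![liouvilleField K x, w] = liouvilleValue (fiberCoord K x)
      (α.pullback (S.secMap K) x ![w]) (fiberCoord K w) := by
  have h0 : mderiv 𝓘(ℝ, EuclideanSpace ℝ (Fin m)) 𝓘(ℝ, E) (S.secMap K) x
      (liouvilleField K x) = 0 := by
    rw [S.mderiv_secMap K hx]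
    simp [liouvilleField]
  rw [S.omega_apply K hα hx, fiberCoord_liouvilleField, ManifoldForm.pullback_apply_one,
    ManifoldForm.pullback_apply_two, h0, alternating_one_zero, alternating_two_zero_left,
    naturalValue_liouville hz]

theorem interior_omega (hα : α.IsSmooth) (S : Slice E P F) {x : EuclideanSpace ℝ (Fin m)}
    (hx : x ∈ S.chartDom K) (hz : fiberCoord K x ≠ 0) :
    OrbifoldAtlas.interior (liouvilleField K x) (S.omega K α x) =
      naturalPrimitive α (S.secMap K) (fiberCoord K) x +
        (1 / 2 : ℝ) • angularForm (fiberCoord K) x := by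
  ext v
  have hv : v = ![v 0] := by ext i; fin_cases i; rfl
  rw [hv, OrbifoldAtlas.interior_apply, S.omega_liouvilleField K hα hx hz]
  change _ = naturalPrimitive _ _ _ _ ![v 0] + (1 / 2 : ℝ) * angularForm _ _ ![v 0]
  rw [naturalPrimitive_apply, angularForm_apply, liouvilleValue]
  set z := fiberCoord K x
  set b := fiberCoord K (v 0)
  have h : ‖z‖ ^ 2 ≠ 0 := by simpa using hz
  have h2 : Complex.normSq z = ‖z‖ ^ 2 := (Complex.sq_norm z).symm
  simp only [Complex.mul_im, Complex.conj_re, Complex.conj_im, Complex.inv_re, Complex.inv_im, h2]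
  field_simp
  ring

theorem extDeriv_interior_omega (hα : α.IsSmooth) (S : Slice E P F)
    {x : EuclideanSpace ℝ (Fin m)} (hx : x ∈ S.chartDom K) (hz : fiberCoord K x ≠ 0) :
    extDeriv (fun y => OrbifoldAtlas.interior (liouvilleField K y) (S.omega K α y)) x =
      S.omega K α x := by
  have hev : (fun y => OrbifoldAtlas.interior (liouvilleField K y) (S.omega K α y)) =ᶠ[𝓝 x]
      naturalPrimitive α (S.secMap K) (fiberCoord K) +
        (1 / 2 : ℝ) • angularForm (fiberCoord K) := by
    filter_upwards [(S.isOpen_chartDom K).mem_nhds hx,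
      (fiberCoord K).continuous.continuousAt.eventually_ne hz] with y hy hyz
    exact S.interior_omega K hα hy hyz
  have hd := differentiableAt_angularForm (fiberCoord K) hz
  rw [hev.extDeriv_eq, extDeriv_add ((contDiffAt_naturalPrimitive hα (S.contMDiffAt_secMap K hx)
    (fiberCoord K)).differentiableAt (by simp)) (hd.const_smul _), extDeriv_smul,
    extDeriv_angularForm _ hz, smul_zero, add_zero]
  rfl

section Lift

variable {W : Type*} [NormedAddCommGroup W] [NormedSpace ℝ W]
  {H : Type*} [TopologicalSpace H] {I : ModelWithCorners ℝ W H} [I.Boundaryless]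
  {M : Type*} [TopologicalSpace M] [ChartedSpace H M]
  {Φ₁ : M → P} {Φ₂ : M → ℂ} {q : M}

theorem exists_values_eq (h : IsReebAction α R) (S : Slice E P F)
    (h₁ : ContMDiffAt I 𝓘(ℝ, E) ∞ Φ₁ q) (h₂ : ContMDiffAt I 𝓘(ℝ, ℂ) ∞ Φ₂ q)
    {f : M → EuclideanSpace ℝ (Fin m)} (hf : OrbifoldAtlas.IsLiftAt I (S.chart K h.action)
      (fun y => LineBundle.proj (Φ₁ y, Φ₂ y)) f q) :
    ∃ (l : Circle) (τ : W →L[ℝ] ℝ), fiberCoord K (f q) = l * Φ₂ q ∧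
      (∀ v, α.pullback (S.secMap K) (f q) ![mderiv I 𝓘(ℝ, EuclideanSpace ℝ (Fin m)) f q v] =
        α.val (Φ₁ q) ![mderiv I 𝓘(ℝ, E) Φ₁ q v] + τ v) ∧
      (∀ v, fiberCoord K (mderiv I 𝓘(ℝ, EuclideanSpace ℝ (Fin m)) f q v) =
        l * (mderiv I 𝓘(ℝ, ℂ) Φ₂ q v - Complex.I * τ v * Φ₂ q)) ∧
      ∀ v w, α.d.pullback (S.secMap K) (f q)
        ![mderiv I 𝓘(ℝ, EuclideanSpace ℝ (Fin m)) f q v,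
          mderiv I 𝓘(ℝ, EuclideanSpace ℝ (Fin m)) f q w] =
        α.d.val (Φ₁ q) ![mderiv I 𝓘(ℝ, E) Φ₁ q v, mderiv I 𝓘(ℝ, E) Φ₁ q w] := by
  obtain ⟨l, τ, hp, hz, hd, hdz⟩ := S.exists_jet_eq K h.action h.generator h₁ h₂ hf
  refine ⟨l⁻¹, τ, hz, fun v => ?_, hdz, fun v w => ?_⟩
  · rw [ManifoldForm.pullback_apply_one, hd, hp, alternating_one_add, alternating_one_smul,
      h.reeb.one, h.val_smul]
    ring
  · rw [ManifoldForm.pullback_apply_two, hd, hd, hp, alternating_two_add_left,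
      alternating_two_smul_left, h.reeb.kernel, alternating_two_add_right,
      alternating_two_smul_right, alternating_two_swap _ _ (R _), h.reeb.kernel, h.d_val_smul]
    ring

theorem omega_lift (h : IsReebAction α R) (S : Slice E P F)
    (h₁ : ContMDiffAt I 𝓘(ℝ, E) ∞ Φ₁ q) (h₂ : ContMDiffAt I 𝓘(ℝ, ℂ) ∞ Φ₂ q)
    {f : M → EuclideanSpace ℝ (Fin m)} (hf : OrbifoldAtlas.IsLiftAt I (S.chart K h.action)
      (fun y => LineBundle.proj (Φ₁ y, Φ₂ y)) f q) (v w : W) :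
    S.omega K α (f q) ![mderiv I 𝓘(ℝ, EuclideanSpace ℝ (Fin m)) f q v,
        mderiv I 𝓘(ℝ, EuclideanSpace ℝ (Fin m)) f q w] =
      naturalValue (Φ₂ q) (α.val (Φ₁ q) ![mderiv I 𝓘(ℝ, E) Φ₁ q v])
        (α.val (Φ₁ q) ![mderiv I 𝓘(ℝ, E) Φ₁ q w]) (mderiv I 𝓘(ℝ, ℂ) Φ₂ q v)
        (mderiv I 𝓘(ℝ, ℂ) Φ₂ q w)
        (α.d.val (Φ₁ q) ![mderiv I 𝓘(ℝ, E) Φ₁ q v, mderiv I 𝓘(ℝ, E) Φ₁ q w]) := by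
  obtain ⟨l, τ, hz, hA, ha, hD⟩ := S.exists_values_eq K h h₁ h₂ hf
  rw [S.omega_apply K h.smooth hf.eventually.self_of_nhds.1, hz, hA, hA, ha, ha, hD,
    naturalValue_circle_mul, naturalValue_shift]

theorem liouvilleValue_lift (h : IsReebAction α R) (S : Slice E P F)
    (h₁ : ContMDiffAt I 𝓘(ℝ, E) ∞ Φ₁ q) (h₂ : ContMDiffAt I 𝓘(ℝ, ℂ) ∞ Φ₂ q)
    {f : M → EuclideanSpace ℝ (Fin m)} (hf : OrbifoldAtlas.IsLiftAt I (S.chart K h.action)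
      (fun y => LineBundle.proj (Φ₁ y, Φ₂ y)) f q) (hq : Φ₂ q ≠ 0) (v : W) :
    fiberCoord K (f q) ≠ 0 ∧ S.omega K α (f q) ![liouvilleField K (f q),
        mderiv I 𝓘(ℝ, EuclideanSpace ℝ (Fin m)) f q v] =
      liouvilleValue (Φ₂ q) (α.val (Φ₁ q) ![mderiv I 𝓘(ℝ, E) Φ₁ q v])
        (mderiv I 𝓘(ℝ, ℂ) Φ₂ q v) := by
  obtain ⟨l, τ, hz, hA, ha, -⟩ := S.exists_values_eq K h h₁ h₂ hf
  have hne : fiberCoord K (f q) ≠ 0 := by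
    rw [hz]
    simpa using hq
  refine ⟨hne, ?_⟩
  rw [S.omega_liouvilleField K h.smooth hf.eventually.self_of_nhds.1 hne, hz, hA, ha,
    liouvilleValue_circle_mul, liouvilleValue_shift hq]

end Lift

section Nondegenerate

variable [FiniteDimensional ℝ E] [FiniteDimensional ℝ F]

theorem omega_nondegenerate (h : IsReebAction α R)
    (hcontact : ∀ p v, α.val p ![v] = 0 → v ≠ 0 → ∃ w, α.val p ![w] = 0 ∧ α.d.val p ![v, w] ≠ 0)
    (hdim : Module.finrank ℝ E = Module.finrank ℝ F + 1) (S : Slice E P F)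
    {x : EuclideanSpace ℝ (Fin m)} (hx : x ∈ S.chartDom K) {u : EuclideanSpace ℝ (Fin m)}
    (hu : ∀ w, S.omega K α x ![u, w] = 0) : u = 0 := by
  set b := (K x).1 with hb
  set z := fiberCoord K x with hz
  set a := fiberCoord K u with ha
  set s := mderiv 𝓘(ℝ, F) 𝓘(ℝ, E) S.sec b (K u).1 with hs
  set A := α.val (S.sec b) ![s] with hA
  have hval : ∀ y c, naturalValue z A
      (α.val (S.sec b) ![mderiv 𝓘(ℝ, F) 𝓘(ℝ, E) S.sec b y]) a c
      (α.d.val (S.sec b) ![s, mderiv 𝓘(ℝ, F) 𝓘(ℝ, E) S.sec b y]) = 0 := by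
    intro y c
    have h1 := hu (K.symm (y, c))
    rw [S.omega_apply K h.smooth hx, ManifoldForm.pullback_apply_one,
      ManifoldForm.pullback_apply_one, ManifoldForm.pullback_apply_two,
      S.mderiv_secMap K hx, S.mderiv_secMap K hx] at h1
    have h2 : fiberCoord K (K.symm (y, c)) = c := by simp [fiberCoord]
    rw [h2, ContinuousLinearEquiv.apply_symm_apply] at h1
    exact h1
  have h0 : ∀ c, naturalValue z A 0 a c 0 = 0 := by
    intro c
    have := hval 0 c
    rwa [map_zero, alternating_one_zero, alternating_two_swap, alternating_two_zero_left,
      neg_zero] at this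
  have hre : a.re = z.im * A := by
    have := h0 Complex.I
    simp [naturalValue] at this
    linarith
  have him : a.im = - z.re * A := by
    have := h0 1
    simp [naturalValue] at this
    linarith
  have hD : ∀ y, α.d.val (S.sec b) ![s, mderiv 𝓘(ℝ, F) 𝓘(ℝ, E) S.sec b y] = 0 := by
    intro y
    have h1 := hval y 0
    have h2 : ((starRingEnd ℂ) z * a).re = 0 := by
      rw [Complex.mul_re, hre, him]
      simp
      ring
    have h3 : (1 + ‖z‖ ^ 2) / 2 ≠ 0 := by positivity
    simp only [naturalValue, h2] at h1
    simpa [h3] using h1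
  have hDR : ∀ v, α.d.val (S.sec b) ![v, R (S.sec b)] = 0 := fun v => by
    rw [alternating_two_swap, h.reeb.kernel, neg_zero]
  have hD' : ∀ v, α.d.val (S.sec b) ![s, v] = 0 := by
    intro v
    rw [S.eq_time_smul_add h.action h.generator hx v, alternating_two_add_right,
      alternating_two_smul_right, hDR, hD]
    ring
  have hsR : s = A • R (S.sec b) := by
    by_contra hne
    have hsub : s + (-A) • R (S.sec b) ≠ 0 := by
      rw [neg_smul, ← sub_eq_add_neg]
      exact sub_ne_zero.2 hne
    obtain ⟨w, -, hw⟩ := hcontact (S.sec b) (s + (-A) • R (S.sec b)) (by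
      rw [alternating_one_add, alternating_one_smul, h.reeb.one, ← hA]
      ring) hsub
    apply hw
    rw [alternating_two_add_left, alternating_two_smul_left, h.reeb.kernel, hD']
    ring
  obtain ⟨hA0, hu1⟩ := S.eq_zero_of_mderiv_sec h.action h.generator hdim hx hsR
  have ha0 : (K u).2 = 0 := by
    change a = 0
    rw [hA0] at hre him
    exact Complex.ext (by simpa using hre) (by simpa using him)
  exact K.map_eq_zero_iff.1 (Prod.ext hu1 ha0)

end Nondegenerate

end Slice

end SymplecticChart

section SliceTransition

variable {E : Type*} [NormedAddCommGroup E] [NormedSpace ℝ E]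
  {P : Type*} [TopologicalSpace P] [ChartedSpace E P] [MulAction Circle P]
  {F : Type*} [NormedAddCommGroup F] [NormedSpace ℝ F]
  {m : ℕ} {K : EuclideanSpace ℝ (Fin m) ≃L[ℝ] F × ℂ} {α : ManifoldForm 𝓘(ℝ, E) P 1} {R : P → E}

namespace Slice

theorem isLiftAt_of_isTransition (hs : IsSmoothCircleAction E P) {S S' : Slice E P F}
    {g : OpenPartialHomeomorph (EuclideanSpace ℝ (Fin m)) (EuclideanSpace ℝ (Fin m))}
    (hg : (S.chart K hs).IsTransition (S'.chart K hs) g) {x : EuclideanSpace ℝ (Fin m)}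
    (hx : x ∈ g.source) : OrbifoldAtlas.IsLiftAt 𝓘(ℝ, EuclideanSpace ℝ (Fin m)) (S'.chart K hs)
      (fun y => LineBundle.proj (S.secMap K y, fiberCoord K y)) g x where
  contMDiffAt := (hg.contDiffOn.contDiffAt (g.open_source.mem_nhds hx)).contMDiffAt
  eventually := by
    filter_upwards [g.open_source.mem_nhds hx] with y hy
    exact ⟨hg.target_subset (g.map_source hy), hg.toFun_eq y hy⟩

theorem fiberCoord_eq_zero_of_act_eq (S : Slice E P F) {g : S.Γ} (hg : g ≠ 1)
    {y : EuclideanSpace ℝ (Fin m)} (hy : y ∈ S.chartDom K) (hgy : S.act K g y = y) :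
    fiberCoord K y = 0 := by
  by_contra hz
  have h1 := S.lift_act K g hy
  rw [hgy] at h1
  have h2 : (K y).2 = (((g : Circle)⁻¹ : Circle) : ℂ) * (K y).2 := (Prod.ext_iff.1 h1).2
  have h3 : (((g : Circle)⁻¹ : Circle) : ℂ) = 1 :=
    (mul_right_cancel₀ (a := 1) hz ((one_mul _).trans h2)).symm
  have h4 : (g : Circle)⁻¹ = 1 := Circle.ext (by simpa using h3)
  exact hg (Subtype.ext (inv_eq_one.1 h4))

variable [IsManifold 𝓘(ℝ, E) ∞ P]

theorem omega_isLiftAt (h : IsReebAction α R) (S S' : Slice E P F)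
    {x : EuclideanSpace ℝ (Fin m)} (hx : x ∈ S.chartDom K)
    {f : EuclideanSpace ℝ (Fin m) → EuclideanSpace ℝ (Fin m)}
    (hf : OrbifoldAtlas.IsLiftAt 𝓘(ℝ, EuclideanSpace ℝ (Fin m)) (S'.chart K h.action)
      (fun y => LineBundle.proj (S.secMap K y, fiberCoord K y)) f x)
    (v w : EuclideanSpace ℝ (Fin m)) :
    S'.omega K α (f x) ![fderiv ℝ f x v, fderiv ℝ f x w] = S.omega K α x ![v, w] := by
  have h1 := S'.omega_lift K h (S.contMDiffAt_secMap K hx)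
    (fiberCoord K).contDiff.contMDiff.contMDiffAt hf v w
  rw [mderiv_eq_fderiv, mderiv_eq_fderiv, ContinuousLinearMap.fderiv] at h1
  rw [h1, S.omega_apply K h.smooth hx, ManifoldForm.pullback_apply_one,
    ManifoldForm.pullback_apply_one, ManifoldForm.pullback_apply_two]

end Slice

end SliceTransition

theorem LineBundle.isOpen_compl_zeroSection {P : Type*} [TopologicalSpace P]
    [MulAction Circle P] [ContinuousSMul Circle P] : IsOpen (LineBundle.zeroSection P)ᶜ := by
  rw [← LineBundle.isOpenQuotientMap_proj.isQuotientMap.isOpen_preimage]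
  have : (LineBundle.proj : P × ℂ → LineBundle P) ⁻¹' (LineBundle.zeroSection P)ᶜ =
      {a | a.2 ≠ 0} := by
    ext ⟨p, z⟩
    exact LineBundle.proj_mem_zeroSection.not
  rw [this]
  exact isOpen_ne_fun continuous_snd continuous_const

section LineBundleAtlas

variable {E : Type*} [NormedAddCommGroup E] [NormedSpace ℝ E] [FiniteDimensional ℝ E]
  {P : Type*} [TopologicalSpace P] [ChartedSpace E P] [MulAction Circle P]
  [IsManifold 𝓘(ℝ, E) ∞ P]
  {F : Type*} [NormedAddCommGroup F] [NormedSpace ℝ F] [FiniteDimensional ℝ F]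
  {m : ℕ} {K : EuclideanSpace ℝ (Fin m) ≃L[ℝ] F × ℂ} {α : ManifoldForm 𝓘(ℝ, E) P 1} {R : P → E}

/-- The nondegeneracy condition of a contact form. -/
def IsContactNondegenerate (α : ManifoldForm 𝓘(ℝ, E) P 1) : Prop :=
  ∀ p v, α.val p ![v] = 0 → v ≠ 0 → ∃ w, α.val p ![w] = 0 ∧ α.d.val p ![v, w] ≠ 0

namespace Slice

theorem exists_equiv_of_isLiftAt (h : IsReebAction α R) (hα : IsContactNondegenerate α)
    (hdim : Module.finrank ℝ E = Module.finrank ℝ F + 1) (S S' : Slice E P F)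
    {x : EuclideanSpace ℝ (Fin m)} (hx : x ∈ S.chartDom K)
    {f : EuclideanSpace ℝ (Fin m) → EuclideanSpace ℝ (Fin m)}
    (hf : OrbifoldAtlas.IsLiftAt 𝓘(ℝ, EuclideanSpace ℝ (Fin m)) (S'.chart K h.action)
      (fun y => LineBundle.proj (S.secMap K y, fiberCoord K y)) f x) :
    ∃ L : EuclideanSpace ℝ (Fin m) ≃L[ℝ] EuclideanSpace ℝ (Fin m),
      fderiv ℝ f x = (L : EuclideanSpace ℝ (Fin m) →L[ℝ] EuclideanSpace ℝ (Fin m)) := by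
  have hinj : Function.Injective (fderiv ℝ f x) := by
    rw [injective_iff_map_eq_zero]
    intro u hu
    refine S.omega_nondegenerate K h hα hdim hx fun w => ?_
    rw [← S.omega_isLiftAt h S' hx hf, hu, alternating_two_zero_left]
  exact ⟨(LinearEquiv.ofInjectiveEndo (fderiv ℝ f x).toLinearMap hinj).toContinuousLinearEquiv,
    ContinuousLinearMap.ext fun v => rfl⟩

theorem exists_isTransition (h : IsReebAction α R) (hα : IsContactNondegenerate α)
    (hdim : Module.finrank ℝ E = Module.finrank ℝ F + 1) (S S' : Slice E P F)
    {x y : EuclideanSpace ℝ (Fin m)} (hx : x ∈ S.chartDom K) (hy : y ∈ S'.chartDom K)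
    (hxy : (S.chart K h.action).toFun x = (S'.chart K h.action).toFun y) :
    ∃ g, (S.chart K h.action).IsTransition (S'.chart K h.action) g ∧ x ∈ g.source ∧ g x = y := by
  obtain ⟨l, hl, -, hly⟩ := S'.exists_smul_eq_lift K hy (p := S.secMap K x)
    (z := fiberCoord K x) hxy.symm
  let f : EuclideanSpace ℝ (Fin m) → EuclideanSpace ℝ (Fin m) := fun x =>
    S'.retract K (l • S.secMap K x, ((l⁻¹ : Circle) : ℂ) * fiberCoord K x)
  let U : Set (EuclideanSpace ℝ (Fin m)) := {x | x ∈ S.chartDom K ∧ l • S.secMap K x ∈ S'.nbhd}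
  have hU : IsOpen U := by
    rw [isOpen_iff_mem_nhds]
    intro x hx
    exact Filter.inter_mem ((S.isOpen_chartDom K).mem_nhds hx.1)
      ((h.action.smul l (S.contMDiffAt_secMap K hx.1)).continuousAt.preimage_mem_nhds
        (S'.isOpen_nbhd.mem_nhds hx.2))
  have hlift : ∀ x ∈ U, OrbifoldAtlas.IsLiftAt 𝓘(ℝ, EuclideanSpace ℝ (Fin m))
      (S'.chart K h.action) (fun y => LineBundle.proj (S.secMap K y, fiberCoord K y)) f x :=
    fun x hx => S'.isLiftAt_retract K h.action (S.contMDiffAt_secMap K hx.1)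
      (fiberCoord K).contDiff.contMDiff.contMDiffAt l hx.2
  have hsmooth : ∀ x ∈ U, ContDiffAt ℝ ∞ f x := fun x hx =>
    contMDiffAt_iff_contDiffAt.1 (hlift x hx).contMDiffAt
  obtain ⟨e, hxe, heU, hef, hsymm⟩ := exists_openPartialHomeomorph_contDiffOn_symm hU hsmooth
    (fun x hx => by
      obtain ⟨L, hL⟩ := S.exists_equiv_of_isLiftAt h hα hdim S' hx.1 (hlift x hx)
      exact ⟨L, hL ▸ ((hsmooth x hx).differentiableAt (by simp)).hasFDerivAt⟩) (a := x) ⟨hx, hl⟩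
  refine ⟨e, ⟨fun x hx => (heU hx).1, ?_, ?_, fun y hy => (hsymm y hy).contDiffWithinAt, ?_⟩, hxe,
    by rw [hef]; exact hly⟩
  · intro y hy
    have hm := e.map_target hy
    have := (hlift _ (heU hm)).eventually.self_of_nhds.1
    rw [← hef, e.right_inv hy] at this
    exact this
  · rw [hef]
    exact fun x hx => (hsmooth x (heU hx)).contDiffWithinAt
  · intro x hx
    rw [hef]
    exact (hlift x (heU hx)).eventually.self_of_nhds.2

theorem fderiv_liouvilleField (h : IsReebAction α R) (hα : IsContactNondegenerate α)
    (hdim : Module.finrank ℝ E = Module.finrank ℝ F + 1) (S S' : Slice E P F)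
    {x : EuclideanSpace ℝ (Fin m)} (hx : x ∈ S.chartDom K) (hz : fiberCoord K x ≠ 0)
    {f : EuclideanSpace ℝ (Fin m) → EuclideanSpace ℝ (Fin m)}
    (hf : OrbifoldAtlas.IsLiftAt 𝓘(ℝ, EuclideanSpace ℝ (Fin m)) (S'.chart K h.action)
      (fun y => LineBundle.proj (S.secMap K y, fiberCoord K y)) f x) :
    fderiv ℝ f x (liouvilleField K x) = liouvilleField K (f x) := by
  obtain ⟨L, hL⟩ := S.exists_equiv_of_isLiftAt h hα hdim S' hx hf
  have hfx : f x ∈ S'.chartDom K := hf.eventually.self_of_nhds.1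
  have key : fderiv ℝ f x (liouvilleField K x) + (-1 : ℝ) • liouvilleField K (f x) = 0 := by
    refine S'.omega_nondegenerate K h hα hdim hfx fun w => ?_
    obtain ⟨v, rfl⟩ := L.surjective w
    have hLv : L v = fderiv ℝ f x v := by rw [hL]; rfl
    have h1 := (S'.liouvilleValue_lift K h (S.contMDiffAt_secMap K hx)
      (fiberCoord K).contDiff.contMDiff.contMDiffAt hf hz v).2
    rw [mderiv_eq_fderiv, mderiv_eq_fderiv, ContinuousLinearMap.fderiv] at h1
    rw [hLv, alternating_two_add_left, alternating_two_smul_left, S.omega_isLiftAt h S' hx hf,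
      S.omega_liouvilleField K h.smooth hx hz, ManifoldForm.pullback_apply_one, h1]
    ring
  rw [neg_one_smul, ← sub_eq_add_neg] at key
  exact sub_eq_zero.1 key

end Slice

variable (K) in
/-- The orbifold atlas of the line bundle, consisting of the charts defined by all slices. -/
def lineBundleAtlas [CompactSpace P] [T2Space P] (h : IsReebAction α R)
    (hα : IsContactNondegenerate α) (hdim : Module.finrank ℝ E = Module.finrank ℝ F + 1)
    (hslice : ∀ p : P, ∃ S : Slice E P F, ∃ b ∈ S.base, S.sec b = p) :
    OrbifoldAtlas m (LineBundle P) where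
  t2 := by
    have := h.action.continuousSMul
    infer_instance
  secondCountable := by
    have := h.action.continuousSMul
    have := ChartedSpace.secondCountable_of_sigmaCompact E P
    infer_instance
  charts := range fun S : Slice E P F => S.chart K h.action
  cover := by
    intro x
    obtain ⟨p, z, rfl⟩ := LineBundle.exists_proj x
    obtain ⟨S, b, hb, rfl⟩ := hslice p
    refine ⟨_, ⟨S, rfl⟩, K.symm (b, z), ?_, ?_⟩
    · change (K (K.symm (b, z))).1 ∈ S.base
      simpa using hb
    · change LineBundle.proj (S.sec (K (K.symm (b, z))).1, (K (K.symm (b, z))).2) = _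
      simp
  compatible := by
    rintro _ ⟨S, rfl⟩ _ ⟨S', rfl⟩ x hx y hy hxy
    exact S.exists_isTransition h hα hdim S' hx hy hxy

section Structures

variable [CompactSpace P] [T2Space P] {h : IsReebAction α R} {hα : IsContactNondegenerate α}
  {hdim : Module.finrank ℝ E = Module.finrank ℝ F + 1}
  {hslice : ∀ p : P, ∃ S : Slice E P F, ∃ b ∈ S.base, S.sec b = p}

/-- A slice which defines a given chart of the atlas. -/
def sliceOf (c : (lineBundleAtlas K h hα hdim hslice).charts) : Slice E P F := c.2.choose

theorem chart_sliceOf (c : (lineBundleAtlas K h hα hdim hslice).charts) :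
    (sliceOf c).chart K h.action = c.1 := c.2.choose_spec

variable (K h hα hdim hslice) in
/-- The symplectic form of the line bundle. -/
def lineBundleForm : (lineBundleAtlas K h hα hdim hslice).Form 2 where
  toFun c := (sliceOf c).omega K α
  contDiffOn c := by
    rw [← chart_sliceOf c]
    exact fun x hx => ((sliceOf c).contDiffAt_omega K h.smooth hx).contDiffWithinAt
  invariant c c' g hg x hx := by
    rw [← chart_sliceOf c, ← chart_sliceOf c'] at hg
    ext v
    have hv : v = ![v 0, v 1] := by ext i; fin_cases i <;> rfl
    have h1 := (sliceOf c).omega_isLiftAt h (sliceOf c') (hg.source_subset hx)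
      (Slice.isLiftAt_of_isTransition h.action hg hx) (v 0) (v 1)
    rw [← hv] at h1
    rw [← h1]
    change (sliceOf c').omega K α (g x) (fun i => fderiv ℝ g x (v i)) = _
    congr 1
    ext i; fin_cases i <;> rfl

theorem fiberCoord_ne_zero_iff (c : (lineBundleAtlas K h hα hdim hslice).charts)
    (x : EuclideanSpace ℝ (Fin m)) :
    c.1.toFun x ∈ (LineBundle.zeroSection P)ᶜ ↔ fiberCoord K x ≠ 0 := by
  rw [← chart_sliceOf c, mem_compl_iff]
  exact LineBundle.proj_mem_zeroSection.not

variable (K h hα hdim hslice) in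
/-- The Liouville field of the line bundle. -/
def lineBundleField :
    (lineBundleAtlas K h hα hdim hslice).VectorFieldOn (LineBundle.zeroSection P)ᶜ where
  isOpen := by
    have := h.action.continuousSMul
    exact LineBundle.isOpen_compl_zeroSection
  toFun _ := liouvilleField K
  contDiffOn c x hx := (contDiffAt_liouvilleField K
    ((fiberCoord_ne_zero_iff c x).1 hx.2)).contDiffWithinAt
  invariant c c' g hg x hx hxV := by
    rw [fiberCoord_ne_zero_iff] at hxV
    rw [← chart_sliceOf c, ← chart_sliceOf c'] at hg
    exact (sliceOf c).fderiv_liouvilleField h hα hdim (sliceOf c') (hg.source_subset hx) hxV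
      (Slice.isLiftAt_of_isTransition h.action hg hx)

theorem isSymplectic_lineBundleForm :
    OrbifoldAtlas.IsSymplectic (lineBundleForm K h hα hdim hslice) where
  closed c x hx := by
    rw [← chart_sliceOf c] at hx
    exact (sliceOf c).extDeriv_omega K h.smooth hx
  nondegenerate c x hx v hv := by
    rw [← chart_sliceOf c] at hx
    by_contra! hcon
    exact hv ((sliceOf c).omega_nondegenerate K h hα hdim hx hcon)

theorem isLiouville_lineBundleField :
    OrbifoldAtlas.IsLiouville (lineBundleField K h hα hdim hslice)
      (lineBundleForm K h hα hdim hslice) := by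
  intro c x hx hxV
  rw [fiberCoord_ne_zero_iff] at hxV
  rw [← chart_sliceOf c] at hx
  exact (sliceOf c).extDeriv_interior_omega K h.smooth hx hxV

theorem mem_zeroSection_of_isSingular (x : LineBundle P)
    (hx : (lineBundleAtlas K h hα hdim hslice).IsSingular x) : x ∈ LineBundle.zeroSection P := by
  obtain ⟨_, ⟨S, rfl⟩, y, hy, rfl, g, hg, hgy⟩ := hx
  exact LineBundle.proj_mem_zeroSection.2 (S.fiberCoord_eq_zero_of_act_eq hg hy hgy)

theorem isSubmersion_proj : (lineBundleAtlas K h hα hdim hslice).IsSubmersion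
    (𝓘(ℝ, E).prod 𝓘(ℝ, ℂ)) (LineBundle.proj : P × ℂ → LineBundle P) := by
  rintro ⟨p, z⟩ _ ⟨S, rfl⟩ x hx hxq
  obtain ⟨l, hl, hlift, hret⟩ := S.exists_smul_eq_lift K hx hxq
  have hlift' := S.isLiftAt_retract K h.action (I := 𝓘(ℝ, E).prod 𝓘(ℝ, ℂ)) (q := (p, z))
    (Φ₁ := Prod.fst) (Φ₂ := Prod.snd) contMDiffAt_fst contMDiffAt_snd l hl
  refine ⟨_, hlift', hret, ?_⟩
  set f : P × ℂ → EuclideanSpace ℝ (Fin m) :=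
    fun y => S.retract K (l • y.1, ((l⁻¹ : Circle) : ℂ) * y.2)
  let j : EuclideanSpace ℝ (Fin m) → P × ℂ := fun y =>
    (l⁻¹ • S.secMap K y, (l : ℂ) * fiberCoord K y)
  have hj0 : j x = (p, z) := by
    have h1 : S.secMap K x = l • p := (Prod.ext_iff.1 hlift).1
    have h2 : fiberCoord K x = ((l⁻¹ : Circle) : ℂ) * z := (Prod.ext_iff.1 hlift).2
    simp [j, h1, h2]
  have hj : ContMDiffAt 𝓘(ℝ, EuclideanSpace ℝ (Fin m)) (𝓘(ℝ, E).prod 𝓘(ℝ, ℂ)) ∞ j x := by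
    refine (h.action.smul _ (S.contMDiffAt_secMap K hx)).prodMk ?_
    exact (contDiff_const.mul (fiberCoord K).contDiff).contMDiff.contMDiffAt
  have hfd : MDifferentiableAt (𝓘(ℝ, E).prod 𝓘(ℝ, ℂ)) 𝓘(ℝ, EuclideanSpace ℝ (Fin m)) f (p, z) :=
    hlift'.contMDiffAt.mdifferentiableAt (by simp)
  change Function.Surjective
    (mderiv (𝓘(ℝ, E).prod 𝓘(ℝ, ℂ)) 𝓘(ℝ, EuclideanSpace ℝ (Fin m)) f (p, z))
  intro v
  refine ⟨mderiv 𝓘(ℝ, EuclideanSpace ℝ (Fin m)) (𝓘(ℝ, E).prod 𝓘(ℝ, ℂ)) j x v, ?_⟩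
  rw [← hj0] at hfd ⊢
  rw [← mderiv_comp_apply x hfd (hj.mdifferentiableAt (by simp))]
  have hev : (fun y => f (j y)) =ᶠ[𝓝 x] fun y => y := by
    filter_upwards [(S.isOpen_chartDom K).mem_nhds hx] with y hy
    have h1 := S.retract_lift K hy
    rw [S.lift_eq] at h1
    simpa [f, j] using h1
  rw [mderiv_congr hev, mderiv_id]
  rfl

theorem isRegularEmbedding_unitSection : (lineBundleAtlas K h hα hdim hslice).IsRegularEmbedding
    𝓘(ℝ, E) (LineBundle.unitSection : P → LineBundle P) where
  isEmbedding := by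
    have := h.action.continuousSMul
    exact LineBundle.isEmbedding_unitSection
  regular q hq := one_ne_zero (LineBundle.proj_mem_zeroSection.1
    (mem_zeroSection_of_isSingular _ hq))
  immersion := by
    rintro q _ ⟨S, rfl⟩ x hx hxq
    obtain ⟨l, hl, hlift, hret⟩ := S.exists_smul_eq_lift K hx hxq
    have hlift' := S.isLiftAt_retract K h.action (I := 𝓘(ℝ, E)) (q := q)
      (Φ₁ := fun p => p) (Φ₂ := fun _ => 1) contMDiffAt_id contMDiffAt_const l hl
    refine ⟨_, hlift', hret, ?_⟩
    set f : P → EuclideanSpace ℝ (Fin m) :=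
      fun y => S.retract K (l • y, ((l⁻¹ : Circle) : ℂ) * 1)
    change Function.Injective (mderiv 𝓘(ℝ, E) 𝓘(ℝ, EuclideanSpace ℝ (Fin m)) f q)
    rw [injective_iff_map_eq_zero]
    intro v hv
    have hc : mderiv 𝓘(ℝ, E) 𝓘(ℝ, ℂ) (fun _ : P => (1 : ℂ)) q = 0 := mfderiv_const
    have hv1 : α.val q ![v] = 0 := by
      have h1 := (S.liouvilleValue_lift K h (Φ₁ := fun p => p) (Φ₂ := fun _ => 1)
        contMDiffAt_id contMDiffAt_const hlift' one_ne_zero v).2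
      rw [hv, alternating_two_swap, alternating_two_zero_left, neg_zero, hc, mderiv_id] at h1
      simpa [liouvilleValue] using h1.symm
    by_contra hne
    obtain ⟨w, hw, hvw⟩ := hα q v hv1 hne
    have h2 := S.omega_lift K h (Φ₁ := fun p => p) (Φ₂ := fun _ => 1)
      contMDiffAt_id contMDiffAt_const hlift' v w
    rw [hv, alternating_two_zero_left, hc, mderiv_id] at h2
    simp [naturalValue, hv1] at h2
    exact hvw h2.symm

theorem isPullback_unitSection : OrbifoldAtlas.IsPullback 𝓘(ℝ, E)
    (LineBundle.unitSection : P → LineBundle P) (OrbifoldAtlas.contract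
      (lineBundleField K h hα hdim hslice) (lineBundleForm K h hα hdim hslice)) α := by
  intro q c f hf v
  rw [← chart_sliceOf c] at hf
  have hc : mderiv 𝓘(ℝ, E) 𝓘(ℝ, ℂ) (fun _ : P => (1 : ℂ)) q = 0 := mfderiv_const
  have h1 := ((sliceOf c).liouvilleValue_lift K h (Φ₁ := fun p => p) (Φ₂ := fun _ => 1)
    contMDiffAt_id contMDiffAt_const hf one_ne_zero (v 0)).2
  rw [hc, mderiv_id] at h1
  have h2 : liouvilleValue 1 (α.val q ![v 0]) 0 = α.val q ![v 0] := by simp [liouvilleValue]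
  have hv : v = ![v 0] := by ext i; fin_cases i; rfl
  rw [← OrbifoldAtlas.interior_apply] at h1
  change OrbifoldAtlas.interior (liouvilleField K (f q)) ((sliceOf c).omega K α (f q))
    (fun i => mderiv 𝓘(ℝ, E) 𝓘(ℝ, EuclideanSpace ℝ (Fin m)) f q (v i)) = α.val q v
  have h3 : (fun i => mderiv 𝓘(ℝ, E) 𝓘(ℝ, EuclideanSpace ℝ (Fin m)) f q (v i)) =
      ![mderiv 𝓘(ℝ, E) 𝓘(ℝ, EuclideanSpace ℝ (Fin m)) f q (v 0)] := by
    ext i; fin_cases i; rfl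
  rw [h3, hv]
  exact h1.trans h2

theorem isConvexFilling_unitDiscBundle : OrbifoldAtlas.IsConvexFilling 𝓘(ℝ, E)
    (lineBundleForm K h hα hdim hslice) (LineBundle.unitDiscBundle P)
    (lineBundleField K h hα hdim hslice) LineBundle.unitSection α where
  symplectic := isSymplectic_lineBundleForm
  isCompact := LineBundle.isCompact_unitDiscBundle
  embedding := isRegularEmbedding_unitSection
  range_subset := by
    rintro _ ⟨p, rfl⟩ h0
    exact one_ne_zero (LineBundle.proj_mem_zeroSection.1 h0)
  liouville := isLiouville_lineBundleField
  boundary := by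
    refine ⟨LineBundle.normSqSubOne, ?_, LineBundle.unitDiscBundle_eq,
      LineBundle.range_unitSection_eq, ?_⟩
    · rintro _ ⟨S, rfl⟩
      exact ((((fiberCoord K).contDiff (n := ∞)).norm_sq ℝ).sub contDiff_const).contDiffOn
    · intro c x hx hxF
      have hz : fiberCoord K x ≠ 0 := by
        rw [← fiberCoord_ne_zero_iff c]
        obtain ⟨p, hp⟩ := hxF
        rw [← hp]
        exact fun h0 => one_ne_zero (LineBundle.proj_mem_zeroSection.1 h0)
      rw [← chart_sliceOf c]
      exact fderiv_norm_sq_liouvilleField K hz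
  restricts := isPullback_unitSection

end Structures

end LineBundleAtlas

theorem exists_continuousLinearEquiv_prod_apply_eq {E F : Type*} [NormedAddCommGroup E]
    [NormedSpace ℝ E] [FiniteDimensional ℝ E] [NormedAddCommGroup F] [NormedSpace ℝ F]
    [FiniteDimensional ℝ F] (hdim : Module.finrank ℝ E = Module.finrank ℝ F + 1) {e : E}
    (he : e ≠ 0) : ∃ j : (ℝ × F) ≃L[ℝ] E, j (1, 0) = e := by
  let j₀ : (ℝ × F) ≃L[ℝ] E := ContinuousLinearEquiv.ofFinrankEq (by simp [hdim, add_comm])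
  have h0 : j₀ (1, 0) ≠ 0 := by simp
  obtain ⟨A, hA⟩ := SeparatingDual.exists_continuousLinearEquiv_apply_eq (R := ℝ) h0 he
  exact ⟨j₀.trans A, hA⟩

theorem IsReebAction.exists_slice {E : Type*} [NormedAddCommGroup E] [NormedSpace ℝ E]
    [FiniteDimensional ℝ E] {P : Type*} [TopologicalSpace P] [ChartedSpace E P]
    [MulAction Circle P] [IsManifold 𝓘(ℝ, E) ∞ P] [T2Space P] {F : Type*} [NormedAddCommGroup F]
    [NormedSpace ℝ F] [FiniteDimensional ℝ F] {α : ManifoldForm 𝓘(ℝ, E) P 1} {R : P → E}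
    (h : IsReebAction α R) (hdim : Module.finrank ℝ E = Module.finrank ℝ F + 1) (p : P)
    (hfin : Finite (MulAction.stabilizer Circle p)) :
    ∃ S : Slice E P F, ∃ b ∈ S.base, S.sec b = p := by
  have hR0 : R p ≠ 0 := by
    intro h0
    have := h.reeb.one p
    rw [h0, alternating_one_zero] at this
    exact zero_ne_one this
  have he : mderiv 𝓘(ℝ, E) 𝓘(ℝ, E) (extChartAt 𝓘(ℝ, E) p) p (R p) ≠ 0 := by
    intro h0
    have h1 := DFunLike.congr_fun (mderiv_extChartAt_symm_comp p) (R p)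
    rw [ContinuousLinearMap.comp_apply, h0, map_zero] at h1
    exact hR0 h1.symm
  obtain ⟨j, hj⟩ := exists_continuousLinearEquiv_prod_apply_eq hdim he
  have := FiniteDimensional.complete ℝ F
  obtain ⟨B⟩ := exists_flowBox h.action h.generator p j hj
  exact exists_slice_of_flowBox h.action B hfin

end

theorem mainTheorem5 (n : ℕ) {P : Type*} [TopologicalSpace P]
    [ChartedSpace (EuclideanSpace ℝ (Fin (2 * n + 1))) P]
    [IsManifold (𝓡 (2 * n + 1)) ∞ P] [CompactSpace P] [T2Space P] [MulAction Circle P]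
    (α : ManifoldForm (𝓡 (2 * n + 1)) P 1) (hα : α.IsGeneralisedBoothbyWang) :
    ∃ (𝒜 : OrbifoldAtlas (2 * n + 1 + 1) (LineBundle P)) (Ω : 𝒜.Form 2)
      (Y : 𝒜.VectorFieldOn (LineBundle.zeroSection P)ᶜ),
      𝒜.IsSubmersion ((𝓡 (2 * n + 1)).prod 𝓘(ℝ, ℂ)) (LineBundle.proj (P := P)) ∧
      PullsBackToNaturalForm Ω α ∧
      (∀ x, 𝒜.IsSingular x → x ∈ LineBundle.zeroSection P) ∧
      OrbifoldAtlas.IsConvexFilling (𝓡 (2 * n + 1)) Ω (LineBundle.unitDiscBundle P) Y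
        LineBundle.unitSection α := by
  obtain ⟨R, hR, hgen⟩ := hα.generated
  have h : IsReebAction α (E := EuclideanSpace ℝ (Fin (2 * n + 1))) R :=
    ⟨hα.contact.smooth, hα.smooth_action, hgen, ⟨fun p => (hR p).1, fun p v => (hR p).2 v⟩⟩
  have hc : IsContactNondegenerate (E := EuclideanSpace ℝ (Fin (2 * n + 1))) α :=
    hα.contact.nondegenerate
  have hdim : Module.finrank ℝ (EuclideanSpace ℝ (Fin (2 * n + 1))) =
      Module.finrank ℝ (EuclideanSpace ℝ (Fin (2 * n))) + 1 := by simp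
  let K : EuclideanSpace ℝ (Fin (2 * n + 1 + 1)) ≃L[ℝ] EuclideanSpace ℝ (Fin (2 * n)) × ℂ :=
    ContinuousLinearEquiv.ofFinrankEq (by simp)
  have hslice := fun p => h.exists_slice hdim p (hα.finite_stabilizer p)
  refine ⟨lineBundleAtlas K h hc hdim hslice, lineBundleForm K h hc hdim hslice,
    lineBundleField K h hc hdim hslice, isSubmersion_proj, ?_, mem_zeroSection_of_isSingular,
    isConvexFilling_unitDiscBundle⟩
  intro p z c f hf v w a b
  rw [← chart_sliceOf c] at hf
  have h1 := (sliceOf c).omega_lift K h (I := (𝓡 (2 * n + 1)).prod 𝓘(ℝ, ℂ)) (q := (p, z))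
    (Φ₁ := Prod.fst) (Φ₂ := Prod.snd) contMDiffAt_fst contMDiffAt_snd hf (v, a) (w, b)
  have hfst : mderiv ((𝓡 (2 * n + 1)).prod 𝓘(ℝ, ℂ)) (𝓡 (2 * n + 1)) (Prod.fst : P × ℂ → P)
      (p, z) = ContinuousLinearMap.fst ℝ _ ℂ := mfderiv_fst
  have hsnd : mderiv ((𝓡 (2 * n + 1)).prod 𝓘(ℝ, ℂ)) 𝓘(ℝ, ℂ) (Prod.snd : P × ℂ → ℂ)
      (p, z) = ContinuousLinearMap.snd ℝ _ ℂ := mfderiv_snd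
  rw [hfst, hsnd] at h1
  exact h1
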